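/- **Setting.** A downlink has $K_{\mathrm{bs}}\ge 1$ base stations (BS's) and $K_{\mathrm{mu}}\ge 1$ users; BS $m$ has $M_m\ge1$ antennas, user $n$ has $N_n\ge1$ antennas. The fading state $\mathbf H$ consists of $N_n\times M_m$ matrices $\mathbf H_{n,m}$ whose entries are all independent, circularly symmetric complex Gaussian with mean $0$ and variance $\overline h_{n,m}>0$. When $L\ge1$ BS's are used the total power is $\mathcal P_L=\mathcal P_{\mathrm{ref}}+\kappa(L-1)$ with $\mathcal P_{\mathrm{ref}}>0$, $\kappa\ge0$; $\mathcal P_0=0$. User $n$ has QoS exponent $\theta_n>0$ and arrival rate $\overline C_n>0$; $B,T>0$ are the bandwidth and the frame length. A channel matrix $\mathbf G$ used with power $p$ has capacity $\max BT\log\det(\mathbf I+\mathbf G\boldsymbol\Xi\mathbf G^\dagger)$ over positive semidefinite $\boldsymbol\Xi$ with trace $p$ ($0$ if $\mathbf G$ has no columns). For a set $\Omega$ of BS's, $\mathbf H^{(n)}_\Omega$ is the matrix formed by the blocks $\mathbf H_{n,m}$, $m\in\Omega$. *Priority.* Let $R^{(n)}_{\max}$ be the capacity of $[\mathbf H_{n,1}\cdots\mathbf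 H_{n,K_{\mathrm{bs}}}]$ with power $\mathcal P_{K_{\mathrm{bs}}}$ and $\mathcal C^{(n)}_{\max}=-\theta_n^{-1}\log\mathbb E\,e^{-\theta_nR^{(n)}_{\max}}$. The users are ordered by decreasing $\overline C_n/\mathcal C^{(n)}_{\max}$ (highest priority first; ties are broken in any fixed way). *Candidate modes.* In each fading state: (i) For each $L=0,\dots,K_{\mathrm{bs}}$ a multi-user mode $\mathfrak M_L=(\Omega_L,\mathcal U_L)$ ($L=0$: no transmission). $\Omega_L$ is obtained by letting the users, cyclically in priority order, choose one by one the not yet chosen BS $m$ with largest $\gamma_{n,m}=\|\mathbf H_{n,m}\|_F^2/M_m$, until $L$ BS's are chosen. For a set $\mathcal U$ of users and $n\in\mathcal U$, the precoder $\boldsymbol\Gamma^{(n)}$ has as columns an orthonormal basis of the common null space of the $\mathbf H^{(i)}_{\Omega_L}$, $i\in\mathcal U\setminus\{n\}$. Starting from $\overline\Lambda=\varnothing$, one repeatedly computes, for each $n\notin\overline\Lambda$ and with $\mathcal U=\overline\Lambda\cup\{n\}$, the number $\varpi_n=\frac1{M_\Sigma}\mathbb E\{\|\mathbf H^{(n)}_{\Omega_L}\boldsymbol\Gamma^{(n)}\|_F^2\mid\boldsymbol\Gamma^{(n)}\text{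 fixed}\}$, where $M_\Sigma=\sum_{m\in\Omega_L}M_m$ (and $\varpi_n=0$ if $\boldsymbol\Gamma^{(n)}$ has no columns or $L=0$), and $\widehat\gamma_n=1$ if $0<\varpi_n\le\frac1{M_\Sigma}\|\mathbf H^{(n)}_{\Omega_L}\boldsymbol\Gamma^{(n)}\|_F^2$, $\widehat\gamma_n=0$ otherwise; the user of highest priority among those with largest $\widehat\gamma_n$ is added to $\overline\Lambda$ if its $\varpi_n$ is positive, and otherwise one stops. $\mathcal U_L$ is the final $\overline\Lambda$. With $\boldsymbol\Gamma^{(n)}$ now for $\mathcal U=\mathcal U_L$, $R^{(n)}_{\mathfrak M_L}(p)$ is the capacity of $\widehat{\boldsymbol\Gamma}{}^{(n)}_L=\mathbf H^{(n)}_{\Omega_L}\boldsymbol\Gamma^{(n)}$ with power $p$ for $n\in\mathcal U_L$, and $0$ for $n\notin\mathcal U_L$. (ii) For $1\le L\le K_{\mathrm{bs}}$ and each $n$ a single-user mode, in which the $L$ BS's with largest $\gamma_{n,m}$ serve user $n$ at the rate $R^{(n)}_{\Omega_L}$ equal to the capacity of that channel with power $\mathcal P_L$. *Problem A1.* A policy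 consists of measurable functions of $\mathbf H$: probabilities $\phi_L\ge0$ ($0\le L\le K_{\mathrm{bs}}$) and $q_{L,n}\ge0$ ($1\le L\le K_{\mathrm{bs}}$), and powers $\mathcal P^{(n)}_L\ge0$. Minimize $\mathbb E\{\sum_{L\ge1} L(\phi_L+\sum_nq_{L,n})\}$ subject to, for almost every $\mathbf H$, 1) $\sum_L\phi_L+\sum_{L,n}q_{L,n}=1$ and 2) $\sum_n\mathcal P_L^{(n)}=\mathcal P_L$ for all $L$; and, for all $n$, $$3)\quad \mathbb E\Big\{\sum_{L=0}^{K_{\mathrm{bs}}}\phi_Le^{-\theta_nR^{(n)}_{\mathfrak M_L}(\mathcal P^{(n)}_L)}+\sum_{L=1}^{K_{\mathrm{bs}}}q_{L,n}e^{-\theta_nR^{(n)}_{\Omega_L}}+\sum_{L=1}^{K_{\mathrm{bs}}}\sum_{j\ne n}q_{L,j}\Big\}-e^{-\theta_n\overline C_n}\le0 .$$ **The form (F).** Given constants $\lambda_n^*>0$ and numbers $\zeta^*_{\mathbf H,L}>0$ ($1\le L\le K_{\mathrm{bs}}$), let $\varepsilon^{(n)}_{L,j}$ be the square of the $j$-th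 largest singular value of $\widehat{\boldsymbol\Gamma}{}^{(n)}_L$, with $1/\varepsilon^{(n)}_{L,0}:=0$ and $1/\varepsilon^{(n)}_{L,j}:=\infty$ for $j$ above the rank. For $n\in\mathcal U_L$ let $(\mu^{(n)}_L,i^*)$ be the unique pair (with $i^*\ge0$ an integer that may depend on $n,L,\mathbf H$) such that $$\mu_L^{(n)}=\Big(\tfrac{\zeta^*_{\mathbf H,L}}{BT\theta_n\lambda_n^*}\Big)^{-\frac1{1+i^*BT\theta_n}}\prod_{j=1}^{i^*}\big(\varepsilon^{(n)}_{L,j}\big)^{-\frac{BT\theta_n}{1+i^*BT\theta_n}},\qquad \mu_L^{(n)}\in\Big[\tfrac1{\varepsilon^{(n)}_{L,i^*}},\tfrac1{\varepsilon^{(n)}_{L,i^*+1}}\Big).$$ A policy has the form (F) with multipliers $(\lambda^*,\zeta^*)$ if, for almost every $\mathbf H$ and all $L,n$: $(\mathcal P^{(n)}_L)^*=\big[i^*\mu^{(n)}_L-\sum_{j=1}^{i^*}1/\varepsilon^{(n)}_{L,j}\big]^+$ for $n\in\mathcal U_L$, $(\mathcal P_L^{(n)})^*=0$ for $n\notin\mathcal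 U_L$, and $\sum_n(\mathcal P_L^{(n)})^*=\mathcal P_L$; $\phi_L^*=1_{(\psi_L=\psi^*)}$ and $q^*_{L,n}=1_{(\psi_{L,n}=\psi^*)}$, where $$\psi_L=L+\sum_n\lambda_n^*e^{-\theta_nR^{(n)}_{\mathfrak M_L}((\mathcal P^{(n)}_L)^*)},\qquad \psi_{L,n}=L+\lambda_n^*e^{-\theta_nR^{(n)}_{\Omega_L}}+\sum_{j\ne n}\lambda_j^*,$$ $\psi^*=\min\{\min_{0\le L\le K_{\mathrm{bs}}}\psi_L,\ \min_{1\le L\le K_{\mathrm{bs}},\,n}\psi_{L,n}\}$, and where, if several modes attain $\psi^*$, they get equal probabilities with sum $1$; and if constraint 3) holds with equality for every $n$. **Theorem.** (a) For all constants $\lambda^*_n>0$: the pair $(\mu^{(n)}_L,i^*)$ exists and is unique for every $\mathbf H$, every $L$, every $n\in\mathcal U_L$ and every $\zeta^*_{\mathbf H,L}>0$; and for almost every $\mathbf H$ and every $L\ge1$ there is exactly one $\zeta^*_{\mathbf H,L}>0$ for which the powers of (F) satisfy $\sum_n(\mathcal P_L^{(n)})^*=\mathcal P_L$. (b) Every policy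 of the form (F) is an optimal solution of A1. Conversely, any optimal solution of A1 satisfies 3) with equality for every $n$ and, for almost every $\mathbf H$, puts positive probability only on modes that attain $\psi^*$, and its powers in every multi-user mode that it uses with positive probability are $(\mathcal P^{(n)}_L)^*$. (c) If A1 is strictly feasible, i.e. some policy satisfies 1), 2) and, for every $n$, 3) with strict inequality, then there are multipliers $\lambda_n^*>0$, $\zeta^*_{\mathbf H,L}>0$ and a policy of the form (F) with these multipliers; by (b) it is an optimal solution of A1. -/

import Mathlib

open MeasureTheory ProbabilityTheory
open scoped NNReal Matrix ComplexOrder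

noncomputable section

/-- `CN(0, v)`: the law of a circularly symmetric complex Gaussian variable with mean zero and
variance `v`, i.e. real and imaginary parts are independent `N(0, v/2)`. -/
def circularGaussian (v : ℝ≥0) : Measure ℂ :=
  ((gaussianReal 0 (v / 2)).prod (gaussianReal 0 (v / 2))).map
    fun x : ℝ × ℝ => (⟨x.1, x.2⟩ : ℂ)

/-- The squared Frobenius norm. -/
def frobSq {ι κ : Type*} [Fintype ι] [Fintype κ] (G : Matrix ι κ ℂ) : ℝ :=
  ∑ i, ∑ j, ‖G i j‖ ^ 2

/-- The capacity `max BT log det (I + G Ξ Gᴴ)` over positive semidefinite covariance matrices `Ξ`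
with trace `p` (here `c` stands for `BT`).  If `G` has no columns and `p ≠ 0` there is no such `Ξ`
and the value is `0`, which is the convention for a precoder that does not exist. -/
def mimoCapacity {ι κ : Type*} [Fintype ι] [DecidableEq ι] [Fintype κ]
    (c : ℝ) (G : Matrix ι κ ℂ) (p : ℝ) : ℝ :=
  sSup {r : ℝ | ∃ Ξ : Matrix κ κ ℂ, Ξ.PosSemidef ∧ Ξ.trace = (p : ℂ) ∧
    r = c * Real.log (1 + G * Ξ * Gᴴ).det.re}

/-- `ε_j` for `j ≥ 1`: the square of the `j`-th largest singular value of `G`. -/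
def subchannelSNR {ι κ : Type*} [Fintype ι] [Fintype κ] [DecidableEq κ]
    (G : Matrix ι κ ℂ) (j : ℕ) : ℝ :=
  (G.toEuclideanLin.singularValues (j - 1)) ^ 2

/-- The breakpoints `1 / ε_j`, with `1 / ε_0 = 0` and `1 / ε_j = ∞` for `j` above the rank. -/
def breakpoint {ι κ : Type*} [Fintype ι] [Fintype κ] [DecidableEq κ]
    (G : Matrix ι κ ℂ) (j : ℕ) : EReal :=
  if j = 0 then 0 else if j ≤ G.rank then ((1 / subchannelSNR G j : ℝ) : EReal) else ⊤

/-- The parameters of the distributed MIMO downlink with `Kbs` base stations and `Kmu` users. -/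
structure DownlinkSystem (Kbs Kmu : ℕ) where
  /-- numbers of transmit antennas of the base stations -/
  M : Fin Kbs → ℕ
  /-- numbers of receive antennas of the users -/
  N : Fin Kmu → ℕ
  /-- variances of the channel gains -/
  hbar : Fin Kmu → Fin Kbs → ℝ≥0
  /-- bandwidth -/
  B : ℝ
  /-- length of a time frame -/
  T : ℝ
  /-- reference power -/
  Pref : ℝ
  /-- power increasing rate -/
  kappa : ℝ
  /-- QoS exponents -/
  θ : Fin Kmu → ℝ
  /-- constant arrival rates -/
  Cbar : Fin Kmu → ℝ
  M_pos : ∀ m, 0 < M m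
  N_pos : ∀ n, 0 < N n
  hbar_pos : ∀ n m, 0 < hbar n m
  B_pos : 0 < B
  T_pos : 0 < T
  Pref_pos : 0 < Pref
  kappa_nonneg : 0 ≤ kappa
  θ_pos : ∀ n, 0 < θ n
  Cbar_pos : ∀ n, 0 < Cbar n

namespace DownlinkSystem

variable {Kbs Kmu : ℕ} (S : DownlinkSystem Kbs Kmu)

/-- The product `BT`. -/
def BT : ℝ := S.B * S.T

/-- A fading state: `H n m i j` is the gain between the `i`-th receive antenna of user `n` and the
`j`-th transmit antenna of base station `m`. -/
abbrev State : Type :=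
  ∀ (n : Fin Kmu) (m : Fin Kbs), Fin (S.N n) → Fin (S.M m) → ℂ

/-- The law of the fading state: independent entries `CN(0, hbar n m)`. -/
def fadingLaw : Measure S.State :=
  Measure.pi fun n => Measure.pi fun m => Measure.pi fun _ => Measure.pi fun _ =>
    circularGaussian (S.hbar n m)

/-- The total power when `L` base stations are used. -/
def totalPower (L : ℕ) : ℝ :=
  if L = 0 then 0 else S.Pref + S.kappa * ((L : ℝ) - 1)

/-- The aggregate power gain `γ_{n,m}`. -/
def aggGain (H : S.State) (n : Fin Kmu) (m : Fin Kbs) : ℝ :=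
  1 / (S.M m : ℝ) * frobSq (Matrix.of (H n m))

/-- The transmit antennas of the base stations in `Ω`. -/
abbrev Antenna (Ω : Finset (Fin Kbs)) : Type :=
  (m : {m : Fin Kbs // m ∈ Ω}) × Fin (S.M m.1)

/-- The channel matrix of user `n` from the base stations in `Ω`. -/
def channel (H : S.State) (Ω : Finset (Fin Kbs)) (n : Fin Kmu) :
    Matrix (Fin (S.N n)) (S.Antenna Ω) ℂ :=
  Matrix.of fun i a => H n a.1.1 i a.2

/-! ### Priority order of the users -/

/-- The maximum achievable rate of user `n`. -/
def maxRate (H : S.State) (n : Fin Kmu) : ℝ :=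
  mimoCapacity S.BT (S.channel H Finset.univ n) (S.totalPower Kbs)

/-- The maximum achievable effective capacity of user `n`. -/
def maxEffCapacity (n : Fin Kmu) : ℝ :=
  -(1 / S.θ n) * Real.log (∫ H, Real.exp (-(S.θ n) * S.maxRate H n) ∂S.fadingLaw)

/-- The effective-capacity fraction of user `n`. -/
def capacityFraction (n : Fin Kmu) : ℝ := S.Cbar n / S.maxEffCapacity n

/-- `π` lists the users in decreasing order of their effective-capacity fractions
(`π 0` is the user with the highest priority). -/
def IsPriorityOrder (π : Equiv.Perm (Fin Kmu)) : Prop :=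
  Antitone fun j => S.capacityFraction (π j)

/-! ### Selection of base stations and active users -/

/-- Greedy selection of `L` base stations: the `ℓ`-th one is that with the largest aggregate power
gain to user `sched ℓ` among those not selected before (the smallest index if there are several,
which has probability zero). -/
def greedyBS (sched : ℕ → Fin Kmu) (H : S.State) : ℕ → Finset (Fin Kbs)
  | 0 => ∅
  | L + 1 =>
    let Ω := greedyBS sched H L
    match ((List.finRange Kbs).filter (· ∉ Ω)).argmax (S.aggGain H (sched L)) with
    | none => Ω
    | some m => insert m Ω

/-- Priority base-station selection: the users choose in turn, cyclically, in priority order. -/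
def multiBS [NeZero Kmu] (π : Equiv.Perm (Fin Kmu)) (H : S.State) (L : ℕ) : Finset (Fin Kbs) :=
  S.greedyBS (fun l => π (Fin.ofNat Kmu l)) H L

/-- The `L` base stations with the largest aggregate power gains to user `n`. -/
def singleBS (H : S.State) (L : ℕ) (n : Fin Kmu) : Finset (Fin Kbs) :=
  S.greedyBS (fun _ => n) H L

/-- The joint null space of the channels of the users in `U` other than `n`. -/
def nullSpace (H : S.State) (Ω : Finset (Fin Kbs)) (U : Finset (Fin Kmu)) (n : Fin Kmu) :
    Submodule ℂ (EuclideanSpace ℂ (S.Antenna Ω)) :=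
  ⨅ i ∈ U.erase n, LinearMap.ker (S.channel H Ω i).toEuclideanLin

/-- The block-diagonalization precoder of user `n`: its columns are an orthonormal basis of the
joint null space of the other active users.  It has no columns if that space is trivial. -/
def precoder (H : S.State) (Ω : Finset (Fin Kbs)) (U : Finset (Fin Kmu)) (n : Fin Kmu) :
    Matrix (S.Antenna Ω) (Fin (Module.finrank ℂ (S.nullSpace H Ω U n))) ℂ :=
  Matrix.of fun a k =>
    (stdOrthonormalBasis ℂ (S.nullSpace H Ω U n) k : EuclideanSpace ℂ (S.Antenna Ω)) a

/-- The equivalent channel of user `n` after block diagonalization. -/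
def effChannel (H : S.State) (Ω : Finset (Fin Kbs)) (U : Finset (Fin Kmu)) (n : Fin Kmu) :
    Matrix (Fin (S.N n)) (Fin (Module.finrank ℂ (S.nullSpace H Ω U n))) ℂ :=
  S.channel H Ω n * S.precoder H Ω U n

/-- The number of transmit antennas of the base stations in `Ω`. -/
def antennaCount (Ω : Finset (Fin Kbs)) : ℕ := ∑ m ∈ Ω, S.M m

/-- `ϖ_n`: the average channel power gain of user `n` for the given precoder, when the active set
is `U`.  An entry of the channel matrix in a column of base station `m` has mean square modulus
`hbar n m`. -/
def avgGain (H : S.State) (Ω : Finset (Fin Kbs)) (U : Finset (Fin Kmu)) (n : Fin Kmu) : ℝ :=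
  1 / (S.antennaCount Ω : ℝ) *
    ∑ _i : Fin (S.N n), ∑ k, ∑ a : S.Antenna Ω,
      (S.hbar n a.1.1 : ℝ) * ‖S.precoder H Ω U n a k‖ ^ 2

open Classical in
/-- The indicator that the current channel of user `n` is at least as good as its average. -/
def aboveAvg (H : S.State) (Ω : Finset (Fin Kbs)) (U : Finset (Fin Kmu)) (n : Fin Kmu) : ℕ :=
  if 0 < S.avgGain H Ω U n ∧
      S.avgGain H Ω U n ≤ 1 / (S.antennaCount Ω : ℝ) * frobSq (S.effChannel H Ω U n)
  then 1 else 0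

open Classical in
/-- One loop of the joint channel-priority user selection, `V` being the set of users selected so
far.  Among the remaining users, listed by priority, take the first one that maximizes the
indicator; add it if its average gain is positive, and otherwise stop. -/
def userStep (π : Equiv.Perm (Fin Kmu)) (H : S.State) (Ω : Finset (Fin Kbs))
    (V : Finset (Fin Kmu)) : Finset (Fin Kmu) :=
  match (((List.finRange Kmu).map π).filter (· ∉ V)).argmax
      (fun n => S.aboveAvg H Ω (insert n V) n) with
  | none => V
  | some u => if 0 < S.avgGain H Ω (insert u V) u then insert u V else V

/-- The active-user set of the multi-user mode with `L` base stations.  There are at most `Kmu`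
effective loops, and a set at which the selection stops is a fixed point of `userStep`. -/
def activeUsers [NeZero Kmu] (π : Equiv.Perm (Fin Kmu)) (H : S.State) (L : ℕ) :
    Finset (Fin Kmu) :=
  (S.userStep π H (S.multiBS π H L))^[Kmu] ∅

/-! ### Rates of the candidate modes -/

/-- The equivalent channel of user `n` in the multi-user mode with `L` base stations. -/
def multiChannel [NeZero Kmu] (π : Equiv.Perm (Fin Kmu)) (H : S.State) (L : ℕ) (n : Fin Kmu) :
    Matrix (Fin (S.N n)) (Fin (Module.finrank ℂ
      (S.nullSpace H (S.multiBS π H L) (S.activeUsers π H L) n))) ℂ :=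
  S.effChannel H (S.multiBS π H L) (S.activeUsers π H L) n

/-- The rate of user `n` with power `p` in the multi-user mode with `L` base stations. -/
def multiRate [NeZero Kmu] (π : Equiv.Perm (Fin Kmu)) (H : S.State) (L : ℕ) (n : Fin Kmu)
    (p : ℝ) : ℝ :=
  if n ∈ S.activeUsers π H L then mimoCapacity S.BT (S.multiChannel π H L n) p else 0

/-- The rate of user `n` in its single-user mode with `L` base stations. -/
def singleRate (H : S.State) (L : ℕ) (n : Fin Kmu) : ℝ :=
  mimoCapacity S.BT (S.channel H (S.singleBS H L n) n) (S.totalPower L)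

/-! ### The optimization problem -/

/-- A policy.  `φ H L` is the probability of the multi-user mode with `L` base stations
(`L = 0`: no transmission), `q H l n` that of the single-user mode of user `n` with `L = l + 1`
base stations, and `pow H L n` the power of user `n` in the multi-user mode with `L` base
stations. -/
structure Policy where
  φ : S.State → Fin (Kbs + 1) → ℝ
  q : S.State → Fin Kbs → Fin Kmu → ℝ
  pow : S.State → Fin (Kbs + 1) → Fin Kmu → ℝ

variable {S}

/-- The average base-station usage. -/
def Policy.usage (p : S.Policy) : ℝ :=
  ∫ H, ((∑ L : Fin (Kbs + 1), (L.val : ℝ) * p.φ H L) +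
    ∑ l : Fin Kbs, ∑ n, ((l.val : ℝ) + 1) * p.q H l n) ∂S.fadingLaw

/-- The left-hand side of the effective-capacity constraint of user `n`. -/
def Policy.qos [NeZero Kmu] (π : Equiv.Perm (Fin Kmu)) (p : S.Policy) (n : Fin Kmu) : ℝ :=
  (∫ H, ((∑ L : Fin (Kbs + 1),
        p.φ H L * Real.exp (-(S.θ n) * S.multiRate π H L n (p.pow H L n))) +
      (∑ l : Fin Kbs, p.q H l n * Real.exp (-(S.θ n) * S.singleRate H (l.val + 1) n)) +
      ∑ l : Fin Kbs, ∑ j ∈ Finset.univ.erase n, p.q H l j) ∂S.fadingLaw)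
    - Real.exp (-(S.θ n) * S.Cbar n)

/-- Policies that are measurable functions of the fading state and satisfy, in almost every fading
state, the probability constraint and the power constraints. -/
structure Policy.Admissible (p : S.Policy) : Prop where
  meas_φ : ∀ L, AEMeasurable (fun H => p.φ H L) S.fadingLaw
  meas_q : ∀ l n, AEMeasurable (fun H => p.q H l n) S.fadingLaw
  meas_pow : ∀ L n, AEMeasurable (fun H => p.pow H L n) S.fadingLaw
  nonneg : ∀ᵐ H ∂S.fadingLaw,
    (∀ L, 0 ≤ p.φ H L) ∧ (∀ l n, 0 ≤ p.q H l n) ∧ (∀ L n, 0 ≤ p.pow H L n)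
  prob : ∀ᵐ H ∂S.fadingLaw, (∑ L, p.φ H L) + (∑ l, ∑ n, p.q H l n) = 1
  power : ∀ᵐ H ∂S.fadingLaw, ∀ L : Fin (Kbs + 1), ∑ n, p.pow H L n = S.totalPower L

/-- The feasible policies of the problem. -/
def Policy.Feasible [NeZero Kmu] (π : Equiv.Perm (Fin Kmu)) (p : S.Policy) : Prop :=
  p.Admissible ∧ ∀ n, p.qos π n ≤ 0

/-- The policies that meet every effective-capacity constraint with strict inequality. -/
def Policy.StrictlyFeasible [NeZero Kmu] (π : Equiv.Perm (Fin Kmu)) (p : S.Policy) : Prop :=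
  p.Admissible ∧ ∀ n, p.qos π n < 0

/-- The optimal solutions of the problem. -/
def Policy.IsOptimal [NeZero Kmu] (π : Equiv.Perm (Fin Kmu)) (p : S.Policy) : Prop :=
  p.Feasible π ∧ ∀ p' : S.Policy, p'.Feasible π → p.usage ≤ p'.usage

/-! ### The form of the solution -/

variable (S)

/-- The conditions that determine the water level `w.1 = μ` and the breakpoint index `w.2 = i` of
user `n` in the multi-user mode with `L` base stations, for the multipliers `lam` and `z = ζ`. -/
def IsWaterLevel [NeZero Kmu] (π : Equiv.Perm (Fin Kmu)) (lam : Fin Kmu → ℝ) (H : S.State)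
    (L : ℕ) (z : ℝ) (n : Fin Kmu) (w : ℝ × ℕ) : Prop :=
  w.1 = (z / (S.BT * S.θ n * lam n)) ^ (-(1 / (1 + (w.2 : ℝ) * (S.BT * S.θ n)))) *
      (∏ j ∈ Finset.Icc 1 w.2, subchannelSNR (S.multiChannel π H L n) j ^
        (-(S.BT * S.θ n / (1 + (w.2 : ℝ) * (S.BT * S.θ n))))) ∧
  breakpoint (S.multiChannel π H L n) w.2 ≤ (w.1 : EReal) ∧
  (w.1 : EReal) < breakpoint (S.multiChannel π H L n) (w.2 + 1)

/-- `P` is the modified water-filling power allocation in the multi-user mode with `L` base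
stations, for the multipliers `lam` and `z = ζ`. -/
def IsModifiedWaterFilling [NeZero Kmu] (π : Equiv.Perm (Fin Kmu)) (lam : Fin Kmu → ℝ)
    (H : S.State) (L : ℕ) (z : ℝ) (P : Fin Kmu → ℝ) : Prop :=
  (∀ n ∈ S.activeUsers π H L, ∃ w : ℝ × ℕ,
    (S.IsWaterLevel π lam H L z n w ∧ ∀ w', S.IsWaterLevel π lam H L z n w' → w' = w) ∧
    P n = max ((w.2 : ℝ) * w.1 -
      ∑ j ∈ Finset.Icc 1 w.2, 1 / subchannelSNR (S.multiChannel π H L n) j) 0) ∧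
  ∀ n ∉ S.activeUsers π H L, P n = 0

/-- `ψ_L`, for the powers `P` in the multi-user mode with `L` base stations. -/
def psiMulti [NeZero Kmu] (π : Equiv.Perm (Fin Kmu)) (lam : Fin Kmu → ℝ) (H : S.State)
    (P : Fin (Kbs + 1) → Fin Kmu → ℝ) (L : Fin (Kbs + 1)) : ℝ :=
  (L.val : ℝ) + ∑ n, lam n * Real.exp (-(S.θ n) * S.multiRate π H L n (P L n))

/-- `ψ_{L,n}` with `L = l + 1`. -/
def psiSingle (lam : Fin Kmu → ℝ) (H : S.State) (l : Fin Kbs) (n : Fin Kmu) : ℝ :=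
  ((l.val : ℝ) + 1) + lam n * Real.exp (-(S.θ n) * S.singleRate H (l.val + 1) n) +
    ∑ j ∈ Finset.univ.erase n, lam j

/-- `ψ*`: the minimum of all `ψ_L` and `ψ_{L,n}`. -/
def psiStar [NeZero Kbs] [NeZero Kmu] (π : Equiv.Perm (Fin Kmu)) (lam : Fin Kmu → ℝ)
    (H : S.State) (P : Fin (Kbs + 1) → Fin Kmu → ℝ) : ℝ :=
  min (Finset.univ.inf' Finset.univ_nonempty fun L : Fin (Kbs + 1) => S.psiMulti π lam H P L)
    (Finset.univ.inf' Finset.univ_nonempty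
      fun x : Fin Kbs × Fin Kmu => S.psiSingle lam H x.1 x.2)

open Classical in
/-- The number of candidate modes that attain `ψ*`. -/
def minimizerCount [NeZero Kbs] [NeZero Kmu] (π : Equiv.Perm (Fin Kmu)) (lam : Fin Kmu → ℝ)
    (H : S.State) (P : Fin (Kbs + 1) → Fin Kmu → ℝ) : ℕ :=
  (Finset.univ.filter fun L : Fin (Kbs + 1) =>
      S.psiMulti π lam H P L = S.psiStar π lam H P).card +
    (Finset.univ.filter fun x : Fin Kbs × Fin Kmu =>
      S.psiSingle lam H x.1 x.2 = S.psiStar π lam H P).card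

variable {S}

open Classical in
/-- `p` has the asserted form for the multipliers `lam` (constant) and `ζ H L` (`1 ≤ L ≤ Kbs`):
in almost every fading state the powers are given by the modified water-filling, with `ζ` such that
they add up to the total power, and all probability is put on the modes that attain `ψ*` (with
equal shares if there are several); the effective-capacity constraints hold with equality. -/
structure Policy.HasOptimalForm [NeZero Kbs] [NeZero Kmu] (π : Equiv.Perm (Fin Kmu))
    (lam : Fin Kmu → ℝ) (ζ : S.State → Fin (Kbs + 1) → ℝ) (p : S.Policy) : Prop where
  lam_pos : ∀ n, 0 < lam n
  zeta_pos : ∀ᵐ H ∂S.fadingLaw, ∀ L, L ≠ 0 → 0 < ζ H L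
  power : ∀ᵐ H ∂S.fadingLaw, ∀ L : Fin (Kbs + 1),
    S.IsModifiedWaterFilling π lam H L (ζ H L) (p.pow H L) ∧
    ∑ n, p.pow H L n = S.totalPower L
  multi : ∀ᵐ H ∂S.fadingLaw, ∀ L, p.φ H L =
    if S.psiMulti π lam H (p.pow H) L = S.psiStar π lam H (p.pow H)
    then 1 / (S.minimizerCount π lam H (p.pow H) : ℝ) else 0
  single : ∀ᵐ H ∂S.fadingLaw, ∀ l n, p.q H l n =
    if S.psiSingle lam H l n = S.psiStar π lam H (p.pow H)
    then 1 / (S.minimizerCount π lam H (p.pow H) : ℝ) else 0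
  qos_eq : ∀ n, p.qos π n = 0

end DownlinkSystem

end

/-!
The problem is linear in the probabilities, so it is solved by Lagrangian duality over the finitely
many candidate modes (`DownlinkSystem.Mode`): for multipliers `lam`, an admissible policy has a
Lagrangian that is the expectation of a mixture of the values of the modes, and pointwise this is
minimized by optimal powers in each mode followed by a uniform choice among the best modes.

*Powers.* The capacity of a matrix channel is that of parallel scalar subchannels with
water-filling (`Subchannels.isCapacity_ofMatrix`). For a fixed mode one minimizes
`∑ n, lam n * exp (-θ n * R n (P n))` under a sum power constraint. Its stationarity condition is a
water level per user coupled by one price `ζ`, and the tangent inequality of `exp` shows that such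
an allocation is a strict global minimizer (`Subchannels.IsLevel.gap`, `IsAllocation.cost_le`,
`IsAllocation.unique`, `IsAllocation.tendsto`). The equation for the level is the explicit formula
with `i*` active subchannels (`level_formula_iff`,
`DownlinkSystem.isModifiedWaterFilling_iff`). The total power is continuous and monotone in `ζ`,
so a suitable `ζ` exists and is unique as soon as some user has a nonzero effective channel, which
holds almost surely in every mode that uses a base station (`DownlinkSystem.ae_isGood`): the user
added last has a positive average gain, and a channel independent of the null space does
not annihilate it.

*Optimality.* Weak duality expresses the difference between the usage of an
admissible policy and that of a policy of the optimal form as an integral of a nonnegative function,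
minus a combination of the constraint functions that is nonpositive for feasible policies
(`DownlinkSystem.Policy.HasOptimalForm.duality`). An optimal policy makes this integrand vanish and
the constraints tight. Measurability of the optimal powers is obtained by writing them as the limit
of approximate minimizers chosen from a countable dense set
(`DownlinkSystem.measurable_modePower`).

*Existence of multipliers.* The dual function is maximized over the boxes `[1 / (k + 1), Λ] ^ Kmu`.
Its supergradient at `lam` is `meanFactor - target`, the expected violation of the constraints by
the policy of the optimal form for `lam`. Strict feasibility keeps the maximizer away from the upper
faces. A user with a very small multiplier is not served
(`DownlinkSystem.eventually_modeFactor_eq_one`), so its constraint is violated and the maximizer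
leaves the lower faces when the box is large. In the interior the supergradient is zero, provided
it is continuous, i.e. provided ties between modes do no harm: almost surely, tied modes give every
user the same rate (`DownlinkSystem.ae_factor_eq_of_tie`). To see this, multiply the channels of
one user, or of all users, by a parameter `t > 0`. The selection of the base stations does not
depend on `t`, only finitely many sets of active users occur, and the fading law does not charge a
set that meets each such curve in a null set (`DownlinkSystem.fadingLaw_null_of_scale`). If a user
gets power in only one of two tied modes, raising `t` for this user breaks the tie
(`DownlinkSystem.ae_power_pos_of_tie`). If the modes give power to the same users but differ in the
number of base stations, their values along a common scaling are, piecewise, analytic functions of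
`t` with different limits at infinity (`volume_expSum_tie`). What remains are two copies of the same
multi-user mode and modes of equal size in which the same single user gets power; there a tie
forces equal rates.
-/


noncomputable section

/-! ### The capacity of a matrix channel -/

section MatrixCapacity
variable {ι κ : Type*} [Fintype ι] [Fintype κ] [DecidableEq κ]

/-- `log det M ≤ tr M - n`, which is `log x ≤ x - 1` summed over the eigenvalues. -/
lemma Matrix.PosDef.log_det_le_trace {M : Matrix κ κ ℂ} (hM : M.PosDef) :
    Real.log M.det.re ≤ M.trace.re - Fintype.card κ := by
  have h1 : M.det.re = ∏ k, hM.isHermitian.eigenvalues k := by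
    rw [hM.isHermitian.det_eq_prod_eigenvalues]
    exact congrArg Complex.re (Complex.ofReal_prod _ _).symm
  have h2 : M.trace.re = ∑ k, hM.isHermitian.eigenvalues k := by
    rw [hM.isHermitian.trace_eq_sum_eigenvalues]
    exact congrArg Complex.re (Complex.ofReal_sum _ _).symm
  have hp : ∀ k, 0 < hM.isHermitian.eigenvalues k := fun k => hM.eigenvalues_pos k
  rw [h1, h2, Real.log_prod (fun k _ => (hp k).ne')]
  have : (Fintype.card κ : ℝ) = ∑ _k : κ, (1 : ℝ) := by simp
  rw [this, ← Finset.sum_sub_distrib]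
  exact Finset.sum_le_sum fun k _ => Real.log_le_sub_one_of_pos (hp k)

/-- A tangent bound for the log determinant at the diagonal matrix with entries `e`: the bound
`log det M ≤ tr M - n` applied after conjugation by the diagonal matrix of `e k ^ (-1/2)`. Only the
diagonal of `Ξ` enters, so that correlated inputs have no advantage. -/
lemma log_det_one_add_diagonal_le {Ξ : Matrix κ κ ℂ} (hΞ : Ξ.PosSemidef) {d e : κ → ℝ}
    (hd : ∀ k, 0 ≤ d k) (he : ∀ k, 0 < e k) :
    Real.log (1 + Matrix.diagonal (fun k => (d k : ℂ)) * Ξ).det.re ≤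
      ∑ k, (Real.log (e k) + (1 + d k * (Ξ k k).re) / e k - 1) := by
  set Ds : Matrix κ κ ℂ := Matrix.diagonal fun k => ((√(d k) : ℝ) : ℂ) with hDs
  set Es : Matrix κ κ ℂ := Matrix.diagonal fun k => (((√(e k))⁻¹ : ℝ) : ℂ) with hEs
  have hDH : Dsᴴ = Ds := by
    rw [hDs, Matrix.diagonal_conjTranspose]; congr 1; ext k
    simp
  have hEH : Esᴴ = Es := by
    rw [hEs, Matrix.diagonal_conjTranspose]; congr 1; ext k
    simp
  have hDD : Matrix.diagonal (fun k => (d k : ℂ)) = Ds * Ds := by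
    rw [hDs, Matrix.diagonal_mul_diagonal]; congr 1; ext k
    rw [← Complex.ofReal_mul, Real.mul_self_sqrt (hd k)]
  rw [hDD, Matrix.mul_assoc, Matrix.det_one_add_mul_comm]
  set A : Matrix κ κ ℂ := 1 + Ds * Ξ * Ds with hA
  have hApos : A.PosDef := by
    refine Matrix.PosDef.one.add_posSemidef ?_
    have := hΞ.mul_mul_conjTranspose_same Ds
    rwa [hDH] at this
  have hM : (Es * A * Es).PosDef := by
    have := hApos.mul_mul_conjTranspose_same (B := Es) ?_
    · rwa [hEH] at this
    · intro v w hvw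
      ext k
      have := congrFun hvw k
      simp only [hEs, Matrix.vecMul_diagonal] at this
      have hne : (((√(e k))⁻¹ : ℝ) : ℂ) ≠ 0 := by
        have := Real.sqrt_pos.2 (he k)
        exact_mod_cast (inv_pos.2 this).ne'
      exact mul_right_cancel₀ hne this
  have hdetA : 0 < A.det := hApos.det_pos
  have hdetAre : 0 < A.det.re := (Complex.pos_iff.1 hdetA).1
  have h1 : (Es * A * Es).det.re = A.det.re * ∏ k, (e k)⁻¹ := by
    rw [Matrix.det_mul, Matrix.det_mul, mul_comm Es.det, mul_assoc, ← Matrix.det_mul]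
    have : Es * Es = Matrix.diagonal fun k => (((e k)⁻¹ : ℝ) : ℂ) := by
      rw [hEs, Matrix.diagonal_mul_diagonal]; congr 1; ext k
      rw [← Complex.ofReal_mul, ← mul_inv, Real.mul_self_sqrt (he k).le]
    rw [this, Matrix.det_diagonal, ← Complex.ofReal_prod, Complex.re_mul_ofReal]
  have h2 : (Es * A * Es).trace.re = ∑ k, (1 + d k * (Ξ k k).re) / e k := by
    rw [Matrix.trace, Complex.re_sum]
    refine Finset.sum_congr rfl fun k _ => ?_
    simp only [hA, hEs, hDs, Matrix.diag_apply, Matrix.mul_diagonal, Matrix.diagonal_mul,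
      Matrix.add_apply, Matrix.one_apply_eq]
    rw [mul_comm, ← mul_assoc, ← Complex.ofReal_mul, Complex.re_ofReal_mul, ← mul_inv,
      Real.mul_self_sqrt (he k).le, mul_comm _ ((√(d k) : ℝ) : ℂ), ← mul_assoc,
      ← Complex.ofReal_mul, Real.mul_self_sqrt (hd k), Complex.add_re, Complex.re_ofReal_mul]
    simp [div_eq_inv_mul]
  have h3 := hM.log_det_le_trace
  rw [h1, h2, Real.log_mul hdetAre.ne' (Finset.prod_ne_zero_iff.2 fun k _ => (inv_pos.2 (he k)).ne'),
    Real.log_prod (fun k _ => (inv_pos.2 (he k)).ne')] at h3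
  simp only [Real.log_inv, Finset.sum_neg_distrib] at h3
  have h4 : (Fintype.card κ : ℝ) = ∑ _k : κ, (1 : ℝ) := by simp
  rw [Finset.sum_sub_distrib, Finset.sum_add_distrib, ← h4]
  linarith

/-- A spectral decomposition of `Gᴴ G` whose nonzero eigenvalues, with multiplicity, are the
`subchannelSNR G j` with `1 ≤ j ≤ rank G`. -/
lemma exists_gram_diagonalization (G : Matrix ι κ ℂ) :
    ∃ (V : Matrix κ κ ℂ) (d : κ → ℝ), Vᴴ * V = 1 ∧ V * Vᴴ = 1 ∧ (∀ k, 0 ≤ d k) ∧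
      Gᴴ * G = V * Matrix.diagonal (fun k => (d k : ℂ)) * Vᴴ ∧
      ∀ h : ℝ → ℝ, h 0 = 0 → ∑ k, h (d k) = ∑ j ∈ Finset.Icc 1 G.rank, h (subchannelSNR G j) := by
  classical
  have hA : (Gᴴ * G).IsHermitian := Matrix.isHermitian_conjTranspose_mul_self G
  refine ⟨hA.eigenvectorUnitary, hA.eigenvalues, ?_, ?_, ?_, ?_, ?_⟩
  · exact Unitary.coe_star_mul_self hA.eigenvectorUnitary
  · exact Unitary.coe_mul_star_self hA.eigenvectorUnitary
  · exact (Matrix.posSemidef_conjTranspose_mul_self G).eigenvalues_nonneg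
  · exact hA.spectral_theorem
  · intro h h0
    have hT : Matrix.toEuclideanLin (Gᴴ * G) =
        LinearMap.adjoint G.toEuclideanLin ∘ₗ G.toEuclideanLin := by
      rw [← Matrix.toEuclideanLin_conjTranspose_eq_adjoint]
      exact Matrix.toLpLin_mul_same _ _ _
    have key : ∀ i : Fin (Fintype.card κ),
        hA.eigenvalues₀ i = G.toEuclideanLin.singularValues i ^ 2 := by
      intro i
      rw [LinearMap.sq_singularValues_fin (T := G.toEuclideanLin) finrank_euclideanSpace i]
      unfold Matrix.IsHermitian.eigenvalues₀
      congr 1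
    have hs : ∑ k, h (hA.eigenvalues k) = ∑ i, h (hA.eigenvalues₀ i) := by
      unfold Matrix.IsHermitian.eigenvalues
      exact Equiv.sum_comp (Fintype.equivOfCardEq (Fintype.card_fin _)).symm
        (fun i => h (hA.eigenvalues₀ i))
    have hr : Module.finrank ℂ (LinearMap.range G.toEuclideanLin) = G.rank := by
      rw [Matrix.rank_eq_finrank_range_toLin G (EuclideanSpace.basisFun ι ℂ).toBasis
        (EuclideanSpace.basisFun κ ℂ).toBasis, Matrix.toEuclideanLin_eq_toLin_orthonormal]
    rw [hs]
    simp only [key]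
    rw [Fin.sum_univ_eq_sum_range (fun i => h (G.toEuclideanLin.singularValues i ^ 2))]
    have hle : Finset.range G.rank ⊆ Finset.range (Fintype.card κ) :=
      Finset.range_mono G.rank_le_card_width
    rw [← Finset.sum_subset hle]
    · have : Finset.Icc 1 G.rank = (Finset.range G.rank).image (· + 1) := by
        ext j; simp only [Finset.mem_Icc, Finset.mem_image, Finset.mem_range]
        constructor
        · rintro ⟨h1, h2⟩; exact ⟨j - 1, by omega, by omega⟩
        · rintro ⟨a, ha, rfl⟩; omega
      rw [this, Finset.sum_image (by intro a _ b _ hab; simpa using hab)]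
      simp [subchannelSNR]
    · intro i _ hi
      have : G.toEuclideanLin.singularValues i = 0 := by
        rw [LinearMap.singularValues_eq_zero_iff_le_finrank_range, hr]
        simpa using hi
      simp [this, h0]

lemma subchannelSNR_pos (G : Matrix ι κ ℂ) {j : ℕ} (hj : j ∈ Finset.Icc 1 G.rank) :
    0 < subchannelSNR G j := by
  classical
  rw [Finset.mem_Icc] at hj
  have hr : Module.finrank ℂ (LinearMap.range G.toEuclideanLin) = G.rank := by
    rw [Matrix.rank_eq_finrank_range_toLin G (EuclideanSpace.basisFun ι ℂ).toBasis
        (EuclideanSpace.basisFun κ ℂ).toBasis, Matrix.toEuclideanLin_eq_toLin_orthonormal]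
  unfold subchannelSNR
  have := (LinearMap.singularValues_pos_iff_lt_finrank_range (T := G.toEuclideanLin)
    (n := j - 1)).2 (by rw [hr]; omega)
  positivity

lemma subchannelSNR_antitone (G : Matrix ι κ ℂ) {i j : ℕ} (hij : i ≤ j) :
    subchannelSNR G j ≤ subchannelSNR G i := by
  unfold subchannelSNR
  exact pow_le_pow_left₀ (LinearMap.singularValues_nonneg _ _)
    (LinearMap.singularValues_antitone _ (by omega)) 2

/-- Parallel scalar channels with positive gains `snr j`, `j ∈ idx`. -/
structure Subchannels where
  idx : Finset ℕ
  snr : ℕ → ℝ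
  snr_pos : ∀ j ∈ idx, 0 < snr j

namespace Subchannels

/-- The total power that classical water-filling with water level `μ` uses. -/
def power (s : Subchannels) (μ : ℝ) : ℝ := ∑ j ∈ s.idx, max (μ - 1 / s.snr j) 0

/-- The sum of the logarithmic gains under classical water-filling with water level `μ`. -/
def logGain (s : Subchannels) (μ : ℝ) : ℝ := ∑ j ∈ s.idx, max (Real.log (μ * s.snr j)) 0

/-- `C` is the capacity function of the parallel channels, up to the factor `c`, as a function of
the power: it is attained by water-filling, and `c / μ` is a supergradient at `power μ`. -/
structure IsCapacity (c : ℝ) (s : Subchannels) (C : ℝ → ℝ) : Prop where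
  eq : ∀ μ, 0 < μ → C (s.power μ) = c * s.logGain μ
  le : ∀ μ, 0 < μ → ∀ p, 0 ≤ p → C p ≤ c * s.logGain μ + c * ((p - s.power μ) / μ)

/-- The subchannels of a matrix channel. -/
def ofMatrix (G : Matrix ι κ ℂ) : Subchannels where
  idx := Finset.Icc 1 G.rank
  snr := subchannelSNR G
  snr_pos _ hj := subchannelSNR_pos G hj

end Subchannels

variable [DecidableEq ι]

lemma det_one_add_eq_of_gram {G : Matrix ι κ ℂ} {V : Matrix κ κ ℂ} {d : κ → ℝ}
    (hG : Gᴴ * G = V * Matrix.diagonal (fun k => (d k : ℂ)) * Vᴴ) (Ξ : Matrix κ κ ℂ) :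
    (1 + G * Ξ * Gᴴ).det =
      (1 + Matrix.diagonal (fun k => (d k : ℂ)) * (Vᴴ * Ξ * V)).det := by
  rw [Matrix.mul_assoc, Matrix.det_one_add_mul_comm, Matrix.mul_assoc, Matrix.det_one_add_mul_comm,
    hG]
  conv_rhs => rw [← Matrix.mul_assoc, Matrix.det_one_add_mul_comm]
  simp only [Matrix.mul_assoc]

lemma log_det_capacity_le (G : Matrix ι κ ℂ) {Ξ : Matrix κ κ ℂ} (hΞ : Ξ.PosSemidef) {p μ : ℝ}
    (hp : Ξ.trace = (p : ℂ)) (hμ : 0 < μ) :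
    Real.log (1 + G * Ξ * Gᴴ).det.re ≤ (Subchannels.ofMatrix G).logGain μ +
      (p - (Subchannels.ofMatrix G).power μ) / μ := by
  obtain ⟨V, d, hV, hV', hd, hG, hsum⟩ := exists_gram_diagonalization G
  rw [det_one_add_eq_of_gram hG]
  have hΞ' : (Vᴴ * Ξ * V).PosSemidef := hΞ.conjTranspose_mul_mul_same V
  have htr : (Vᴴ * Ξ * V).trace = (p : ℂ) := by
    rw [Matrix.mul_assoc, Matrix.trace_mul_comm, Matrix.mul_assoc, hV', Matrix.mul_one, hp]
  set X := Vᴴ * Ξ * V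
  have h1 := log_det_one_add_diagonal_le hΞ' hd (e := fun k => max (μ * d k) 1)
    (fun k => lt_max_of_lt_right one_pos)
  have hx : ∀ k, 0 ≤ (X k k).re := fun k => (Complex.nonneg_iff.1 hΞ'.diag_nonneg).1
  have hxs : ∑ k, (X k k).re = p := by
    have := congrArg Complex.re htr
    rwa [Matrix.trace, Complex.re_sum] at this
  refine h1.trans ?_
  have e1 : (Subchannels.ofMatrix G).logGain μ = ∑ k, max (Real.log (μ * d k)) 0 := by
    rw [hsum (fun x => max (Real.log (μ * x)) 0) (by simp)]; rfl
  have e2 : (Subchannels.ofMatrix G).power μ =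
      ∑ k, (if d k = 0 then 0 else max (μ - 1 / d k) 0) := by
    rw [hsum (fun x => if x = 0 then 0 else max (μ - 1 / x) 0) (by simp)]
    refine Finset.sum_congr rfl fun j hj => ?_
    rw [if_neg (subchannelSNR_pos G hj).ne']; rfl
  rw [e1, e2, ← hxs, ← Finset.sum_sub_distrib, Finset.sum_div, ← Finset.sum_add_distrib]
  refine Finset.sum_le_sum fun k _ => ?_
  by_cases hk : 1 ≤ μ * d k
  · have hdk : 0 < d k := by
      rcases (hd k).lt_or_eq with h | h
      · exact h
      · rw [← h] at hk; norm_num at hk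
    have : 1 / d k ≤ μ := by rw [div_le_iff₀ hdk]; linarith
    rw [max_eq_left hk, max_eq_left (Real.log_nonneg hk), if_neg hdk.ne', max_eq_left (by linarith)]
    apply le_of_eq
    field_simp
    ring
  · push Not at hk
    have h0 : (if d k = 0 then (0 : ℝ) else max (μ - 1 / d k) 0) = 0 := by
      split_ifs with h
      · rfl
      · have hdk : 0 < d k := lt_of_le_of_ne (hd k) (Ne.symm h)
        have : μ < 1 / d k := by rw [lt_div_iff₀ hdk]; linarith
        exact max_eq_right (by linarith)
    rw [max_eq_right hk.le, h0]
    have h2 : d k * (X k k).re ≤ (X k k).re / μ := by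
      rw [le_div_iff₀ hμ]
      nlinarith [hx k]
    have h3 := le_max_right (Real.log (μ * d k)) 0
    rw [Real.log_one, div_one, sub_zero]
    linarith

lemma exists_covariance_waterfilling (G : Matrix ι κ ℂ) {μ : ℝ} (hμ : 0 < μ) :
    ∃ Ξ : Matrix κ κ ℂ, Ξ.PosSemidef ∧ Ξ.trace = (((Subchannels.ofMatrix G).power μ : ℝ) : ℂ) ∧
      Real.log (1 + G * Ξ * Gᴴ).det.re = (Subchannels.ofMatrix G).logGain μ := by
  obtain ⟨V, d, hV, hV', hd, hG, hsum⟩ := exists_gram_diagonalization G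
  set x : κ → ℝ := fun k => if d k = 0 then 0 else max (μ - 1 / d k) 0 with hxdef
  have hx : ∀ k, 0 ≤ x k := fun k => by
    simp only [hxdef]; split_ifs
    · exact le_rfl
    · exact le_max_right _ _
  refine ⟨V * Matrix.diagonal (fun k => (x k : ℂ)) * Vᴴ, ?_, ?_, ?_⟩
  · refine Matrix.PosSemidef.mul_mul_conjTranspose_same (Matrix.PosSemidef.diagonal ?_) V
    intro k
    exact Complex.zero_le_real.2 (hx k)
  · rw [Matrix.mul_assoc, Matrix.trace_mul_comm, Matrix.mul_assoc, hV, Matrix.mul_one,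
      Matrix.trace_diagonal, ← Complex.ofReal_sum, hsum (fun x => if x = 0 then 0 else
        max (μ - 1 / x) 0) (by simp)]
    congr 1
    refine Finset.sum_congr rfl fun j hj => ?_
    rw [if_neg (subchannelSNR_pos G hj).ne']; rfl
  · rw [det_one_add_eq_of_gram hG]
    have : Vᴴ * (V * Matrix.diagonal (fun k => (x k : ℂ)) * Vᴴ) * V =
        Matrix.diagonal (fun k => (x k : ℂ)) := by
      calc _ = (Vᴴ * V) * Matrix.diagonal (fun k => (x k : ℂ)) * (Vᴴ * V) := by
            simp only [Matrix.mul_assoc]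
        _ = _ := by rw [hV, Matrix.one_mul, Matrix.mul_one]
    rw [this, Matrix.diagonal_mul_diagonal, ← Matrix.diagonal_one, Matrix.diagonal_add,
      Matrix.det_diagonal]
    have e : ∀ k, (1 : ℂ) + (d k : ℂ) * (x k : ℂ) = ((max (μ * d k) 1 : ℝ) : ℂ) := by
      intro k
      norm_cast
      simp only [hxdef]
      split_ifs with h
      · simp [h]
      · have hdk : 0 < d k := lt_of_le_of_ne (hd k) (Ne.symm h)
        rw [mul_max_of_nonneg _ _ hdk.le, ← max_add_add_left]
        congr 1
        · field_simp; ring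
        · ring
    simp only [e]
    rw [← Complex.ofReal_prod, Complex.ofReal_re,
      Real.log_prod (fun k _ => (lt_max_of_lt_right one_pos).ne')]
    have e1 : (Subchannels.ofMatrix G).logGain μ = ∑ k, max (Real.log (μ * d k)) 0 := by
      rw [hsum (fun x => max (Real.log (μ * x)) 0) (by simp)]; rfl
    rw [e1]
    refine Finset.sum_congr rfl fun k _ => ?_
    rcases le_total 1 (μ * d k) with hk | hk
    · rw [max_eq_left hk, max_eq_left (Real.log_nonneg hk)]
    · rw [max_eq_right hk, Real.log_one,
        max_eq_right (Real.log_nonpos (mul_nonneg hμ.le (hd k)) hk)]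

lemma mimoCapacity_bddAbove {c : ℝ} (hc : 0 ≤ c) (G : Matrix ι κ ℂ) (p : ℝ) :
    BddAbove {r : ℝ | ∃ Ξ : Matrix κ κ ℂ, Ξ.PosSemidef ∧ Ξ.trace = (p : ℂ) ∧
      r = c * Real.log (1 + G * Ξ * Gᴴ).det.re} := by
  refine ⟨c * ((Subchannels.ofMatrix G).logGain 1 +
    (p - (Subchannels.ofMatrix G).power 1) / 1), ?_⟩
  rintro r ⟨Ξ, hΞ, hp, rfl⟩
  exact mul_le_mul_of_nonneg_left (log_det_capacity_le G hΞ hp one_pos) hc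

omit [DecidableEq κ] in
lemma one_le_det_capacity (G : Matrix ι κ ℂ) {Ξ : Matrix κ κ ℂ} (hΞ : Ξ.PosSemidef) :
    1 ≤ (1 + G * Ξ * Gᴴ).det.re := by
  have hP := hΞ.mul_mul_conjTranspose_same G
  set A := G * Ξ * Gᴴ
  have h : A.IsHermitian := hP.isHermitian
  obtain ⟨U, hU⟩ : ∃ U : Matrix.unitaryGroup ι ℂ, A = (U : Matrix ι ι ℂ) *
      Matrix.diagonal (fun i => ((h.eigenvalues i : ℝ) : ℂ)) * (U : Matrix ι ι ℂ)ᴴ :=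
    ⟨h.eigenvectorUnitary, h.spectral_theorem⟩
  have hUU : (U : Matrix ι ι ℂ)ᴴ * (U : Matrix ι ι ℂ) = 1 := Unitary.coe_star_mul_self U
  rw [hU, Matrix.mul_assoc, Matrix.det_one_add_mul_comm, Matrix.mul_assoc, hUU, Matrix.mul_one,
    ← Matrix.diagonal_one, Matrix.diagonal_add, Matrix.det_diagonal]
  have : ∏ i, ((1 : ℂ) + ((h.eigenvalues i : ℝ) : ℂ)) =
      ((∏ i, (1 + h.eigenvalues i) : ℝ) : ℂ) := by
    push_cast; rfl
  rw [this, Complex.ofReal_re]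
  exact Finset.prod_induction _ (fun x => 1 ≤ x) (fun a b ha hb => one_le_mul_of_one_le_of_one_le ha hb)
    le_rfl (fun i _ => by have := hP.eigenvalues_nonneg i; linarith)

omit [DecidableEq κ] in
lemma mimoCapacity_nonneg {c : ℝ} (hc : 0 ≤ c) (G : Matrix ι κ ℂ) (p : ℝ) :
    0 ≤ mimoCapacity c G p := by
  refine Real.sSup_nonneg ?_
  rintro r ⟨Ξ, hΞ, -, rfl⟩
  exact mul_nonneg hc (Real.log_nonneg (one_le_det_capacity G hΞ))

omit [DecidableEq κ] in
lemma mimoCapacity_zero (c : ℝ) (G : Matrix ι κ ℂ) : mimoCapacity c G 0 = 0 := by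
  have : {r : ℝ | ∃ Ξ : Matrix κ κ ℂ, Ξ.PosSemidef ∧ Ξ.trace = ((0 : ℝ) : ℂ) ∧
      r = c * Real.log (1 + G * Ξ * Gᴴ).det.re} = {0} := by
    ext r
    simp only [Set.mem_ofPred_eq, Set.mem_singleton_iff]
    constructor
    · rintro ⟨Ξ, hΞ, h0, rfl⟩
      have : Ξ = 0 := hΞ.trace_eq_zero_iff.1 (by simpa using h0)
      simp [this]
    · rintro rfl
      exact ⟨0, Matrix.PosSemidef.zero, by simp, by simp⟩
  rw [mimoCapacity, this, csSup_singleton]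

namespace Subchannels

lemma power_nonneg (s : Subchannels) (μ : ℝ) : 0 ≤ s.power μ :=
  Finset.sum_nonneg fun _ _ => le_max_right _ _

lemma logGain_nonneg (s : Subchannels) (μ : ℝ) : 0 ≤ s.logGain μ :=
  Finset.sum_nonneg fun _ _ => le_max_right _ _

lemma power_le_mul_logGain (s : Subchannels) {μ : ℝ} (hμ : 0 < μ) :
    s.power μ ≤ μ * s.logGain μ := by
  rw [power, logGain, Finset.mul_sum]
  refine Finset.sum_le_sum fun j hj => ?_
  have hs := s.snr_pos j hj
  refine max_le ?_ (mul_nonneg hμ.le (le_max_right _ _))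
  refine le_trans ?_ (mul_le_mul_of_nonneg_left (le_max_left _ _) hμ.le)
  have := Real.one_sub_inv_le_log_of_pos (mul_pos hμ hs)
  calc μ - 1 / s.snr j = μ * (1 - (μ * s.snr j)⁻¹) := by field_simp
    _ ≤ _ := mul_le_mul_of_nonneg_left this hμ.le

theorem isCapacity_ofMatrix {c : ℝ} (hc : 0 ≤ c) (G : Matrix ι κ ℂ) :
    IsCapacity c (ofMatrix G) (mimoCapacity c G) := by
  have hle : ∀ μ, 0 < μ → ∀ p, 0 ≤ p → mimoCapacity c G p ≤
      c * (ofMatrix G).logGain μ + c * ((p - (ofMatrix G).power μ) / μ) := by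
    intro μ hμ p hp
    rw [← mul_add]
    refine Real.sSup_le ?_ (mul_nonneg hc ?_)
    · rintro r ⟨Ξ, hΞ, htr, rfl⟩
      exact mul_le_mul_of_nonneg_left (log_det_capacity_le G hΞ htr hμ) hc
    · have h1 := (ofMatrix G).power_le_mul_logGain hμ
      rw [sub_div]
      have : (ofMatrix G).power μ / μ ≤ (ofMatrix G).logGain μ := by
        rw [div_le_iff₀ hμ]; linarith
      have := div_nonneg hp hμ.le
      linarith
  refine ⟨fun μ hμ => le_antisymm ?_ ?_, hle⟩
  · have := hle μ hμ _ ((ofMatrix G).power_nonneg μ)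
    simpa using this
  · obtain ⟨Ξ, hΞ, htr, hlog⟩ := exists_covariance_waterfilling G hμ
    exact le_csSup (mimoCapacity_bddAbove hc G _) ⟨Ξ, hΞ, htr, by rw [hlog]⟩

/-- No subchannel: the capacity is zero. -/
def empty : Subchannels := ⟨∅, fun _ => 1, by simp⟩

lemma isCapacity_empty {c : ℝ} (hc : 0 ≤ c) : IsCapacity c empty (fun _ => 0) where
  eq μ _ := by simp [logGain, empty]
  le μ hμ p hp := by
    simp only [logGain, power, empty, Finset.sum_empty]
    have := mul_nonneg hc (div_nonneg hp hμ.le)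
    simpa using this

end Subchannels

end MatrixCapacity

/-! ### Modified water-filling over parallel channels -/

namespace Subchannels

variable (s : Subchannels)

lemma continuous_power : Continuous s.power := by
  unfold power; fun_prop

lemma power_mono : Monotone s.power := fun a b hab =>
  Finset.sum_le_sum fun _ _ => max_le_max_right _ (by linarith)

lemma power_lt_power {a b : ℝ} (hab : a < b) (ha : 0 < s.power a) : s.power a < s.power b := by
  obtain ⟨j, hj, hpos⟩ := Finset.exists_lt_of_sum_lt (s := s.idx) (f := fun _ => (0 : ℝ))
    (g := fun j => max (a - 1 / s.snr j) 0) (by simpa [power] using ha)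
  refine Finset.sum_lt_sum (fun _ _ => max_le_max_right _ (by linarith)) ⟨j, hj, ?_⟩
  rcases lt_max_iff.1 hpos with h | h
  · rw [max_eq_left h.le]
    exact lt_max_of_lt_left (by linarith)
  · exact absurd h (lt_irrefl _)

lemma logGain_exp (u : ℝ) :
    s.logGain (Real.exp u) = ∑ j ∈ s.idx, max (u + Real.log (s.snr j)) 0 := by
  refine Finset.sum_congr rfl fun j hj => ?_
  rw [Real.log_mul (Real.exp_pos u).ne' (s.snr_pos j hj).ne', Real.log_exp]

lemma continuous_logGain_exp : Continuous fun u => s.logGain (Real.exp u) := by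
  simp only [logGain_exp]; fun_prop

lemma logGain_exp_mono : Monotone fun u => s.logGain (Real.exp u) := fun a b hab => by
  simp only [logGain_exp]
  exact Finset.sum_le_sum fun _ _ => max_le_max_right _ (by linarith)

lemma logGain_mono {a b : ℝ} (ha : 0 < a) (hab : a ≤ b) : s.logGain a ≤ s.logGain b := by
  have := s.logGain_exp_mono (Real.log_le_log ha hab)
  simpa [Real.exp_log ha, Real.exp_log (ha.trans_le hab)] using this

/-- For each `v` the equation `u + β logGain (exp u) = v` has exactly one solution `u`, which
depends continuously and strictly monotonically on `v`. -/
lemma exists_logLevel {β : ℝ} (hβ : 0 < β) :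
    ∃ g : ℝ → ℝ, Continuous g ∧ StrictMono g ∧
      (∀ v, g v + β * s.logGain (Real.exp (g v)) = v) ∧
      (∀ u, g (u + β * s.logGain (Real.exp u)) = u) := by
  set Φ : ℝ → ℝ := fun u => u + β * s.logGain (Real.exp u) with hΦ
  have hc : Continuous Φ := continuous_id.add (continuous_const.mul s.continuous_logGain_exp)
  have hm : StrictMono Φ := strictMono_id.add_monotone (s.logGain_exp_mono.const_mul hβ.le)
  have hs : Function.Surjective Φ := by
    refine hc.surjective ?_ ?_
    · refine Filter.tendsto_atTop_mono (fun u => ?_) Filter.tendsto_id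
      have := mul_nonneg hβ.le (s.logGain_nonneg (Real.exp u))
      simp only [hΦ, id]; linarith
    · refine Filter.tendsto_atBot_mono' Filter.atBot ?_
        (Filter.tendsto_atBot_add_const_right _ (β * s.logGain (Real.exp 0)) Filter.tendsto_id)
      filter_upwards [Filter.eventually_le_atBot 0] with u hu
      have := mul_le_mul_of_nonneg_left (s.logGain_exp_mono hu) hβ.le
      simp only [hΦ, id]; linarith
  let e := hm.orderIsoOfSurjective Φ hs
  exact ⟨e.symm, e.symm.continuous, e.symm.strictMono, fun v => e.apply_symm_apply v,
    fun u => e.symm_apply_apply u⟩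

lemma exists_logGain_eq_zero : ∃ m, 0 < m ∧ ∀ μ, 0 < μ → μ ≤ m → s.logGain μ = 0 ∧
    s.power μ = 0 := by
  refine ⟨∏ j ∈ s.idx, min 1 (1 / s.snr j), Finset.prod_pos fun j hj =>
    lt_min one_pos (one_div_pos.2 (s.snr_pos j hj)), fun μ hμ hm => ?_⟩
  have hle : ∀ j ∈ s.idx, μ ≤ 1 / s.snr j := by
    intro j hj
    refine hm.trans ?_
    rw [← Finset.mul_prod_erase _ _ hj]
    calc _ ≤ min 1 (1 / s.snr j) * 1 := by
          refine mul_le_mul_of_nonneg_left ?_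
            (le_min zero_le_one (one_div_pos.2 (s.snr_pos j hj)).le)
          exact Finset.prod_le_one (fun i hi => le_min zero_le_one
            (one_div_pos.2 (s.snr_pos i (Finset.mem_of_mem_erase hi))).le)
            fun i _ => min_le_left _ _
      _ ≤ _ := by rw [mul_one]; exact min_le_right _ _
  constructor
  · refine Finset.sum_eq_zero fun j hj => max_eq_right ?_
    have hs := s.snr_pos j hj
    refine Real.log_nonpos (mul_pos hμ hs).le ?_
    have := hle j hj
    rwa [le_div_iff₀ hs] at this
  · exact Finset.sum_eq_zero fun j hj => max_eq_right (by linarith [hle j hj])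

lemma exists_lt_power (h : s.idx.Nonempty) (x : ℝ) : ∃ M, 0 < M ∧ x < s.power M := by
  obtain ⟨j, hj⟩ := h
  have hs := one_div_pos.2 (s.snr_pos j hj)
  refine ⟨1 / s.snr j + |x| + 1, by positivity, ?_⟩
  calc x ≤ |x| := le_abs_self x
    _ < max (1 / s.snr j + |x| + 1 - 1 / s.snr j) 0 := lt_max_of_lt_left (by linarith)
    _ ≤ _ := Finset.single_le_sum (f := fun j => max (1 / s.snr _ + |x| + 1 - 1 / s.snr j) 0)
      (fun _ _ => le_max_right _ _) hj

lemma idx_nonempty_of_power_pos {μ : ℝ} (h : 0 < s.power μ) : s.idx.Nonempty := by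
  by_contra h0
  rw [Finset.not_nonempty_iff_eq_empty] at h0
  simp [power, h0] at h

/-- `μ` is the water level of modified water-filling for the multipliers `lam` and `ζ`: with
this level the derivative of `lam * exp (-β logGain)` with respect to the power is `-ζ`. -/
structure IsLevel (s : Subchannels) (β lam ζ μ : ℝ) : Prop where
  pos : 0 < μ
  eq : lam * β * Real.exp (-(β * s.logGain μ)) = ζ * μ

variable {s} {β lam ζ μ : ℝ}

lemma isLevel_iff_log (hβ : 0 < β) (hl : 0 < lam) (hζ : 0 < ζ) (hμ : 0 < μ) :
    s.IsLevel β lam ζ μ ↔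
      Real.log μ + β * s.logGain μ = Real.log (lam * β) - Real.log ζ := by
  have h1 : s.IsLevel β lam ζ μ ↔ lam * β * Real.exp (-(β * s.logGain μ)) = ζ * μ :=
    ⟨fun h => h.eq, fun h => ⟨hμ, h⟩⟩
  rw [h1]
  have hlb := mul_pos hl hβ
  constructor
  · intro h
    have := congrArg Real.log h
    rw [Real.log_mul hlb.ne' (Real.exp_pos _).ne', Real.log_exp, Real.log_mul hζ.ne' hμ.ne'] at this
    linarith
  · intro h
    apply Real.log_injOn_pos (Set.mem_Ioi.2 (mul_pos hlb (Real.exp_pos _)))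
      (Set.mem_Ioi.2 (mul_pos hζ hμ))
    rw [Real.log_mul hlb.ne' (Real.exp_pos _).ne', Real.log_exp, Real.log_mul hζ.ne' hμ.ne']
    linarith

lemma existsUnique_isLevel (s : Subchannels) (hβ : 0 < β) (hl : 0 < lam) (hζ : 0 < ζ) :
    ∃! μ, s.IsLevel β lam ζ μ := by
  obtain ⟨g, -, -, h1, h2⟩ := s.exists_logLevel hβ
  refine ⟨Real.exp (g (Real.log (lam * β) - Real.log ζ)), ?_, ?_⟩
  · dsimp only
    rw [isLevel_iff_log hβ hl hζ (Real.exp_pos _), Real.log_exp, h1]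
  · intro μ hμ
    have h := (isLevel_iff_log hβ hl hζ hμ.pos).1 hμ
    rw [← h, ← Real.exp_log hμ.pos]
    have h3 := h2 (Real.log μ)
    rw [Real.exp_log hμ.pos] at h3
    rw [Real.exp_log hμ.pos, h3, Real.exp_log hμ.pos]

/-- Quantitative optimality of the modified water-filling power of a single user. -/
lemma IsLevel.gap {θ c : ℝ} {C : ℝ → ℝ} (hc : 0 < c) (hθ : 0 < θ) (hl : 0 < lam)
    (hC : s.IsCapacity c C) (hμ : s.IsLevel (c * θ) lam ζ μ) {p : ℝ} (hp : 0 ≤ p) :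
    ζ * μ / (c * θ) * (Real.exp (-(c * θ * ((p - s.power μ) / μ))) - 1 +
        c * θ * ((p - s.power μ) / μ)) ≤
      (lam * Real.exp (-θ * C p) + ζ * p) -
        (lam * Real.exp (-θ * C (s.power μ)) + ζ * s.power μ) := by
  have hβ : 0 < c * θ := mul_pos hc hθ
  have hμ0 := hμ.pos
  have h1 : lam * Real.exp (-θ * C (s.power μ)) = ζ * μ / (c * θ) := by
    rw [eq_div_iff hβ.ne', ← hμ.eq, hC.eq μ hμ0]
    rw [show -θ * (c * s.logGain μ) = -(c * θ * s.logGain μ) by ring]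
    ring
  have h2 : lam * Real.exp (-θ * C (s.power μ)) * Real.exp (-(c * θ * ((p - s.power μ) / μ))) ≤
      lam * Real.exp (-θ * C p) := by
    rw [mul_assoc, ← Real.exp_add]
    refine mul_le_mul_of_nonneg_left (Real.exp_le_exp.2 ?_) hl.le
    have := mul_le_mul_of_nonneg_left (hC.le μ hμ0 p hp) hθ.le
    rw [hC.eq μ hμ0]
    linarith
  rw [h1] at h2 ⊢
  have h3 : ζ * μ / (c * θ) * (c * θ * ((p - s.power μ) / μ)) = ζ * (p - s.power μ) := by
    field_simp
  linarith

end Subchannels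

lemma exp_neg_sub_one_add_nonneg (x : ℝ) : 0 ≤ Real.exp (-x) - 1 + x := by
  linarith [Real.add_one_le_exp (-x)]

lemma exp_neg_sub_one_add_pos {x : ℝ} (hx : x ≠ 0) : 0 < Real.exp (-x) - 1 + x := by
  linarith [Real.add_one_lt_exp (neg_ne_zero.2 hx)]

/-- `exp (-x) - 1 + x` is bounded below away from `x = 0`. -/
lemma exists_forall_le_exp_neg_sub_one_add {δ : ℝ} (hδ : 0 < δ) :
    ∃ η > 0, ∀ x : ℝ, δ ≤ |x| → η ≤ Real.exp (-x) - 1 + x := by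
  refine ⟨min (Real.exp (-δ) - 1 + δ) (Real.exp (-(-δ)) - 1 + (-δ)),
    lt_min (exp_neg_sub_one_add_pos hδ.ne') (exp_neg_sub_one_add_pos (neg_ne_zero.2 hδ.ne')), ?_⟩
  intro x hx
  rcases le_abs.1 hx with h | h
  · refine (min_le_left _ _).trans ?_
    have h1 := Real.add_one_le_exp (-(x - δ))
    have h2 : Real.exp (-δ) ≤ 1 := Real.exp_le_one_iff.2 (by linarith)
    have h3 : Real.exp (-x) = Real.exp (-δ) * Real.exp (-(x - δ)) := by
      rw [← Real.exp_add]; congr 1; ring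
    have h4 := mul_le_mul_of_nonneg_left h1 (Real.exp_pos (-δ)).le
    rw [h3]
    nlinarith
  · refine (min_le_right _ _).trans ?_
    have h1 := Real.add_one_le_exp (-x - δ)
    have h2 : 1 ≤ Real.exp (-(-δ)) := Real.one_le_exp_iff.2 (by linarith)
    have h3 : Real.exp (-x) = Real.exp (-(-δ)) * Real.exp (-x - δ) := by
      rw [← Real.exp_add]; congr 1; ring
    have h4 := mul_le_mul_of_nonneg_left h1 (Real.exp_pos (-(-δ))).le
    rw [h3]
    nlinarith

section Breakpoints
variable {ι κ : Type*} [Fintype ι] [Fintype κ] [DecidableEq κ] (G : Matrix ι κ ℂ)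

lemma exists_breakpoint_interval {μ : ℝ} (hμ : 0 < μ) :
    ∃ i, breakpoint G i ≤ (μ : EReal) ∧ (μ : EReal) < breakpoint G (i + 1) := by
  classical
  have hex : ∃ i, (μ : EReal) < breakpoint G (i + 1) :=
    ⟨G.rank, by simp [breakpoint]⟩
  refine ⟨Nat.find hex, ?_, Nat.find_spec hex⟩
  rcases h : Nat.find hex with _ | k
  · simp only [breakpoint, if_true]
    exact_mod_cast hμ.le
  · have := Nat.find_min hex (m := k) (by omega)
    exact not_lt.1 this

variable {G}

lemma le_rank_of_breakpoint_le {μ : ℝ} {i : ℕ} (h : breakpoint G i ≤ (μ : EReal)) :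
    i ≤ G.rank := by
  by_contra hi
  push Not at hi
  rw [breakpoint, if_neg (by omega), if_neg (by omega)] at h
  exact absurd h (by simp)

lemma one_div_snr_le_of_breakpoint_le {μ : ℝ} {i j : ℕ} (h : breakpoint G i ≤ (μ : EReal))
    (hj : j ∈ Finset.Icc 1 i) : 1 / subchannelSNR G j ≤ μ := by
  rw [Finset.mem_Icc] at hj
  have hi := le_rank_of_breakpoint_le h
  rw [breakpoint, if_neg (by omega), if_pos hi] at h
  refine le_trans ?_ (EReal.coe_le_coe_iff.1 h)
  exact one_div_le_one_div_of_le (subchannelSNR_pos G (Finset.mem_Icc.2 ⟨by omega, hi⟩))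
    (subchannelSNR_antitone G hj.2)

lemma lt_one_div_snr_of_lt_breakpoint {μ : ℝ} {i j : ℕ}
    (h : (μ : EReal) < breakpoint G (i + 1)) (hij : i < j) (hj : j ≤ G.rank) :
    μ < 1 / subchannelSNR G j := by
  rw [breakpoint, if_neg (by omega), if_pos (by omega)] at h
  refine lt_of_lt_of_le (EReal.coe_lt_coe_iff.1 h) ?_
  exact one_div_le_one_div_of_le (subchannelSNR_pos G (Finset.mem_Icc.2 ⟨by omega, hj⟩))
    (subchannelSNR_antitone G (by omega))

lemma breakpoint_interval_unique {μ : ℝ} {i i' : ℕ} (h1 : breakpoint G i ≤ (μ : EReal))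
    (h2 : (μ : EReal) < breakpoint G (i + 1)) (h1' : breakpoint G i' ≤ (μ : EReal))
    (h2' : (μ : EReal) < breakpoint G (i' + 1)) : i = i' := by
  have key : ∀ {i i' : ℕ}, (μ : EReal) < breakpoint G (i + 1) →
      breakpoint G i' ≤ (μ : EReal) → ¬ i < i' := by
    intro i i' h2 h1' hlt
    have ha := lt_one_div_snr_of_lt_breakpoint h2 hlt (le_rank_of_breakpoint_le h1')
    have hb := one_div_snr_le_of_breakpoint_le h1' (j := i') (Finset.mem_Icc.2 ⟨by omega, le_rfl⟩)
    linarith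
  have := key h2 h1'
  have := key h2' h1
  omega

lemma sum_subchannels_of_breakpoint {μ : ℝ} {i : ℕ} (h1 : breakpoint G i ≤ (μ : EReal))
    (h2 : (μ : EReal) < breakpoint G (i + 1)) {f : ℝ → ℝ}
    (hf : ∀ x, 0 < x → μ < 1 / x → f x = 0) :
    ∑ j ∈ (Subchannels.ofMatrix G).idx, f ((Subchannels.ofMatrix G).snr j) =
      ∑ j ∈ Finset.Icc 1 i, f (subchannelSNR G j) := by
  symm
  refine Finset.sum_subset (Finset.Icc_subset_Icc_right (le_rank_of_breakpoint_le h1)) ?_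
  intro j hj hj'
  refine hf _ (subchannelSNR_pos G hj) ?_
  have hj2 := (Finset.mem_Icc (α := ℕ)).1 hj
  rw [Finset.mem_Icc] at hj'
  exact lt_one_div_snr_of_lt_breakpoint h2 (by omega) hj2.2

lemma power_of_breakpoint {μ : ℝ} {i : ℕ} (h1 : breakpoint G i ≤ (μ : EReal))
    (h2 : (μ : EReal) < breakpoint G (i + 1)) :
    (Subchannels.ofMatrix G).power μ =
      (i : ℝ) * μ - ∑ j ∈ Finset.Icc 1 i, 1 / subchannelSNR G j := by
  rw [Subchannels.power, sum_subchannels_of_breakpoint h1 h2 (f := fun x => max (μ - 1 / x) 0)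
    (fun x _ h => max_eq_right (by linarith))]
  rw [Finset.sum_congr rfl fun j hj =>
    max_eq_left (sub_nonneg.2 (one_div_snr_le_of_breakpoint_le h1 hj)), Finset.sum_sub_distrib]
  simp

lemma logGain_of_breakpoint {μ : ℝ} {i : ℕ} (hμ : 0 < μ) (h1 : breakpoint G i ≤ (μ : EReal))
    (h2 : (μ : EReal) < breakpoint G (i + 1)) :
    (Subchannels.ofMatrix G).logGain μ =
      (i : ℝ) * Real.log μ + ∑ j ∈ Finset.Icc 1 i, Real.log (subchannelSNR G j) := by
  have hsnr : ∀ j ∈ Finset.Icc 1 i, 0 < subchannelSNR G j := fun j hj =>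
    subchannelSNR_pos G (Finset.Icc_subset_Icc_right (le_rank_of_breakpoint_le h1) hj)
  rw [Subchannels.logGain, sum_subchannels_of_breakpoint h1 h2
    (f := fun x => max (Real.log (μ * x)) 0) (fun x hx h => max_eq_right
      (Real.log_nonpos (mul_pos hμ hx).le ((lt_div_iff₀ hx).1 h).le))]
  have : ∀ j ∈ Finset.Icc 1 i, max (Real.log (μ * subchannelSNR G j)) 0 =
      Real.log μ + Real.log (subchannelSNR G j) := by
    intro j hj
    have hs := hsnr j hj
    rw [max_eq_left, Real.log_mul hμ.ne' hs.ne']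
    refine Real.log_nonneg ?_
    have := one_div_snr_le_of_breakpoint_le h1 hj
    rwa [div_le_iff₀ hs] at this
  rw [Finset.sum_congr rfl this, Finset.sum_add_distrib]
  simp

/-- On the interval between two consecutive breakpoints the closed formula for the water level is
equivalent to the level equation. -/
lemma level_formula_iff {β lam z μ : ℝ} {i : ℕ} (hβ : 0 < β) (hl : 0 < lam) (hz : 0 < z)
    (h1 : breakpoint G i ≤ (μ : EReal)) (h2 : (μ : EReal) < breakpoint G (i + 1)) :
    μ = (z / (β * lam)) ^ (-(1 / (1 + (i : ℝ) * β))) *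
        (∏ j ∈ Finset.Icc 1 i, subchannelSNR G j ^ (-(β / (1 + (i : ℝ) * β)))) ↔
      (Subchannels.ofMatrix G).IsLevel β lam z μ := by
  have hsnr : ∀ j ∈ Finset.Icc 1 i, 0 < subchannelSNR G j := fun j hj =>
    subchannelSNR_pos G (Finset.Icc_subset_Icc_right (le_rank_of_breakpoint_le h1) hj)
  have hzl : 0 < z / (β * lam) := div_pos hz (mul_pos hβ hl)
  have hA : 0 < (z / (β * lam)) ^ (-(1 / (1 + (i : ℝ) * β))) := Real.rpow_pos_of_pos hzl _
  have hB : 0 < ∏ j ∈ Finset.Icc 1 i, subchannelSNR G j ^ (-(β / (1 + (i : ℝ) * β))) :=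
    Finset.prod_pos fun j hj => Real.rpow_pos_of_pos (hsnr j hj) _
  have hi : 0 < 1 + (i : ℝ) * β := by positivity
  have key : 0 < μ → (μ = (z / (β * lam)) ^ (-(1 / (1 + (i : ℝ) * β))) *
        (∏ j ∈ Finset.Icc 1 i, subchannelSNR G j ^ (-(β / (1 + (i : ℝ) * β)))) ↔
      (Subchannels.ofMatrix G).IsLevel β lam z μ) := by
    intro hμ
    rw [Subchannels.isLevel_iff_log hβ hl hz hμ, logGain_of_breakpoint hμ h1 h2,
      ← Real.log_injOn_pos.eq_iff (Set.mem_Ioi.2 hμ) (Set.mem_Ioi.2 (mul_pos hA hB)),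
      Real.log_mul hA.ne' hB.ne', Real.log_rpow hzl, Real.log_prod (fun j hj =>
        (Real.rpow_pos_of_pos (hsnr j hj) _).ne'), Finset.sum_congr rfl fun j hj =>
        Real.log_rpow (hsnr j hj) _, ← Finset.mul_sum, Real.log_div hz.ne' (mul_pos hβ hl).ne',
      mul_comm β lam]
    set E := ∑ j ∈ Finset.Icc 1 i, Real.log (subchannelSNR G j)
    constructor
    · intro h
      rw [h]
      field_simp
      ring
    · intro h
      rw [mul_comm lam β] at h
      field_simp
      linarith
  constructor
  · intro h
    exact (key (h ▸ mul_pos hA hB)).1 h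
  · intro h
    exact (key h.pos).2 h

end Breakpoints

section Allocation
variable {ι : Type*} [Fintype ι]

/-- The modified water-filling allocation among several users with multipliers `lam` and `ζ`. -/
structure IsAllocation (s : ι → Subchannels) (β lam : ι → ℝ) (ζ : ℝ) (P : ι → ℝ) : Prop where
  zeta_pos : 0 < ζ
  level : ∀ n, ∃ μ, (s n).IsLevel (β n) (lam n) ζ μ ∧ P n = (s n).power μ

variable {s : ι → Subchannels} {β lam : ι → ℝ}

omit [Fintype ι] in
lemma IsAllocation.nonneg {ζ : ℝ} {P : ι → ℝ} (h : IsAllocation s β lam ζ P) (n : ι) :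
    0 ≤ P n := by
  obtain ⟨μ, -, h2⟩ := h.level n
  exact h2 ▸ (s n).power_nonneg μ

/-- Some `ζ` exhausts the power `x`: with `ζ = exp (-v)` the total power is continuous in `v`, and it
passes from `0` to arbitrarily large values as soon as some user has a subchannel. -/
lemma exists_isAllocation (hβ : ∀ n, 0 < β n) (hl : ∀ n, 0 < lam n)
    (hs : ∃ n, (s n).idx.Nonempty) {x : ℝ} (hx : 0 < x) :
    ∃ ζ P, IsAllocation s β lam ζ P ∧ ∑ n, P n = x := by
  choose g hgc hgm hg1 hg2 using fun n => (s n).exists_logLevel (hβ n)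
  set L : ℝ → ι → ℝ := fun v n => Real.exp (g n (Real.log (lam n * β n) + v)) with hL
  set S : ℝ → ℝ := fun v => ∑ n, (s n).power (L v n) with hS
  have hSc : Continuous S := by
    refine continuous_finsetSum _ fun n _ => (s n).continuous_power.comp ?_
    exact Real.continuous_exp.comp ((hgc n).comp (continuous_const.add continuous_id))
  have hlevel : ∀ v n, (s n).IsLevel (β n) (lam n) (Real.exp (-v)) (L v n) := by
    intro v n
    rw [Subchannels.isLevel_iff_log (hβ n) (hl n) (Real.exp_pos _) (Real.exp_pos _)]
    simp only [Real.log_exp, hg1]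
    ring
  choose m hm0 hm using fun n => (s n).exists_logGain_eq_zero
  have hlow : ∃ v, S v ≤ x := by
    -- with `v` so small that every water level is below the smallest breakpoint
    obtain ⟨v, hv⟩ : ∃ v, ∀ n, v ≤ Real.log (m n) - Real.log (lam n * β n) := by
      obtain ⟨v, hv⟩ := (Set.finite_range fun n => Real.log (m n) - Real.log (lam n * β n)).bddBelow
      exact ⟨v, fun n => hv (Set.mem_range_self n)⟩
    refine ⟨v, ?_⟩
    have : S v = 0 := Finset.sum_eq_zero fun n _ => by
      refine ((hm n) _ (Real.exp_pos _) ?_).2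
      have h1 := hg1 n (Real.log (lam n * β n) + v)
      have h2 := mul_nonneg (hβ n).le ((s n).logGain_nonneg
        (Real.exp (g n (Real.log (lam n * β n) + v))))
      rw [← Real.le_log_iff_exp_le (hm0 n)]
      linarith [hv n]
    rw [this]; exact hx.le
  have hhigh : ∃ v, x ≤ S v := by
    obtain ⟨n, hn⟩ := hs
    obtain ⟨M, hM0, hM⟩ := (s n).exists_lt_power hn x
    refine ⟨Real.log M + β n * (s n).logGain M - Real.log (lam n * β n), hM.le.trans ?_⟩
    have h2 := hg2 n (Real.log M)
    rw [Real.exp_log hM0] at h2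
    have : L (Real.log M + β n * (s n).logGain M - Real.log (lam n * β n)) n = M := by
      simp only [hL]
      rw [show Real.log (lam n * β n) + (Real.log M + β n * (s n).logGain M -
        Real.log (lam n * β n)) = Real.log M + β n * (s n).logGain M by ring, h2,
        Real.exp_log hM0]
    refine (congrArg (s n).power this).symm.le.trans ?_
    exact Finset.single_le_sum (f := fun k => (s k).power (L _ k))
      (fun k _ => (s k).power_nonneg _) (Finset.mem_univ n)
  obtain ⟨v1, hv1⟩ := hlow
  obtain ⟨v2, hv2⟩ := hhigh
  obtain ⟨v, hv⟩ := mem_range_of_exists_le_of_exists_ge hSc ⟨v1, hv1⟩ ⟨v2, hv2⟩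
  exact ⟨Real.exp (-v), fun n => (s n).power (L v n), ⟨Real.exp_pos _, fun n =>
    ⟨L v n, hlevel v n, rfl⟩⟩, hv⟩

lemma Subchannels.IsLevel.lt_of_zeta_lt {s : Subchannels} {β lam ζ ζ' μ μ' : ℝ} (hβ : 0 < β)
    (hl : 0 < lam) (h : s.IsLevel β lam ζ μ) (h' : s.IsLevel β lam ζ' μ') (hζ : ζ < ζ')
    (hζ0 : 0 < ζ) : μ' < μ := by
  by_contra hle
  push Not at hle
  have h1 := s.logGain_mono h.pos hle
  have h2 : Real.exp (-(β * s.logGain μ')) ≤ Real.exp (-(β * s.logGain μ)) :=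
    Real.exp_le_exp.2 (by nlinarith)
  have h3 := mul_le_mul_of_nonneg_left h2 (mul_pos hl hβ).le
  rw [h.eq, h'.eq] at h3
  have h4 : ζ * μ < ζ' * μ' := by nlinarith [h.pos, h'.pos]
  linarith

/-- The power constraint determines `ζ`. -/
lemma IsAllocation.zeta_unique (hβ : ∀ n, 0 < β n) (hl : ∀ n, 0 < lam n) {ζ ζ' : ℝ}
    {P P' : ι → ℝ} (h : IsAllocation s β lam ζ P) (h' : IsAllocation s β lam ζ' P')
    (hsum : ∑ n, P n = ∑ n, P' n) (hpos : 0 < ∑ n, P n) : ζ = ζ' := by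
  have key : ∀ {ζ ζ' : ℝ} {P P' : ι → ℝ}, IsAllocation s β lam ζ P →
      IsAllocation s β lam ζ' P' → 0 < ∑ n, P' n → ζ < ζ' → ∑ n, P' n < ∑ n, P n := by
    intro ζ ζ' P P' h h' hpos hlt
    have hle : ∀ n, P' n ≤ P n ∧ (0 < P' n → P' n < P n) := by
      intro n
      obtain ⟨μ, h1, h2⟩ := h.level n
      obtain ⟨μ', h1', h2'⟩ := h'.level n
      have := h1.lt_of_zeta_lt (hβ n) (hl n) h1' hlt h.zeta_pos
      rw [h2, h2']
      exact ⟨(s n).power_mono this.le, fun hp => (s n).power_lt_power this hp⟩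
    obtain ⟨n, -, hn⟩ := Finset.exists_lt_of_sum_lt (s := Finset.univ) (f := fun _ : ι => (0 : ℝ))
      (g := P') (by simpa using hpos)
    exact Finset.sum_lt_sum (fun n _ => (hle n).1) ⟨n, Finset.mem_univ n, (hle n).2 hn⟩
  rcases lt_trichotomy ζ ζ' with hlt | heq | hlt
  · have := key h h' (hsum ▸ hpos) hlt
    linarith
  · exact heq
  · have := key h' h hpos hlt
    linarith

end Allocation

/-! ### Exponential sums and their inverse functions -/

section ExpSum
variable {ι : Type*} [Fintype ι]

/-- The exponential sum `∑ a n exp (b n v)`. -/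
def expSum (a b : ι → ℝ) (v : ℝ) : ℝ := ∑ n, a n * Real.exp (b n * v)

lemma analyticAt_expSum (a b : ι → ℝ) (v : ℝ) : AnalyticAt ℝ (expSum a b) v := by
  unfold expSum
  exact Finset.analyticAt_fun_sum _ fun n _ => by fun_prop

lemma hasDerivAt_expSum (a b : ι → ℝ) (v : ℝ) :
    HasDerivAt (expSum a b) (expSum (fun n => a n * b n) b v) v := by
  unfold expSum
  refine HasDerivAt.fun_sum fun n _ => ?_
  have h := ((hasDerivAt_id v).const_mul (b n)).exp.const_mul (a n)
  convert! h using 1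
  simp only [id]
  ring

variable {a b : ι → ℝ}

lemma expSum_deriv_pos (ha : ∀ n, 0 ≤ a n) (hb : ∀ n, 0 < b n) (hpos : ∃ n, 0 < a n) (v : ℝ) :
    0 < expSum (fun n => a n * b n) b v := by
  obtain ⟨n, hn⟩ := hpos
  exact Finset.sum_pos' (fun k _ => mul_nonneg (mul_nonneg (ha k) (hb k).le) (Real.exp_pos _).le)
    ⟨n, Finset.mem_univ n, mul_pos (mul_pos hn (hb n)) (Real.exp_pos _)⟩

lemma expSum_strictMono (ha : ∀ n, 0 ≤ a n) (hb : ∀ n, 0 < b n) (hpos : ∃ n, 0 < a n) :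
    StrictMono (expSum a b) :=
  strictMono_of_hasDerivAt_pos (fun v => hasDerivAt_expSum a b v)
    (fun v => expSum_deriv_pos ha hb hpos v)

lemma tendsto_expSum_atBot (hb : ∀ n, 0 < b n) :
    Filter.Tendsto (expSum a b) Filter.atBot (nhds 0) := by
  have : (0 : ℝ) = ∑ n, a n * 0 := by simp
  rw [this]
  refine tendsto_finsetSum _ fun n _ => Filter.Tendsto.const_mul _ ?_
  exact Real.tendsto_exp_atBot.comp (Filter.tendsto_id.const_mul_atBot (hb n))

lemma tendsto_expSum_atTop (ha : ∀ n, 0 ≤ a n) (hb : ∀ n, 0 < b n) (hpos : ∃ n, 0 < a n) :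
    Filter.Tendsto (expSum a b) Filter.atTop Filter.atTop := by
  obtain ⟨n, hn⟩ := hpos
  refine Filter.tendsto_atTop_mono (f := fun v => a n * Real.exp (b n * v)) (fun v => ?_) ?_
  · exact Finset.single_le_sum (f := fun n => a n * Real.exp (b n * v))
      (fun k _ => mul_nonneg (ha k) (Real.exp_pos _).le) (Finset.mem_univ n)
  · exact (Real.tendsto_exp_atTop.comp (Filter.tendsto_id.const_mul_atTop (hb n))).const_mul_atTop hn

/-- An exponential sum with positive exponents has an analytic inverse on `(0, ∞)`. -/
lemma exists_analytic_inverse_expSum (ha : ∀ n, 0 ≤ a n) (hb : ∀ n, 0 < b n)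
    (hpos : ∃ n, 0 < a n) :
    ∃ g : ℝ → ℝ, (∀ x, 0 < x → expSum a b (g x) = x) ∧ (∀ v, g (expSum a b v) = v) ∧
      AnalyticOnNhd ℝ g (Set.Ioi 0) ∧ Filter.Tendsto g Filter.atTop Filter.atTop := by
  have hm := expSum_strictMono ha hb hpos
  have hc : Continuous (expSum a b) :=
    continuous_iff_continuousAt.2 fun v => (analyticAt_expSum a b v).continuousAt
  have hsurj : ∀ x, 0 < x → ∃ v, expSum a b v = x := by
    intro x hx
    obtain ⟨v1, hv1⟩ := ((tendsto_expSum_atBot (a := a) hb).eventually_le_const hx).exists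
    obtain ⟨v2, hv2⟩ := ((tendsto_expSum_atTop ha hb hpos).eventually_ge_atTop x).exists
    exact mem_range_of_exists_le_of_exists_ge hc ⟨v1, hv1⟩ ⟨v2, hv2⟩
  have hpos' : ∀ v, 0 < expSum a b v := by
    obtain ⟨n, hn⟩ := hpos
    intro v
    exact Finset.sum_pos' (fun k _ => mul_nonneg (ha k) (Real.exp_pos _).le)
      ⟨n, Finset.mem_univ n, mul_pos hn (Real.exp_pos _)⟩
  set g := Function.invFun (expSum a b) with hg
  have hg1 : ∀ x, 0 < x → expSum a b (g x) = x := fun x hx => Function.invFun_eq (hsurj x hx)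
  have hg2 : ∀ v, g (expSum a b v) = v := fun v => Function.leftInverse_invFun hm.injective v
  refine ⟨g, hg1, hg2, ?_, ?_⟩
  · intro x hx
    have hA := analyticAt_expSum a b (g x)
    have hd : deriv (expSum a b) (g x) ≠ 0 := by
      rw [(hasDerivAt_expSum a b (g x)).deriv]
      exact (expSum_deriv_pos ha hb hpos _).ne'
    have h1 := hA.analyticAt_localInverse hd
    have h2 := HasStrictDerivAt.eventually_right_inverse hA.hasStrictDerivAt hd
    rw [hg1 x hx] at h1 h2
    refine h1.congr ?_
    filter_upwards [h2] with y hy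
    conv_rhs => rw [← hy]
    rw [hg2]
  · refine Filter.tendsto_atTop.2 fun v => ?_
    filter_upwards [Filter.eventually_ge_atTop (expSum a b v)] with x hx
    rw [← hm.le_iff_le, hg1 x ((hpos' v).trans_le hx)]
    exact hx

lemma tendsto_expSum_neg_atTop {y d : ι → ℝ} (hd : ∀ n, 0 ≤ d n) :
    Filter.Tendsto (expSum y fun n => -d n) Filter.atTop
      (nhds (∑ n, if d n = 0 then y n else 0)) := by
  refine tendsto_finsetSum _ fun n _ => ?_
  split_ifs with h
  · simp [h]
  · have : (0 : ℝ) = y n * 0 := by simp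
    rw [this]
    refine Filter.Tendsto.const_mul _ ?_
    refine Real.tendsto_exp_atBot.comp ?_
    exact Filter.tendsto_id.const_mul_atTop_of_neg (neg_neg_of_pos (lt_of_le_of_ne (hd n) (Ne.symm h)))

/-- Two exponential sums with different limits, each evaluated along the inverse of an exponential
sum, agree only on a null set: their difference is analytic and not identically zero. -/
lemma volume_expSum_tie {κ : Type*} [Fintype κ] {a b y d : ι → ℝ} {a' b' y' d' : κ → ℝ}
    (ha : ∀ n, 0 ≤ a n) (hb : ∀ n, 0 < b n) (hpos : ∃ n, 0 < a n) (hd : ∀ n, 0 ≤ d n)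
    (ha' : ∀ n, 0 ≤ a' n) (hb' : ∀ n, 0 < b' n) (hpos' : ∃ n, 0 < a' n) (hd' : ∀ n, 0 ≤ d' n)
    {P P' B B' L L' : ℝ} (hP : 0 < P) (hP' : 0 < P') (hB : 0 ≤ B) (hB' : 0 ≤ B')
    (hne : L + ∑ n, (if d n = 0 then y n else 0) ≠ L' + ∑ n, (if d' n = 0 then y' n else 0)) :
    volume {t : ℝ | 0 < t ∧ ∃ v v', expSum a b v = t ^ 2 * P + B ∧
      expSum a' b' v' = t ^ 2 * P' + B' ∧
      L + expSum y (fun n => -d n) v = L' + expSum y' (fun n => -d' n) v'} = 0 := by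
  obtain ⟨g, hg1, hg2, hga, hgt⟩ := exists_analytic_inverse_expSum ha hb hpos
  obtain ⟨g', hg1', hg2', hga', hgt'⟩ := exists_analytic_inverse_expSum ha' hb' hpos'
  set F : ℝ → ℝ := fun t => (L + expSum y (fun n => -d n) (g (t ^ 2 * P + B))) -
    (L' + expSum y' (fun n => -d' n) (g' (t ^ 2 * P' + B'))) with hF
  have hF0 : AnalyticOnNhd ℝ F (Set.Ioi 0) := by
    intro t ht
    have ht' : 0 < t := ht
    have h1 : AnalyticAt ℝ (fun t : ℝ => g (t ^ 2 * P + B)) t :=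
      AnalyticAt.fun_comp (hga _ (by simp only [Set.mem_Ioi]; positivity)) (by fun_prop)
    have h2 : AnalyticAt ℝ (fun t : ℝ => g' (t ^ 2 * P' + B')) t :=
      AnalyticAt.fun_comp (hga' _ (by simp only [Set.mem_Ioi]; positivity)) (by fun_prop)
    exact (analyticAt_const.add ((analyticAt_expSum _ _ _).fun_comp h1)).sub
      (analyticAt_const.add ((analyticAt_expSum _ _ _).fun_comp h2))
  have harg : ∀ {P B : ℝ}, 0 < P →
      Filter.Tendsto (fun t : ℝ => t ^ 2 * P + B) Filter.atTop Filter.atTop := fun hP =>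
    Filter.tendsto_atTop_add_const_right _ _
      ((Filter.tendsto_pow_atTop two_ne_zero).atTop_mul_const hP)
  have hlim : Filter.Tendsto F Filter.atTop
      (nhds ((L + ∑ n, (if d n = 0 then y n else 0)) -
        (L' + ∑ n, (if d' n = 0 then y' n else 0)))) :=
    (((tendsto_expSum_neg_atTop hd).comp (hgt.comp (harg hP))).const_add L).sub
      (((tendsto_expSum_neg_atTop hd').comp (hgt'.comp (harg hP'))).const_add L')
  obtain ⟨t0, ht0, hFt0⟩ : ∃ t0, 0 < t0 ∧ F t0 ≠ 0 := by
    have h1 := hlim.eventually_ne (sub_ne_zero.2 hne)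
    obtain ⟨t0, h2, h3⟩ := (h1.and (Filter.eventually_gt_atTop 0)).exists
    exact ⟨t0, h3, h2⟩
  have hcod := hF0.preimage_zero_mem_codiscreteWithin hFt0 ht0
    ⟨Set.nonempty_Ioi, isPreconnected_Ioi⟩
  have hae := ae_restrict_le_codiscreteWithin (μ := (volume : Measure ℝ)) measurableSet_Ioi hcod
  rw [mem_ae_iff, Measure.restrict_apply' measurableSet_Ioi] at hae
  refine measure_mono_null ?_ hae
  rintro t ⟨ht, v, v', hv, hv', heq⟩
  refine ⟨?_, ht⟩
  simp only [Set.mem_compl_iff, Set.mem_preimage, Set.mem_singleton_iff, not_not, hF]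
  rw [← hv, ← hv', hg2, hg2', heq, sub_self]

end ExpSum

/-! ### Measurability tools -/

section Tools
variable {X : Type*} [MeasurableSpace X]

/-- All level sets of `f` are measurable; used for maps to countable types. -/
def LevelMeasurable {α : Type*} (f : X → α) : Prop := ∀ a, MeasurableSet {x | f x = a}

lemma LevelMeasurable.const {α : Type*} (a : α) : LevelMeasurable fun _ : X => a := fun b => by
  by_cases h : a = b <;> simp [h]

lemma LevelMeasurable.bind {α β : Type*} [Countable α] {f : X → α} {g : α → X → β}
    (hf : LevelMeasurable f) (hg : ∀ a, LevelMeasurable (g a)) :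
    LevelMeasurable fun x => g (f x) x := by
  intro b
  have : {x | g (f x) x = b} = ⋃ a, {x | f x = a} ∩ {x | g a x = b} := by
    ext x; simp
  rw [this]
  exact MeasurableSet.iUnion fun a => (hf a).inter (hg a b)

lemma LevelMeasurable.ite {α : Type*} {p : X → Prop} [DecidablePred p]
    (hp : MeasurableSet {x | p x}) {f g : X → α} (hf : LevelMeasurable f)
    (hg : LevelMeasurable g) : LevelMeasurable fun x => if p x then f x else g x := by
  intro a
  have : {x | (if p x then f x else g x) = a} =
      ({x | p x} ∩ {x | f x = a}) ∪ ({x | p x}ᶜ ∩ {x | g x = a}) := by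
    ext x
    by_cases h : p x <;> simp [h]
  rw [this]
  exact (hp.inter (hf a)).union (hp.compl.inter (hg a))

lemma LevelMeasurable.map {α β : Type*} [Countable α] {f : X → α} (hf : LevelMeasurable f)
    (g : α → β) : LevelMeasurable fun x => g (f x) :=
  hf.bind fun a => LevelMeasurable.const (g a)

lemma LevelMeasurable.measurable {α β : Type*} [Countable α] [MeasurableSpace β] {f : X → α}
    {F : α → X → β} (hf : LevelMeasurable f) (hF : ∀ a, Measurable (F a)) :
    Measurable fun x => F (f x) x := by
  intro t ht
  have : (fun x => F (f x) x) ⁻¹' t = ⋃ a, {x | f x = a} ∩ (F a) ⁻¹' t := by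
    ext x; simp
  rw [this]
  exact MeasurableSet.iUnion fun a => (hf a).inter (hF a ht)

lemma LevelMeasurable.measurableSet {α : Type*} [Countable α] {f : X → α}
    {F : α → X → Prop} (hf : LevelMeasurable f) (hF : ∀ a, MeasurableSet {x | F a x}) :
    MeasurableSet {x | F (f x) x} := by
  have : {x | F (f x) x} = ⋃ a, {x | f x = a} ∩ {x | F a x} := by
    ext x; simp
  rw [this]
  exact MeasurableSet.iUnion fun a => (hf a).inter (hF a)

lemma LevelMeasurable.argmax {α β : Type*} [Countable α] [LinearOrder β] {g : X → α → β}
    (hg : ∀ a b, MeasurableSet {x | g x a < g x b}) (l : List α) :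
    LevelMeasurable fun x => l.argmax (g x) := by
  induction l with
  | nil => simpa using LevelMeasurable.const (X := X) (none : Option α)
  | cons a l ih =>
    simp only [List.argmax_cons]
    refine LevelMeasurable.bind (g := fun (o : Option α) x => (Option.casesOn o (some a)
      fun c => if g x a < g x c then some c else some a : Option α)) ih fun o => ?_
    cases o with
    | none => exact LevelMeasurable.const _
    | some c =>
      exact LevelMeasurable.ite (f := fun _ => some c) (g := fun _ => some a) (hg a c)
        (LevelMeasurable.const _) (LevelMeasurable.const _)

/-- The entries of the matrix-valued function `M` are measurable. -/
def EntryMeasurable {ι κ : Type*} (M : X → Matrix ι κ ℂ) : Prop :=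
  ∀ i j, Measurable fun x => M x i j

variable {ι κ ρ : Type*}

lemma EntryMeasurable.mul [Fintype κ] {A : X → Matrix ι κ ℂ} {B : X → Matrix κ ρ ℂ}
    (hA : EntryMeasurable A) (hB : EntryMeasurable B) : EntryMeasurable fun x => A x * B x := by
  intro i j
  simp only [Matrix.mul_apply]
  exact Finset.measurable_sum _ fun k _ => (hA i k).mul (hB k j)

lemma EntryMeasurable.add {A B : X → Matrix ι κ ℂ}
    (hA : EntryMeasurable A) (hB : EntryMeasurable B) : EntryMeasurable fun x => A x + B x :=
  fun i j => (hA i j).add (hB i j)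

lemma EntryMeasurable.const (A : Matrix ι κ ℂ) : EntryMeasurable fun _ : X => A :=
  fun _ _ => measurable_const

lemma EntryMeasurable.smul {A : X → Matrix ι κ ℂ} (hA : EntryMeasurable A) {c : X → ℂ}
    (hc : Measurable c) : EntryMeasurable fun x => c x • A x :=
  fun i j => hc.mul (hA i j)

lemma EntryMeasurable.conjTranspose {A : X → Matrix ι κ ℂ} (hA : EntryMeasurable A) :
    EntryMeasurable fun x => (A x)ᴴ :=
  fun i j => Complex.continuous_conj.measurable.comp (hA j i)

lemma EntryMeasurable.det [Fintype ι] [DecidableEq ι] {A : X → Matrix ι ι ℂ}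
    (hA : EntryMeasurable A) : Measurable fun x => (A x).det := by
  simp only [Matrix.det_apply]
  refine Finset.measurable_sum _ fun σ _ => ?_
  exact (Finset.measurable_prod _ fun i _ => hA (σ i) i).const_smul _

lemma EntryMeasurable.trace [Fintype ι] {A : X → Matrix ι ι ℂ}
    (hA : EntryMeasurable A) : Measurable fun x => (A x).trace :=
  Finset.measurable_sum _ fun i _ => hA i i

end Tools

/-! ### Precoded channels through the projection onto the range of the precoder -/

section Precoded
variable {ι α κ : Type*} [Fintype ι] [DecidableEq ι] [Fintype α] [Fintype κ]
  [DecidableEq κ]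

/-- The rate, with power `p`, of the channel `A` with precoder range projection `Q` for an input
covariance proportional to `Q X Xᴴ Q`.  If `Q X = 0` the value is `0`. -/
def precodedRate (c : ℝ) (A : Matrix ι α ℂ) (Q : Matrix α α ℂ) (X : α → α → ℂ) (p : ℝ) : ℝ :=
  c * Real.log (1 + ((p / (Q * Matrix.of X * (Q * Matrix.of X)ᴴ).trace.re : ℝ) : ℂ) •
    (A * (Q * Matrix.of X * (Q * Matrix.of X)ᴴ) * Aᴴ)).det.re

variable {c : ℝ} (A : Matrix ι α ℂ) {Γ : Matrix α κ ℂ}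

lemma Matrix.PosSemidef.exists_eq_mul_conjTranspose {M : Matrix κ κ ℂ} (hM : M.PosSemidef) :
    ∃ Y : Matrix κ κ ℂ, M = Y * Yᴴ := by
  obtain ⟨U, hU⟩ : ∃ U : Matrix κ κ ℂ, M = U *
      Matrix.diagonal (fun i => ((hM.isHermitian.eigenvalues i : ℝ) : ℂ)) * Uᴴ :=
    ⟨hM.isHermitian.eigenvectorUnitary, hM.isHermitian.spectral_theorem⟩
  refine ⟨U * Matrix.diagonal fun i => ((√(hM.isHermitian.eigenvalues i) : ℝ) : ℂ), ?_⟩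
  conv_lhs => rw [hU]
  rw [Matrix.conjTranspose_mul, Matrix.diagonal_conjTranspose, Matrix.mul_assoc, Matrix.mul_assoc]
  congr 1
  rw [← Matrix.mul_assoc, Matrix.diagonal_mul_diagonal]
  congr 2
  ext i
  simp only [Pi.star_apply, RCLike.star_def, Complex.conj_ofReal]
  rw [← Complex.ofReal_mul, Real.mul_self_sqrt (hM.eigenvalues_nonneg i)]

/-- The normalized covariance that `X` stands for, projected onto the range of `Γ`, is admissible in
the definition of the capacity of `A * Γ`. -/
lemma precodedRate_mem (hc : 0 ≤ c) (hΓ : Γᴴ * Γ = 1) (X : α → α → ℂ) {p : ℝ} (hp : 0 ≤ p) :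
    0 ≤ precodedRate c A (Γ * Γᴴ) X p ∧
      precodedRate c A (Γ * Γᴴ) X p ≤ mimoCapacity c (A * Γ) p := by
  classical
  unfold precodedRate
  set Z := Γ * Γᴴ * Matrix.of X with hZ
  set t := (Z * Zᴴ).trace.re with ht
  have hZp : (Z * Zᴴ).PosSemidef := Matrix.posSemidef_self_mul_conjTranspose Z
  have ht0 : 0 ≤ t := (Complex.nonneg_iff.1 hZp.trace_nonneg).1
  have htC : (Z * Zᴴ).trace = (t : ℂ) := by
    refine Complex.ext rfl ?_
    simpa using (Complex.nonneg_iff.1 hZp.trace_nonneg).2.symm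
  set Ξ : Matrix κ κ ℂ := ((p / t : ℝ) : ℂ) • (Γᴴ * (Z * Zᴴ) * Γ) with hΞ
  have hΞp : Ξ.PosSemidef := by
    refine (hZp.conjTranspose_mul_mul_same Γ).smul ?_
    exact Complex.zero_le_real.2 (div_nonneg hp ht0)
  have hΓZ : Γ * (Γᴴ * Z) = Z := by
    rw [hZ]
    calc Γ * (Γᴴ * (Γ * Γᴴ * Matrix.of X)) = Γ * (Γᴴ * Γ) * Γᴴ * Matrix.of X := by
          simp only [Matrix.mul_assoc]
      _ = _ := by rw [hΓ, Matrix.mul_one]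
  have hmain : A * Γ * Ξ * (A * Γ)ᴴ = ((p / t : ℝ) : ℂ) • (A * (Z * Zᴴ) * Aᴴ) := by
    rw [hΞ, Matrix.mul_smul, Matrix.smul_mul]
    congr 1
    have h2 : (Γ * (Γᴴ * Z))ᴴ = Zᴴ * (Γ * Γᴴ) := by
      simp only [Matrix.conjTranspose_mul, Matrix.conjTranspose_conjTranspose, Matrix.mul_assoc]
    calc A * Γ * (Γᴴ * (Z * Zᴴ) * Γ) * (A * Γ)ᴴ
        = A * (Γ * (Γᴴ * Z)) * (Zᴴ * (Γ * Γᴴ)) * Aᴴ := by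
          simp only [Matrix.conjTranspose_mul, Matrix.mul_assoc]
      _ = A * (Z * Zᴴ) * Aᴴ := by rw [← h2, hΓZ]; simp only [Matrix.mul_assoc]
  have h1 := one_le_det_capacity (A * Γ) hΞp
  rw [hmain] at h1
  refine ⟨mul_nonneg hc (Real.log_nonneg h1), ?_⟩
  rcases ht0.eq_or_lt with h0 | hpos
  · rw [← h0, div_zero]
    simpa using mimoCapacity_nonneg hc (A * Γ) p
  · refine le_csSup (mimoCapacity_bddAbove hc (A * Γ) p) ⟨Ξ, hΞp, ?_, by rw [hmain]⟩
    rw [hΞ, Matrix.trace_smul, Matrix.mul_assoc, Matrix.trace_mul_comm, Matrix.mul_assoc,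
      Matrix.mul_assoc]
    have : Zᴴ * (Γ * Γᴴ) = Zᴴ := by
      have := congrArg Matrix.conjTranspose hΓZ
      simpa only [Matrix.conjTranspose_mul, Matrix.conjTranspose_conjTranspose,
        Matrix.mul_assoc] using this
    rw [this, htC, smul_eq_mul, ← Complex.ofReal_mul, div_mul_cancel₀ _ hpos.ne']

lemma continuousAt_precodedRate {Q : Matrix α α ℂ} {X : α → α → ℂ} (p : ℝ)
    (h1 : 0 < (1 + ((p / (Q * Matrix.of X * (Q * Matrix.of X)ᴴ).trace.re : ℝ) : ℂ) •
      (A * (Q * Matrix.of X * (Q * Matrix.of X)ᴴ) * Aᴴ)).det.re)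
    (h : (Q * Matrix.of X * (Q * Matrix.of X)ᴴ).trace.re ≠ 0) :
    ContinuousAt (fun X => precodedRate c A Q X p) X := by
  unfold precodedRate
  have hof : Continuous fun X : α → α → ℂ => Matrix.of X := continuous_id
  have hZ : Continuous fun X : α → α → ℂ => Q * Matrix.of X * (Q * Matrix.of X)ᴴ := by fun_prop
  have ht : Continuous fun X : α → α → ℂ => (Q * Matrix.of X * (Q * Matrix.of X)ᴴ).trace.re :=
    Complex.continuous_re.comp hZ.matrix_trace
  have hq : ContinuousAt (fun X : α → α → ℂ =>
      ((p / (Q * Matrix.of X * (Q * Matrix.of X)ᴴ).trace.re : ℝ) : ℂ)) X :=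
    Complex.continuous_ofReal.continuousAt.comp (continuousAt_const.div ht.continuousAt h)
  have hdet : ContinuousAt (fun X : α → α → ℂ =>
      (1 + ((p / (Q * Matrix.of X * (Q * Matrix.of X)ᴴ).trace.re : ℝ) : ℂ) •
        (A * (Q * Matrix.of X * (Q * Matrix.of X)ᴴ) * Aᴴ)).det) X := by
    have hM : ContinuousAt (fun X : α → α → ℂ =>
      (1 + ((p / (Q * Matrix.of X * (Q * Matrix.of X)ᴴ).trace.re : ℝ) : ℂ) •
        (A * (Q * Matrix.of X * (Q * Matrix.of X)ᴴ) * Aᴴ))) X :=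
      continuousAt_const.add (hq.smul (by fun_prop))
    exact (continuous_id.matrix_det).continuousAt.comp hM
  exact continuousAt_const.mul ((Complex.continuous_re.continuousAt.comp hdet).log h1.ne')

/-- The capacity of a precoded channel is approached along any dense family of covariance
directions. -/
lemma mimoCapacity_eq_iSup (hc : 0 ≤ c) (hΓ : Γᴴ * Γ = 1) {p : ℝ} (hp : 0 ≤ p)
    {D : ℕ → α → α → ℂ} (hD : DenseRange D) :
    mimoCapacity c (A * Γ) p = ⨆ k, precodedRate c A (Γ * Γᴴ) (D k) p := by
  classical
  have hbdd : BddAbove (Set.range fun k => precodedRate c A (Γ * Γᴴ) (D k) p) :=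
    ⟨_, by rintro _ ⟨k, rfl⟩; exact (precodedRate_mem A hc hΓ (D k) hp).2⟩
  refine le_antisymm ?_ (ciSup_le fun k => (precodedRate_mem A hc hΓ (D k) hp).2)
  have hnn : 0 ≤ ⨆ k, precodedRate c A (Γ * Γᴴ) (D k) p :=
    (precodedRate_mem A hc hΓ (D 0) hp).1.trans (le_ciSup hbdd 0)
  refine Real.sSup_le ?_ hnn
  rintro r ⟨Ξ, hΞ, htr, rfl⟩
  rcases hp.eq_or_lt with h0 | hpos
  · have : Ξ = 0 := hΞ.trace_eq_zero_iff.1 (by rw [htr, ← h0]; simp)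
    simpa [this] using hnn
  obtain ⟨Y, hY⟩ := (hΞ.mul_mul_conjTranspose_same Γ).exists_eq_mul_conjTranspose
  have hZ : Γ * Γᴴ * Y * (Γ * Γᴴ * Y)ᴴ = Γ * Ξ * Γᴴ := by
    calc Γ * Γᴴ * Y * (Γ * Γᴴ * Y)ᴴ = Γ * Γᴴ * (Y * Yᴴ) * (Γ * Γᴴ) := by
          simp only [Matrix.conjTranspose_mul, Matrix.conjTranspose_conjTranspose, Matrix.mul_assoc]
      _ = Γ * (Γᴴ * Γ) * Ξ * (Γᴴ * Γ) * Γᴴ := by rw [← hY]; simp only [Matrix.mul_assoc]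
      _ = _ := by rw [hΓ, Matrix.mul_one, Matrix.mul_one]
  have htrZ : (Γ * Γᴴ * Y * (Γ * Γᴴ * Y)ᴴ).trace.re = p := by
    rw [hZ, Matrix.mul_assoc, Matrix.trace_mul_comm, Matrix.mul_assoc, hΓ, Matrix.mul_one, htr,
      Complex.ofReal_re]
  have hval : (1 + ((p / (Γ * Γᴴ * Y * (Γ * Γᴴ * Y)ᴴ).trace.re : ℝ) : ℂ) •
      (A * (Γ * Γᴴ * Y * (Γ * Γᴴ * Y)ᴴ) * Aᴴ)) = 1 + A * Γ * Ξ * (A * Γ)ᴴ := by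
    rw [htrZ, div_self hpos.ne', hZ, Complex.ofReal_one, one_smul, Matrix.conjTranspose_mul]
    simp only [Matrix.mul_assoc]
  have hcont := continuousAt_precodedRate (c := c) A (Q := Γ * Γᴴ) (X := Y) p
    (by
      have := one_le_det_capacity (A * Γ) hΞ
      rw [← hval] at this
      exact one_pos.trans_le this)
    (by
      have h3 : (Γ * Γᴴ * Matrix.of Y * (Γ * Γᴴ * Matrix.of Y)ᴴ).trace.re = p := htrZ
      rw [h3]; exact hpos.ne')
  have hgY : precodedRate c A (Γ * Γᴴ) Y p =
      c * Real.log (1 + A * Γ * Ξ * (A * Γ)ᴴ).det.re := by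
    rw [← hval]; rfl
  refine le_of_forall_lt fun a ha => ?_
  rw [← hgY] at ha
  obtain ⟨k, hk⟩ := hD.exists_mem_open isOpen_interior
    ⟨_, mem_interior_iff_mem_nhds.2 (hcont.eventually_const_lt ha)⟩
  have hk' := interior_subset hk
  exact (show a < precodedRate c A (Γ * Γᴴ) (D k) p from hk').trans_le
    (le_ciSup hbdd k)

lemma measurable_precodedRate {Y : Type*} [MeasurableSpace Y] {A : Y → Matrix ι α ℂ}
    {Q : Y → Matrix α α ℂ} (hA : EntryMeasurable A) (hQ : EntryMeasurable Q) (X : α → α → ℂ)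
    {p : Y → ℝ} (hp : Measurable p) :
    Measurable fun y => precodedRate c (A y) (Q y) X (p y) := by
  have hZ : EntryMeasurable fun y => Q y * Matrix.of X * (Q y * Matrix.of X)ᴴ :=
    (hQ.mul (EntryMeasurable.const _)).mul (hQ.mul (EntryMeasurable.const _)).conjTranspose
  have ht : Measurable fun y => ((p y / (Q y * Matrix.of X *
      (Q y * Matrix.of X)ᴴ).trace.re : ℝ) : ℂ) :=
    Complex.measurable_ofReal.comp (hp.div (Complex.measurable_re.comp hZ.trace))
  have hM := (EntryMeasurable.const (X := Y) (1 : Matrix ι ι ℂ)).add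
    (((hA.mul hZ).mul hA.conjTranspose).smul ht)
  exact (Real.measurable_log.comp (Complex.measurable_re.comp hM.det)).const_mul c

lemma one_le_det_precoded (Q : Matrix α α ℂ) (X : α → α → ℂ) {p : ℝ} (hp : 0 ≤ p) :
    1 ≤ (1 + ((p / (Q * Matrix.of X * (Q * Matrix.of X)ᴴ).trace.re : ℝ) : ℂ) •
      (A * (Q * Matrix.of X * (Q * Matrix.of X)ᴴ) * Aᴴ)).det.re := by
  classical
  have hZp := Matrix.posSemidef_self_mul_conjTranspose (Q * Matrix.of X)
  have h := one_le_det_capacity A (hZp.smul (a := ((p / (Q * Matrix.of X *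
    (Q * Matrix.of X)ᴴ).trace.re : ℝ) : ℂ)) (Complex.zero_le_real.2
      (div_nonneg hp (Complex.nonneg_iff.1 hZp.trace_nonneg).1)))
  rwa [Matrix.mul_smul, Matrix.smul_mul] at h

lemma continuousAt_precodedRate_power (Q : Matrix α α ℂ) (X : α → α → ℂ) {p : ℝ} (hp : 0 ≤ p) :
    ContinuousAt (fun p => precodedRate c A Q X p) p := by
  have h1 := one_le_det_precoded A Q X hp
  unfold precodedRate
  refine continuousAt_const.mul (ContinuousAt.log ?_ (one_pos.trans_le h1).ne')
  refine Complex.continuous_re.continuousAt.comp ?_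
  refine (Continuous.matrix_det ?_).continuousAt
  have h2 : Continuous fun p : ℝ =>
      ((p / (Q * Matrix.of X * (Q * Matrix.of X)ᴴ).trace.re : ℝ) : ℂ) :=
    Complex.continuous_ofReal.comp (continuous_id.div_const _)
  fun_prop

/-- Lower semicontinuity of the capacity in the power. -/
lemma eventually_lt_mimoCapacity (hc : 0 ≤ c) (hΓ : Γᴴ * Γ = 1) {p : ℝ} (hp : 0 ≤ p) {r : ℝ}
    (hr : r < mimoCapacity c (A * Γ) p) :
    ∀ᶠ p' in nhdsWithin p (Set.Ici 0), r < mimoCapacity c (A * Γ) p' := by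
  rw [mimoCapacity_eq_iSup A hc hΓ hp
    (TopologicalSpace.denseRange_denseSeq (α → α → ℂ))] at hr
  obtain ⟨k, hk⟩ := exists_lt_of_lt_ciSup hr
  have h := (continuousAt_precodedRate_power A (c := c) (Γ * Γᴴ) _ hp).eventually_const_lt hk
  filter_upwards [nhdsWithin_le_nhds h, self_mem_nhdsWithin] with p' h1 h2
  exact h1.trans_le (precodedRate_mem A hc hΓ _ h2).2

end Precoded

/-! ### The projection onto a joint null space -/

section Projection
variable {α κ : Type*} [Fintype α] [DecidableEq α] [Fintype κ] [DecidableEq κ]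

/-- If the columns of `Γ` are an orthonormal basis of the kernel of a positive semidefinite `S`,
then `(1 + k S)⁻¹` tends to the projection `Γ Γᴴ`. -/
lemma tendsto_inv_one_add_smul {S : Matrix α α ℂ} (hS : S.PosSemidef) {Γ : Matrix α κ ℂ}
    (hΓ : Γᴴ * Γ = 1) (hker : ∀ v : α → ℂ, S.mulVec v = 0 ↔ (Γ * Γᴴ).mulVec v = v) (i j : α) :
    Filter.Tendsto (fun k : ℕ => ((1 + (k : ℂ) • S)⁻¹ : Matrix α α ℂ) i j) Filter.atTop
      (nhds ((Γ * Γᴴ) i j)) := by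
  obtain ⟨V, d, hVV, hVV', hd, hSV⟩ : ∃ (V : Matrix α α ℂ) (d : α → ℝ), Vᴴ * V = 1 ∧
      V * Vᴴ = 1 ∧ (∀ k, 0 ≤ d k) ∧ S = V * Matrix.diagonal (fun i => (d i : ℂ)) * Vᴴ :=
    ⟨hS.isHermitian.eigenvectorUnitary, hS.isHermitian.eigenvalues,
      Unitary.coe_star_mul_self hS.isHermitian.eigenvectorUnitary,
      Unitary.coe_mul_star_self hS.isHermitian.eigenvectorUnitary, hS.eigenvalues_nonneg,
      hS.isHermitian.spectral_theorem⟩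
  have hne : ∀ (k : ℕ) i, (1 : ℂ) + (k : ℂ) * (d i : ℂ) ≠ 0 := by
    intro k i
    have : (0 : ℝ) < 1 + k * d i := by have := hd i; positivity
    exact_mod_cast this.ne'
  have hinv : ∀ k : ℕ, (1 + (k : ℂ) • S)⁻¹ =
      V * Matrix.diagonal (fun i => (1 + (k : ℂ) * (d i : ℂ))⁻¹) * Vᴴ := by
    intro k
    refine Matrix.inv_eq_right_inv ?_
    have h1 : 1 + (k : ℂ) • S =
        V * Matrix.diagonal (fun i => 1 + (k : ℂ) * (d i : ℂ)) * Vᴴ := by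
      have : Matrix.diagonal (fun i => 1 + (k : ℂ) * (d i : ℂ)) =
          1 + (k : ℂ) • Matrix.diagonal (fun i => (d i : ℂ)) := by
        rw [← Matrix.diagonal_one, ← Matrix.diagonal_smul, Matrix.diagonal_add]
        rfl
      rw [this, Matrix.mul_add, Matrix.add_mul, Matrix.mul_one, hVV', Matrix.mul_smul,
        Matrix.smul_mul, ← hSV]
    rw [h1]
    calc _ = V * Matrix.diagonal (fun i => 1 + (k : ℂ) * (d i : ℂ)) * (Vᴴ * V) *
          Matrix.diagonal (fun i => (1 + (k : ℂ) * (d i : ℂ))⁻¹) * Vᴴ := by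
          simp only [Matrix.mul_assoc]
      _ = V * (Matrix.diagonal (fun i => 1 + (k : ℂ) * (d i : ℂ)) *
          Matrix.diagonal (fun i => (1 + (k : ℂ) * (d i : ℂ))⁻¹)) * Vᴴ := by
          rw [hVV, Matrix.mul_one]; simp only [Matrix.mul_assoc]
      _ = 1 := by
          rw [Matrix.diagonal_mul_diagonal]
          simp only [mul_inv_cancel₀ (hne k _)]
          rw [Matrix.diagonal_one, Matrix.mul_one, hVV']
  set e : α → ℂ := fun i => if d i = 0 then 1 else 0 with he
  set Q' : Matrix α α ℂ := V * Matrix.diagonal e * Vᴴ with hQ'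
  have hde : ∀ i, (d i : ℂ) * e i = 0 := by
    intro i; by_cases h : d i = 0 <;> simp [he, h]
  have hQ'H : Q'ᴴ = Q' := by
    rw [hQ', Matrix.conjTranspose_mul, Matrix.conjTranspose_mul, Matrix.diagonal_conjTranspose,
      Matrix.conjTranspose_conjTranspose, Matrix.mul_assoc]
    congr 3
    ext i; by_cases h : d i = 0 <;> simp [he, h]
  have hQH : (Γ * Γᴴ)ᴴ = Γ * Γᴴ := by simp
  have hSQ' : S * Q' = 0 := by
    rw [hSV, hQ']
    calc _ = V * Matrix.diagonal (fun i => (d i : ℂ)) * (Vᴴ * V) * Matrix.diagonal e * Vᴴ := by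
          simp only [Matrix.mul_assoc]
      _ = V * (Matrix.diagonal (fun i => (d i : ℂ)) * Matrix.diagonal e) * Vᴴ := by
          rw [hVV, Matrix.mul_one]; simp only [Matrix.mul_assoc]
      _ = 0 := by rw [Matrix.diagonal_mul_diagonal]; simp [hde]
  have hQQ' : Γ * Γᴴ * Q' = Q' := by
    ext a b
    have h1 : S.mulVec (fun a => Q' a b) = 0 := by
      ext a'; exact congrFun (congrFun hSQ' a') b
    exact congrFun ((hker _).1 h1) a
  have hSQ : S * (Γ * Γᴴ) = 0 := by
    have hidem : Γ * Γᴴ * (Γ * Γᴴ) = Γ * Γᴴ := by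
      calc _ = Γ * (Γᴴ * Γ) * Γᴴ := by simp only [Matrix.mul_assoc]
        _ = _ := by rw [hΓ, Matrix.mul_one]
    ext a b
    have h1 : (Γ * Γᴴ).mulVec (fun a => (Γ * Γᴴ) a b) = fun a => (Γ * Γᴴ) a b := by
      ext a'; exact congrFun (congrFun hidem a') b
    exact congrFun ((hker _).2 h1) a
  have hQ'Q : Q' * (Γ * Γᴴ) = Γ * Γᴴ := by
    have h1 : Matrix.diagonal (fun i => (d i : ℂ)) * (Vᴴ * (Γ * Γᴴ)) = 0 := by
      calc _ = (Vᴴ * V) * Matrix.diagonal (fun i => (d i : ℂ)) * (Vᴴ * (Γ * Γᴴ)) := by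
            rw [hVV, Matrix.one_mul]
        _ = Vᴴ * (S * (Γ * Γᴴ)) := by rw [hSV]; simp only [Matrix.mul_assoc]
        _ = 0 := by rw [hSQ, Matrix.mul_zero]
    have h2 : Matrix.diagonal e * (Vᴴ * (Γ * Γᴴ)) = Vᴴ * (Γ * Γᴴ) := by
      ext a b
      rw [Matrix.diagonal_mul]
      have h3 := congrFun (congrFun h1 a) b
      rw [Matrix.diagonal_mul] at h3
      by_cases h : d a = 0
      · simp [he, h]
      · rcases mul_eq_zero.1 h3 with h4 | h4
        · exact absurd (Complex.ofReal_eq_zero.1 h4) h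
        · rw [h4, mul_zero]
    calc _ = V * (Matrix.diagonal e * (Vᴴ * (Γ * Γᴴ))) := by
          rw [hQ']; simp only [Matrix.mul_assoc]
      _ = (V * Vᴴ) * (Γ * Γᴴ) := by rw [h2]; simp only [Matrix.mul_assoc]
      _ = _ := by rw [hVV', Matrix.one_mul]
  have hEq : Q' = Γ * Γᴴ := by
    have h1 := congrArg Matrix.conjTranspose hQQ'
    rw [Matrix.conjTranspose_mul, hQ'H, hQH] at h1
    rw [← h1, hQ'Q]
  rw [← hEq]
  have hentry : ∀ f : α → ℂ, (V * Matrix.diagonal f * Vᴴ) i j =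
      ∑ l, V i l * f l * Vᴴ l j := fun f => by
    rw [Matrix.mul_apply]; simp only [Matrix.mul_diagonal]
  simp only [hinv, hQ', hentry]
  refine tendsto_finsetSum _ fun l _ => Filter.Tendsto.mul_const _ (Filter.Tendsto.const_mul _ ?_)
  by_cases h : d l = 0
  · simp [he, h]
  · have h0 : 0 < d l := lt_of_le_of_ne (hd l) (Ne.symm h)
    have h1 : Filter.Tendsto (fun k : ℕ => (1 + (k : ℝ) * d l)⁻¹) Filter.atTop (nhds 0) :=
      (Filter.tendsto_atTop_add_const_left _ _
        (tendsto_natCast_atTop_atTop.atTop_mul_const h0)).inv_tendsto_atTop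
    have h2 := (Complex.continuous_ofReal.tendsto 0).comp h1
    simp only [he, if_neg h]
    refine Filter.Tendsto.congr (fun k => ?_) (by simpa using h2)
    simp

end Projection

section BasisMatrix
variable {α : Type*} [Fintype α]

/-- The matrix whose columns are the standard orthonormal basis of the subspace `K`. -/
def basisMatrix (K : Submodule ℂ (EuclideanSpace ℂ α)) :
    Matrix α (Fin (Module.finrank ℂ K)) ℂ :=
  Matrix.of fun a k => (stdOrthonormalBasis ℂ K k : EuclideanSpace ℂ α) a

lemma basisMatrix_conjTranspose_mul (K : Submodule ℂ (EuclideanSpace ℂ α)) :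
    (basisMatrix K)ᴴ * basisMatrix K = 1 := by
  ext k l
  have h := orthonormal_iff_ite.1 (stdOrthonormalBasis ℂ K).orthonormal k l
  rw [Submodule.coe_inner, EuclideanSpace.inner_eq_star_dotProduct] at h
  rw [Matrix.mul_apply, Matrix.one_apply, ← h, dotProduct]
  exact Finset.sum_congr rfl fun a _ => mul_comm _ _

lemma basisMatrix_mulVec_eq_self_iff (K : Submodule ℂ (EuclideanSpace ℂ α)) (v : α → ℂ) :
    (basisMatrix K * (basisMatrix K)ᴴ).mulVec v = v ↔ WithLp.toLp 2 v ∈ K := by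
  have hcol : ∀ w : Fin (Module.finrank ℂ K) → ℂ, WithLp.toLp 2 ((basisMatrix K).mulVec w) =
      ((∑ k, w k • stdOrthonormalBasis ℂ K k : K) : EuclideanSpace ℂ α) := by
    intro w
    ext a
    simp [basisMatrix, Matrix.mulVec, dotProduct, mul_comm]
  constructor
  · intro h
    rw [← h, ← Matrix.mulVec_mulVec, hcol]
    exact Submodule.coe_mem _
  · intro h
    have h1 := (stdOrthonormalBasis ℂ K).sum_repr' ⟨_, h⟩
    have h2 : ((basisMatrix K)ᴴ).mulVec v =
        fun k => inner ℂ (stdOrthonormalBasis ℂ K k) (⟨_, h⟩ : K) := by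
      ext k
      rw [Submodule.coe_inner, EuclideanSpace.inner_eq_star_dotProduct]
      simp only [Matrix.mulVec, dotProduct, Matrix.conjTranspose_apply, basisMatrix, Matrix.of_apply]
      exact Finset.sum_congr rfl fun a _ => mul_comm _ _
    have h3 := hcol (fun k => inner ℂ (stdOrthonormalBasis ℂ K k) (⟨_, h⟩ : K))
    rw [h1, ← h2, Matrix.mulVec_mulVec] at h3
    exact (WithLp.toLp_injective 2) h3

end BasisMatrix

namespace DownlinkSystem

variable {Kbs Kmu : ℕ} (S : DownlinkSystem Kbs Kmu)

lemma BT_pos : 0 < S.BT := mul_pos S.B_pos S.T_pos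

lemma entryMeasurable_channel (Ω : Finset (Fin Kbs)) (n : Fin Kmu) :
    EntryMeasurable fun H : S.State => S.channel H Ω n := by
  intro i a
  exact (measurable_pi_apply a.2).comp ((measurable_pi_apply i).comp
    ((measurable_pi_apply a.1.1).comp (measurable_pi_apply n)))

lemma continuous_channel (Ω : Finset (Fin Kbs)) (n : Fin Kmu) :
    Continuous fun H : S.State => S.channel H Ω n := by
  refine continuous_matrix fun i a => ?_
  exact (continuous_apply a.2).comp ((continuous_apply i).comp
    ((continuous_apply a.1.1).comp (continuous_apply n)))

/-- The projection onto the joint null space. -/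
def nullProj (H : S.State) (Ω : Finset (Fin Kbs)) (U : Finset (Fin Kmu)) (n : Fin Kmu) :
    Matrix (S.Antenna Ω) (S.Antenna Ω) ℂ :=
  S.precoder H Ω U n * (S.precoder H Ω U n)ᴴ

lemma precoder_conjTranspose_mul (H : S.State) (Ω : Finset (Fin Kbs)) (U : Finset (Fin Kmu))
    (n : Fin Kmu) : (S.precoder H Ω U n)ᴴ * S.precoder H Ω U n = 1 :=
  basisMatrix_conjTranspose_mul (S.nullSpace H Ω U n)

lemma mem_nullSpace (H : S.State) (Ω : Finset (Fin Kbs)) (U : Finset (Fin Kmu)) (n : Fin Kmu)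
    (v : S.Antenna Ω → ℂ) : WithLp.toLp 2 v ∈ S.nullSpace H Ω U n ↔
      ∀ i ∈ U.erase n, (S.channel H Ω i).mulVec v = 0 := by
  simp only [nullSpace, Submodule.mem_iInf, LinearMap.mem_ker]
  refine forall₂_congr fun i _ => ?_
  rw [Matrix.toLpLin_toLp]
  simp

lemma nullProj_mulVec_eq_self_iff (H : S.State) (Ω : Finset (Fin Kbs)) (U : Finset (Fin Kmu))
    (n : Fin Kmu) (v : S.Antenna Ω → ℂ) : (S.nullProj H Ω U n).mulVec v = v ↔
      ∀ i ∈ U.erase n, (S.channel H Ω i).mulVec v = 0 := by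
  rw [← S.mem_nullSpace H Ω U n v]
  exact basisMatrix_mulVec_eq_self_iff (S.nullSpace H Ω U n) v

/-- The sum of the Gram matrices of the channels of the users in `U` other than `n`. -/
def interferenceGram (H : S.State) (Ω : Finset (Fin Kbs)) (U : Finset (Fin Kmu)) (n : Fin Kmu) :
    Matrix (S.Antenna Ω) (S.Antenna Ω) ℂ :=
  ∑ i ∈ U.erase n, (S.channel H Ω i)ᴴ * S.channel H Ω i

lemma interferenceGram_posSemidef (H : S.State) (Ω : Finset (Fin Kbs)) (U : Finset (Fin Kmu))
    (n : Fin Kmu) : (S.interferenceGram H Ω U n).PosSemidef :=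
  Matrix.posSemidef_sum _ fun _ _ => Matrix.posSemidef_conjTranspose_mul_self _

lemma interferenceGram_mulVec_eq_zero_iff (H : S.State) (Ω : Finset (Fin Kbs))
    (U : Finset (Fin Kmu)) (n : Fin Kmu) (v : S.Antenna Ω → ℂ) :
    (S.interferenceGram H Ω U n).mulVec v = 0 ↔
      ∀ i ∈ U.erase n, (S.channel H Ω i).mulVec v = 0 := by
  constructor
  · intro h
    have h1 : ∑ i ∈ U.erase n, star ((S.channel H Ω i).mulVec v) ⬝ᵥ (S.channel H Ω i).mulVec v =
        0 := by
      have : star v ⬝ᵥ (S.interferenceGram H Ω U n).mulVec v = 0 := by rw [h, dotProduct_zero]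
      rw [interferenceGram, Matrix.sum_mulVec, dotProduct_sum] at this
      rw [← this]
      refine Finset.sum_congr rfl fun i _ => ?_
      rw [← Matrix.mulVec_mulVec, Matrix.dotProduct_mulVec (star v), Matrix.star_mulVec]
    rw [Finset.sum_eq_zero_iff_of_nonneg (fun i _ => dotProduct_star_self_nonneg _)] at h1
    intro i hi
    exact dotProduct_star_self_eq_zero.1 (h1 i hi)
  · intro h
    rw [interferenceGram, Matrix.sum_mulVec]
    refine Finset.sum_eq_zero fun i hi => ?_
    rw [← Matrix.mulVec_mulVec, h i hi, Matrix.mulVec_zero]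

/-- The precoder itself depends on a choice of bases and need not be measurable in the fading state,
but the projection onto its range is the pointwise limit of `(1 + k • interferenceGram)⁻¹`. -/
lemma entryMeasurable_nullProj (Ω : Finset (Fin Kbs)) (U : Finset (Fin Kmu)) (n : Fin Kmu) :
    EntryMeasurable fun H : S.State => S.nullProj H Ω U n := by
  intro a b
  refine measurable_of_tendsto_metrizable (f := fun (k : ℕ) (H : S.State) =>
    ((1 + (k : ℂ) • S.interferenceGram H Ω U n)⁻¹ : Matrix _ _ ℂ) a b) (fun k => ?_) ?_
  · have hcG : Continuous fun H : S.State => S.interferenceGram H Ω U n := by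
      refine continuous_finsetSum _ fun i _ => ?_
      have := S.continuous_channel Ω i
      fun_prop
    have hc : Continuous fun H : S.State => 1 + (k : ℂ) • S.interferenceGram H Ω U n := by
      fun_prop
    have hdet : Continuous fun H : S.State => (1 + (k : ℂ) • S.interferenceGram H Ω U n).det :=
      hc.matrix_det
    have hadj : Continuous fun H : S.State =>
        (1 + (k : ℂ) • S.interferenceGram H Ω U n).adjugate a b :=
      (hc.matrix_adjugate).matrix_elem a b
    simp only [Matrix.inv_def, Ring.inverse_eq_inv, Matrix.smul_apply, smul_eq_mul]
    exact hdet.measurable.inv.mul hadj.measurable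
  · rw [tendsto_pi_nhds]
    intro H
    refine tendsto_inv_one_add_smul (S.interferenceGram_posSemidef H Ω U n)
      (S.precoder_conjTranspose_mul H Ω U n) (fun v => ?_) a b
    rw [interferenceGram_mulVec_eq_zero_iff, ← nullProj_mulVec_eq_self_iff]
    rfl

/-- The rate of user `n` for a fixed choice of base stations and active users. -/
def frozenRate (H : S.State) (Ω : Finset (Fin Kbs)) (U : Finset (Fin Kmu)) (n : Fin Kmu)
    (p : ℝ) : ℝ :=
  if n ∈ U then mimoCapacity S.BT (S.effChannel H Ω U n) p else 0

/-- The rate is a countable supremum over a dense set of directions of the input covariance, each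
term depending on the precoder only through its projection. -/
lemma measurable_frozenRate (Ω : Finset (Fin Kbs)) (U : Finset (Fin Kmu)) (n : Fin Kmu)
    {p : S.State → ℝ} (hp : Measurable p) (hp0 : ∀ H, 0 ≤ p H) :
    Measurable fun H => S.frozenRate H Ω U n (p H) := by
  unfold frozenRate
  split_ifs with h
  · have : (fun H => mimoCapacity S.BT (S.effChannel H Ω U n) (p H)) = fun H =>
        ⨆ k, precodedRate S.BT (S.channel H Ω n) (S.nullProj H Ω U n)
          (TopologicalSpace.denseSeq (S.Antenna Ω → S.Antenna Ω → ℂ) k) (p H) := by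
      ext H
      exact mimoCapacity_eq_iSup _ S.BT_pos.le (S.precoder_conjTranspose_mul H Ω U n) (hp0 H)
        (TopologicalSpace.denseRange_denseSeq _)
    rw [this]
    exact Measurable.iSup fun k => measurable_precodedRate (S.entryMeasurable_channel Ω n)
      (S.entryMeasurable_nullProj Ω U n) _ hp
  · exact measurable_const

lemma frobSq_eq_trace {ι κ : Type*} [Fintype ι] [Fintype κ] (G : Matrix ι κ ℂ) :
    frobSq G = (G * Gᴴ).trace.re := by
  simp only [frobSq, Matrix.trace, Matrix.diag_apply, Matrix.mul_apply, Matrix.conjTranspose_apply,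
    Complex.re_sum]
  refine Finset.sum_congr rfl fun i _ => Finset.sum_congr rfl fun j _ => ?_
  rw [RCLike.star_def, Complex.mul_conj, Complex.ofReal_re, Complex.normSq_eq_norm_sq]

lemma measurable_frobSq_effChannel (Ω : Finset (Fin Kbs)) (U : Finset (Fin Kmu)) (n : Fin Kmu) :
    Measurable fun H : S.State => frobSq (S.effChannel H Ω U n) := by
  have : (fun H : S.State => frobSq (S.effChannel H Ω U n)) = fun H =>
      (S.channel H Ω n * S.nullProj H Ω U n * (S.channel H Ω n)ᴴ).trace.re := by
    ext H
    rw [frobSq_eq_trace, effChannel, Matrix.conjTranspose_mul, nullProj]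
    simp only [Matrix.mul_assoc]
  rw [this]
  have h := S.entryMeasurable_channel Ω n
  exact Complex.measurable_re.comp
    (((h.mul (S.entryMeasurable_nullProj Ω U n)).mul h.conjTranspose).trace)

/-- The average gain in terms of the projection, hence independent of the choice of bases. -/
lemma avgGain_eq (H : S.State) (Ω : Finset (Fin Kbs)) (U : Finset (Fin Kmu)) (n : Fin Kmu) :
    S.avgGain H Ω U n = 1 / (S.antennaCount Ω : ℝ) * ∑ _i : Fin (S.N n), ∑ a : S.Antenna Ω,
      (S.hbar n a.1.1 : ℝ) * (S.nullProj H Ω U n a a).re := by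
  unfold avgGain
  congr 1
  refine Finset.sum_congr rfl fun _ _ => ?_
  rw [Finset.sum_comm]
  refine Finset.sum_congr rfl fun a _ => ?_
  rw [← Finset.mul_sum]
  congr 1
  simp only [nullProj, Matrix.mul_apply, Matrix.conjTranspose_apply, Complex.re_sum]
  refine Finset.sum_congr rfl fun k _ => ?_
  rw [RCLike.star_def, Complex.mul_conj, Complex.ofReal_re, Complex.normSq_eq_norm_sq]

lemma measurable_avgGain (Ω : Finset (Fin Kbs)) (U : Finset (Fin Kmu)) (n : Fin Kmu) :
    Measurable fun H : S.State => S.avgGain H Ω U n := by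
  simp only [avgGain_eq]
  refine (Finset.measurable_sum _ fun _ _ => Finset.measurable_sum _ fun a _ => ?_).const_mul _
  exact (Complex.measurable_re.comp (S.entryMeasurable_nullProj Ω U n a a)).const_mul _

lemma levelMeasurable_aboveAvg (Ω : Finset (Fin Kbs)) (U : Finset (Fin Kmu)) (n : Fin Kmu) :
    LevelMeasurable fun H : S.State => S.aboveAvg H Ω U n := by
  unfold aboveAvg
  refine LevelMeasurable.ite ?_ (LevelMeasurable.const _) (LevelMeasurable.const _)
  exact (measurableSet_lt measurable_const (S.measurable_avgGain Ω U n)).inter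
    (measurableSet_le (S.measurable_avgGain Ω U n)
      ((S.measurable_frobSq_effChannel Ω U n).const_mul _))

lemma measurable_aggGain (n : Fin Kmu) (m : Fin Kbs) :
    Measurable fun H : S.State => S.aggGain H n m := by
  unfold aggGain frobSq
  refine (Finset.measurable_sum _ fun i _ => Finset.measurable_sum _ fun j _ => ?_).const_mul _
  exact (((measurable_pi_apply j).comp ((measurable_pi_apply i).comp
    ((measurable_pi_apply m).comp (measurable_pi_apply n)))).norm).pow_const 2

lemma levelMeasurable_greedyBS (sched : ℕ → Fin Kmu) (L : ℕ) :
    LevelMeasurable fun H : S.State => S.greedyBS sched H L := by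
  induction L with
  | zero => exact LevelMeasurable.const _
  | succ L ih =>
    refine LevelMeasurable.bind (g := fun (Ω : Finset (Fin Kbs)) (H : S.State) =>
      match ((List.finRange Kbs).filter (· ∉ Ω)).argmax (S.aggGain H (sched L)) with
      | none => Ω
      | some m => insert m Ω) ih fun Ω => ?_
    refine LevelMeasurable.map (LevelMeasurable.argmax (g := fun (H : S.State) m =>
      S.aggGain H (sched L) m) (fun a b => ?_) _) fun o =>
      match o with
      | none => Ω
      | some m => insert m Ω
    exact measurableSet_lt (S.measurable_aggGain _ a) (S.measurable_aggGain _ b)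

lemma levelMeasurable_userStep (π : Equiv.Perm (Fin Kmu)) (Ω : Finset (Fin Kbs))
    (V : Finset (Fin Kmu)) : LevelMeasurable fun H : S.State => S.userStep π H Ω V := by
  unfold userStep
  refine LevelMeasurable.bind (g := fun (o : Option (Fin Kmu)) (H : S.State) =>
    match o with
    | none => V
    | some u => if 0 < S.avgGain H Ω (insert u V) u then insert u V else V)
    (LevelMeasurable.argmax (g := fun (H : S.State) n => S.aboveAvg H Ω (insert n V) n)
      (fun a b => ?_) _) fun o => ?_
  · have h := LevelMeasurable.measurableSet (F := fun (k : ℕ) (H : S.State) =>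
        k < S.aboveAvg H Ω (insert b V) b) (S.levelMeasurable_aboveAvg Ω (insert a V) a)
      fun k => LevelMeasurable.measurableSet (F := fun (l : ℕ) (_ : S.State) => k < l)
        (S.levelMeasurable_aboveAvg Ω (insert b V) b) fun l => MeasurableSet.const _
    exact h
  · cases o with
    | none => exact LevelMeasurable.const _
    | some u =>
      exact LevelMeasurable.ite (f := fun _ => insert u V) (g := fun _ => V)
        (measurableSet_lt measurable_const (S.measurable_avgGain _ _ _))
        (LevelMeasurable.const _) (LevelMeasurable.const _)

lemma levelMeasurable_activeUsers [NeZero Kmu] (π : Equiv.Perm (Fin Kmu)) (L : ℕ) :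
    LevelMeasurable fun H : S.State => S.activeUsers π H L := by
  unfold activeUsers
  refine LevelMeasurable.bind (g := fun (Ω : Finset (Fin Kbs)) (H : S.State) =>
    (S.userStep π H Ω)^[Kmu] ∅) (S.levelMeasurable_greedyBS _ L) fun Ω => ?_
  have : ∀ k, LevelMeasurable fun H : S.State => (S.userStep π H Ω)^[k] ∅ := by
    intro k
    induction k with
    | zero => exact LevelMeasurable.const _
    | succ k ih =>
      simp only [Function.iterate_succ_apply']
      exact LevelMeasurable.bind (g := fun V H => S.userStep π H Ω V) ih
        fun V => S.levelMeasurable_userStep π Ω V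
  exact this Kmu

end DownlinkSystem

/-! ### Null sets of the fading law -/

lemma Measure.pi_fin_absolutelyContinuous : ∀ {k : ℕ} {α : Fin k → Type}
    [∀ i, MeasurableSpace (α i)] {μ ν : ∀ i, Measure (α i)} [∀ i, SigmaFinite (μ i)]
    [∀ i, SigmaFinite (ν i)], (∀ i, μ i ≪ ν i) → Measure.pi μ ≪ Measure.pi ν := by
  intro k
  induction k with
  | zero =>
    intro α _ μ ν _ _ _
    rw [Measure.pi_of_empty μ, Measure.pi_of_empty ν]
  | succ k ih =>
    intro α _ μ ν _ _ h
    have hμ := (measurePreserving_piFinSuccAbove μ 0).symm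
    have hν := (measurePreserving_piFinSuccAbove ν 0).symm
    rw [← hμ.map_eq, ← hν.map_eq]
    refine Measure.AbsolutelyContinuous.map ?_ (MeasurableEquiv.measurable _)
    exact (h 0).prod (ih fun j => h _)

instance (v : ℝ≥0) : IsProbabilityMeasure (circularGaussian v) := by
  unfold circularGaussian
  exact Measure.isProbabilityMeasure_map
    (Complex.measurableEquivRealProd.symm.measurable.aemeasurable)

lemma circularGaussian_absolutelyContinuous {v : ℝ≥0} (hv : 0 < v) :
    circularGaussian v ≪ volume := by
  have h1 : gaussianReal 0 (v / 2) ≪ volume :=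
    gaussianReal_absolutelyContinuous 0 (by positivity)
  rw [← Complex.volume_preserving_equiv_real_prod.symm.map_eq]
  exact (h1.prod h1).map Complex.measurableEquivRealProd.symm.measurable

namespace DownlinkSystem

variable {Kbs Kmu : ℕ} (S : DownlinkSystem Kbs Kmu)

instance : IsProbabilityMeasure S.fadingLaw := by
  unfold fadingLaw; infer_instance

lemma fadingLaw_absolutelyContinuous : S.fadingLaw ≪ volume :=
  Measure.pi_fin_absolutelyContinuous fun n => Measure.pi_fin_absolutelyContinuous fun m =>
    Measure.pi_fin_absolutelyContinuous fun _ => Measure.pi_fin_absolutelyContinuous fun _ =>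
      circularGaussian_absolutelyContinuous (S.hbar_pos n m)

/-- A set is null if it meets every curve `t ↦ T t H`, `t > 0`, in a null set of parameters,
provided that only null sets have a null preimage under `T t`. This is Fubini's theorem: for some
`t` the preimage of the set under `T t` is null. -/
lemma fadingLaw_null_of_curves {E : Set S.State} (hE : MeasurableSet E) (T : ℝ → S.State → S.State)
    (hT : Measurable fun x : S.State × ℝ => T x.2 x.1)
    (hTE : ∀ t, 0 < t → volume (T t ⁻¹' E) = 0 → volume E = 0)
    (hnull : ∀ H, volume {t : ℝ | 0 < t ∧ T t H ∈ E} = 0) : S.fadingLaw E = 0 := by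
  refine S.fadingLaw_absolutelyContinuous ?_
  set s : Set (S.State × ℝ) := {x | 0 < x.2 ∧ T x.2 x.1 ∈ E} with hs
  have hsm : MeasurableSet s :=
    (measurableSet_lt measurable_const measurable_snd).inter (hT hE)
  have h1 : (volume.prod volume : Measure (S.State × ℝ)) s = 0 := by
    rw [Measure.measure_prod_null hsm]
    exact Filter.Eventually.of_forall fun H => hnull H
  have h2 : (volume.prod volume : Measure (ℝ × S.State)) (Prod.swap ⁻¹' s) = 0 := by
    rw [← Measure.prod_swap, Measure.map_apply measurable_swap (hsm.preimage measurable_swap)]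
    exact h1
  rw [Measure.measure_prod_null (hsm.preimage measurable_swap)] at h2
  have h3 : ∃ t : ℝ, 0 < t ∧ volume (Prod.mk t ⁻¹' (Prod.swap ⁻¹' s)) = 0 := by
    by_contra hno
    push Not at hno
    have h4 : volume (Set.Ioi (0 : ℝ)) = 0 := by
      refine measure_mono_null (fun t ht => ?_) (mem_ae_iff.1 h2)
      exact hno t ht
    simp at h4
  obtain ⟨t, ht, h5⟩ := h3
  refine hTE t ht (measure_mono_null (fun H hH => ?_) h5)
  exact ⟨ht, hH⟩

/-- Scaling of the channel of each user `n` by `c n`. -/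
def scale (c : Fin Kmu → ℝ) (H : S.State) : S.State := fun n => c n • H n

instance : (volume : Measure S.State).IsAddHaarMeasure := by
  have h1 : ∀ (n : Fin Kmu) (m : Fin Kbs),
      (volume : Measure (Fin (S.N n) → Fin (S.M m) → ℂ)).IsAddHaarMeasure := fun n m =>
    Measure.pi.isAddHaarMeasure (α := fun _ : Fin (S.N n) => Fin (S.M m) → ℂ) fun _ => volume
  have h2 : ∀ n : Fin Kmu,
      (volume : Measure (∀ m : Fin Kbs, Fin (S.N n) → Fin (S.M m) → ℂ)).IsAddHaarMeasure :=
    fun n => Measure.pi.isAddHaarMeasure (α := fun m : Fin Kbs => Fin (S.N n) → Fin (S.M m) → ℂ)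
      fun _ => volume
  exact Measure.pi.isAddHaarMeasure
    (α := fun n : Fin Kmu => ∀ m : Fin Kbs, Fin (S.N n) → Fin (S.M m) → ℂ) fun _ => volume

lemma volume_eq_zero_of_scale {c : Fin Kmu → ℝ} (hc : ∀ n, c n ≠ 0) {E : Set S.State}
    (h : volume (S.scale c ⁻¹' E) = 0) : volume E = 0 := by
  let e : S.State ≃ₗ[ℝ] S.State := LinearEquiv.piCongrRight fun n =>
    LinearEquiv.smulOfNeZero ℝ _ (c n) (hc n)
  have he : (e : S.State → S.State) = S.scale c := by
    ext H; rfl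
  rw [← he, Measure.addHaar_preimage_linearEquiv] at h
  rcases mul_eq_zero.1 h with h | h
  · simp only [ENNReal.ofReal_eq_zero] at h
    have : (LinearMap.det (e.symm : S.State →ₗ[ℝ] S.State)) ≠ 0 := e.symm.isUnit_det'.ne_zero
    exact absurd h (not_le.2 (abs_pos.2 this))
  · exact h

lemma measurable_scale_curve {c : ℝ → Fin Kmu → ℝ} (hc : ∀ n, Measurable fun t => c t n) :
    Measurable fun x : S.State × ℝ => S.scale (c x.2) x.1 := by
  refine measurable_pi_lambda _ fun n => ?_
  exact ((hc n).comp measurable_snd).smul ((measurable_pi_apply n).comp measurable_fst)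

/-- A set is null if it meets every curve obtained by scaling the channels of the users in a null set
of parameters. -/
lemma fadingLaw_null_of_scale {E : Set S.State} (hE : MeasurableSet E) (c : ℝ → Fin Kmu → ℝ)
    (hc : ∀ n, Measurable fun t => c t n) (hpos : ∀ t, 0 < t → ∀ n, 0 < c t n)
    (hnull : ∀ H, volume {t : ℝ | 0 < t ∧ S.scale (c t) H ∈ E} = 0) : S.fadingLaw E = 0 :=
  S.fadingLaw_null_of_curves hE (fun t => S.scale (c t)) (S.measurable_scale_curve hc)
    (fun t ht h => S.volume_eq_zero_of_scale (fun n => (hpos t ht n).ne') h) hnull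

/-! ### Invariance under scaling -/

variable {S} {c : Fin Kmu → ℝ}

lemma scale_apply (H : S.State) (n : Fin Kmu) (m : Fin Kbs) (i : Fin (S.N n)) (j : Fin (S.M m)) :
    S.scale c H n m i j = (c n : ℂ) * H n m i j := rfl

lemma channel_scale (H : S.State) (Ω : Finset (Fin Kbs)) (n : Fin Kmu) :
    S.channel (S.scale c H) Ω n = (c n : ℂ) • S.channel H Ω n := rfl

lemma nullSpace_scale (hc : ∀ n, 0 < c n) (H : S.State) (Ω : Finset (Fin Kbs))
    (U : Finset (Fin Kmu)) (n : Fin Kmu) :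
    S.nullSpace (S.scale c H) Ω U n = S.nullSpace H Ω U n := by
  unfold nullSpace
  refine iInf_congr fun i => iInf_congr fun _ => ?_
  have h0 : (c i : ℂ) ≠ 0 := by exact_mod_cast (hc i).ne'
  rw [channel_scale]
  have h1 : Matrix.toEuclideanLin ((c i : ℂ) • S.channel H Ω i) =
      (c i : ℂ) • Matrix.toEuclideanLin (S.channel H Ω i) :=
    LinearEquiv.map_smul (Matrix.toEuclideanLin (𝕜 := ℂ)) _ _
  rw [h1]
  ext v
  simp only [LinearMap.mem_ker, LinearMap.smul_apply, smul_eq_zero, h0, false_or]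

lemma aggGain_scale (H : S.State) (n : Fin Kmu) (m : Fin Kbs) :
    S.aggGain (S.scale c H) n m = (c n) ^ 2 * S.aggGain H n m := by
  unfold aggGain frobSq
  rw [mul_left_comm]
  congr 1
  simp only [Finset.mul_sum]
  refine Finset.sum_congr rfl fun i _ => Finset.sum_congr rfl fun j _ => ?_
  simp only [Matrix.of_apply, scale_apply, norm_mul, Complex.norm_real, mul_pow, Real.norm_eq_abs,
    sq_abs]

lemma argmax_const_mul {α : Type*} {f g : α → ℝ} {r : ℝ} (hr : 0 < r) (h : ∀ a, g a = r * f a)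
    (l : List α) : l.argmax g = l.argmax f := by
  induction l with
  | nil => rfl
  | cons a l ih =>
    rw [List.argmax_cons, List.argmax_cons, ih]
    cases l.argmax f with
    | none => rfl
    | some b => simp only [h, mul_lt_mul_iff_right₀ hr]

lemma greedyBS_scale (hc : ∀ n, 0 < c n) (sched : ℕ → Fin Kmu) (H : S.State) (L : ℕ) :
    S.greedyBS sched (S.scale c H) L = S.greedyBS sched H L := by
  induction L with
  | zero => rfl
  | succ L ih =>
    unfold greedyBS
    simp only [ih]
    rw [argmax_const_mul (pow_pos (hc (sched L)) 2) fun m => aggGain_scale H (sched L) m]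

lemma mimoCapacity_smul {ι κ : Type*} [Fintype ι] [DecidableEq ι] [Fintype κ] (b : ℝ)
    (G : Matrix ι κ ℂ) {r : ℝ} (hr : 0 < r) (p : ℝ) :
    mimoCapacity b ((r : ℂ) • G) p = mimoCapacity b G (r ^ 2 * p) := by
  have hrC : (r : ℂ) ≠ 0 := by exact_mod_cast hr.ne'
  unfold mimoCapacity
  congr 1
  ext x
  constructor
  · rintro ⟨Ξ, hΞ, htr, rfl⟩
    refine ⟨((r ^ 2 : ℝ) : ℂ) • Ξ, hΞ.smul (Complex.zero_le_real.2 (by positivity)), ?_, ?_⟩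
    · rw [Matrix.trace_smul, htr, smul_eq_mul, Complex.ofReal_mul]
    · congr 5
      rw [Matrix.conjTranspose_smul, Matrix.smul_mul, Matrix.smul_mul, Matrix.mul_smul,
        Matrix.mul_smul, Matrix.smul_mul, smul_smul]
      congr 1
      simp [sq]
  · rintro ⟨Ξ, hΞ, htr, rfl⟩
    refine ⟨((r⁻¹ ^ 2 : ℝ) : ℂ) • Ξ, hΞ.smul (Complex.zero_le_real.2 (by positivity)), ?_, ?_⟩
    · rw [Matrix.trace_smul, htr, smul_eq_mul, ← Complex.ofReal_mul]
      congr 1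
      field_simp
    · congr 5
      rw [Matrix.conjTranspose_smul, Matrix.smul_mul, Matrix.smul_mul, Matrix.mul_smul,
        Matrix.mul_smul, Matrix.smul_mul, smul_smul, smul_smul]
      have : (r : ℂ) * (starRingEnd ℂ) (r : ℂ) * ((r⁻¹ ^ 2 : ℝ) : ℂ) = 1 := by
        rw [Complex.conj_ofReal]; push_cast; field_simp
      simp only [RCLike.star_def]
      rw [this, one_smul]

lemma effChannel_eq (H : S.State) (Ω : Finset (Fin Kbs)) (U : Finset (Fin Kmu)) (n : Fin Kmu) :
    S.effChannel H Ω U n = S.channel H Ω n * basisMatrix (S.nullSpace H Ω U n) := rfl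

/-- Scaling does not change the null spaces, so scaling the channel of user `n` by `c n` amounts to
multiplying its power by `c n ^ 2`. -/
lemma frozenRate_scale (hc : ∀ n, 0 < c n) (H : S.State) (Ω : Finset (Fin Kbs))
    (U : Finset (Fin Kmu)) (n : Fin Kmu) (p : ℝ) :
    S.frozenRate (S.scale c H) Ω U n p = S.frozenRate H Ω U n (c n ^ 2 * p) := by
  unfold frozenRate
  split_ifs
  · rw [← mimoCapacity_smul _ _ (hc n), effChannel_eq, effChannel_eq, nullSpace_scale hc,
      channel_scale, Matrix.smul_mul]
  · rfl

end DownlinkSystem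

lemma frobSq_pos_iff {ι κ : Type*} [Fintype ι] [Fintype κ] (G : Matrix ι κ ℂ) :
    0 < frobSq G ↔ G ≠ 0 := by
  have h0 : 0 ≤ frobSq G := Finset.sum_nonneg fun _ _ => Finset.sum_nonneg fun _ _ => sq_nonneg _
  rw [h0.lt_iff_ne', not_iff_not]
  constructor
  · intro h
    ext i j
    have h1 := (Finset.sum_eq_zero_iff_of_nonneg fun i _ =>
      Finset.sum_nonneg fun j _ => sq_nonneg ‖G i j‖).1 h i (Finset.mem_univ i)
    have h2 := (Finset.sum_eq_zero_iff_of_nonneg fun j _ => sq_nonneg ‖G i j‖).1 h1 j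
      (Finset.mem_univ j)
    simpa using h2
  · rintro rfl
    simp [frobSq]

/-- Right multiplication by a unitary matrix does not change the capacity. -/
lemma mimoCapacity_mul_unitary {ι α κ : Type*} [Fintype ι] [DecidableEq ι] [Fintype α]
    [DecidableEq α] [Fintype κ] [DecidableEq κ] (c : ℝ) (A : Matrix ι α ℂ) {Γ : Matrix α κ ℂ}
    (h1 : Γᴴ * Γ = 1) (h2 : Γ * Γᴴ = 1) (p : ℝ) :
    mimoCapacity c (A * Γ) p = mimoCapacity c A p := by
  unfold mimoCapacity
  congr 1
  ext x
  constructor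
  · rintro ⟨Ξ, hΞ, htr, rfl⟩
    refine ⟨Γ * Ξ * Γᴴ, hΞ.mul_mul_conjTranspose_same Γ, ?_, ?_⟩
    · rw [Matrix.mul_assoc, Matrix.trace_mul_comm, Matrix.mul_assoc, h1, Matrix.mul_one, htr]
    · rw [Matrix.conjTranspose_mul]; simp only [Matrix.mul_assoc]
  · rintro ⟨Ξ, hΞ, htr, rfl⟩
    refine ⟨Γᴴ * Ξ * Γ, hΞ.conjTranspose_mul_mul_same Γ, ?_, ?_⟩
    · rw [Matrix.mul_assoc, Matrix.trace_mul_comm, Matrix.mul_assoc, h2, Matrix.mul_one, htr]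
    · have : A * Γ * (Γᴴ * Ξ * Γ) * (A * Γ)ᴴ = A * (Γ * Γᴴ) * Ξ * (Γ * Γᴴ) * Aᴴ := by
        rw [Matrix.conjTranspose_mul]; simp only [Matrix.mul_assoc]
      rw [this, h2, Matrix.mul_one, Matrix.mul_one]

namespace DownlinkSystem

variable {Kbs Kmu : ℕ} {S : DownlinkSystem Kbs Kmu}

/-! ### Generic channels -/

lemma nullProj_eq_zero_of_diag {H : S.State} {Ω : Finset (Fin Kbs)} {U : Finset (Fin Kmu)}
    {n : Fin Kmu} (h : ∀ a, S.nullProj H Ω U n a a = 0) : S.nullProj H Ω U n = 0 := by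
  have h1 : (S.precoder H Ω U n * (S.precoder H Ω U n)ᴴ).trace = 0 :=
    Finset.sum_eq_zero fun a _ => h a
  rw [Matrix.trace_mul_conjTranspose_self_eq_zero_iff] at h1
  rw [nullProj, h1, Matrix.zero_mul]

lemma nullProj_congr {H H' : S.State} {Ω : Finset (Fin Kbs)} {U : Finset (Fin Kmu)} {n : Fin Kmu}
    (h : ∀ i ≠ n, H i = H' i) : S.nullProj H Ω U n = S.nullProj H' Ω U n := by
  have h1 : S.nullSpace H Ω U n = S.nullSpace H' Ω U n := by
    unfold nullSpace
    refine iInf_congr fun i => iInf_congr fun hi => ?_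
    have : S.channel H Ω i = S.channel H' Ω i := by
      unfold channel; rw [h i (Finset.ne_of_mem_erase hi)]
    rw [this]
  have h2 : ∀ H : S.State, S.nullProj H Ω U n =
      basisMatrix (S.nullSpace H Ω U n) * (basisMatrix (S.nullSpace H Ω U n))ᴴ := fun _ => rfl
  rw [h2, h2, h1]

variable (S) in
/-- The state in which only user `n` has a channel, with unit gains from the antenna `a`. -/
def unitState {Ω : Finset (Fin Kbs)} (n : Fin Kmu) (a : S.Antenna Ω) : S.State :=
  Pi.single n (Pi.single a.1.1 fun _ => Pi.single a.2 1)

lemma channel_unitState {Ω : Finset (Fin Kbs)} (n : Fin Kmu) (a b : S.Antenna Ω)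
    (i : Fin (S.N n)) : S.channel (S.unitState n a) Ω n i b = if b = a then 1 else 0 := by
  unfold channel unitState
  simp only [Matrix.of_apply, Pi.single_eq_same]
  obtain ⟨⟨m, hm⟩, j⟩ := a
  obtain ⟨⟨m', hm'⟩, j'⟩ := b
  by_cases h : m' = m
  · subst h
    simp only [Pi.single_eq_same]
    by_cases hj : j' = j
    · subst hj; simp
    · rw [Pi.single_eq_of_ne hj, if_neg]
      intro h'; exact hj (by simpa using h')
  · rw [Pi.single_eq_of_ne h, if_neg]
    · rfl
    · intro h'
      rw [Sigma.mk.injEq] at h'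
      exact h (congrArg Subtype.val h'.1)

/-- The channel of user `n` is independent of the null space of the other users, and a nonzero
subspace is annihilated by the channel only with probability zero. -/
lemma ae_effChannel_ne_zero : ∀ᵐ H ∂S.fadingLaw, ∀ (Ω : Finset (Fin Kbs)) (U : Finset (Fin Kmu))
    (n : Fin Kmu), S.nullProj H Ω U n ≠ 0 → S.effChannel H Ω U n ≠ 0 := by
  rw [ae_all_iff]; intro Ω
  rw [ae_all_iff]; intro U
  rw [ae_all_iff]; intro n
  -- if `nullProj a a ≠ 0`, moving a single entry of the channel of user `n` in column `a` changes the
  -- product but not the projection, so that the product vanishes for at most one value of the entry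
  have key : ∀ a : S.Antenna Ω, ∀ᵐ H ∂S.fadingLaw,
      ¬ (S.nullProj H Ω U n a a ≠ 0 ∧ S.channel H Ω n * S.nullProj H Ω U n = 0) := by
    intro a
    have hE : MeasurableSet {H : S.State | S.nullProj H Ω U n a a ≠ 0 ∧
        S.channel H Ω n * S.nullProj H Ω U n = 0} := by
      have hQ := S.entryMeasurable_nullProj Ω U n
      have h1 : MeasurableSet {H : S.State | S.nullProj H Ω U n a a ≠ 0} :=
        (hQ a a) (measurableSet_singleton 0).compl
      have h2 : MeasurableSet {H : S.State | S.channel H Ω n * S.nullProj H Ω U n = 0} := by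
        have : {H : S.State | S.channel H Ω n * S.nullProj H Ω U n = 0} = ⋂ i, ⋂ b,
            {H | (S.channel H Ω n * S.nullProj H Ω U n) i b = 0} := by
          ext H
          simp only [Set.mem_ofPred_eq, Set.mem_iInter]
          exact ⟨fun h i b => by rw [h]; rfl, fun h => by ext i b; exact h i b⟩
        rw [this]
        exact MeasurableSet.iInter fun i => MeasurableSet.iInter fun b =>
          ((S.entryMeasurable_channel Ω n).mul hQ i b) (measurableSet_singleton 0)
      exact h1.inter h2
    rw [ae_iff]
    simp only [not_not]
    set X := S.unitState n a with hX
    refine S.fadingLaw_null_of_curves hE (fun t H => H + t • X) (by fun_prop) ?_ ?_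
    · intro t _ h
      rwa [measure_preimage_add_right] at h
    · intro H
      refine Set.Subsingleton.measure_zero ?_ _
      rintro t ⟨-, ht1, ht2⟩ t' ⟨-, -, ht2'⟩
      by_contra hne
      have hQ : ∀ s : ℝ, S.nullProj (H + s • X) Ω U n = S.nullProj H Ω U n := fun s =>
        nullProj_congr fun i hi => by
          have : X i = 0 := Pi.single_eq_of_ne hi _
          simp [this]
      have hch : ∀ s : ℝ, S.channel (H + s • X) Ω n =
          S.channel H Ω n + (s : ℂ) • S.channel X Ω n := fun s => rfl
      rw [hQ] at ht1 ht2 ht2'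
      rw [hch, Matrix.add_mul, Matrix.smul_mul] at ht2 ht2'
      have h1 : ((t : ℂ) - t') • (S.channel X Ω n * S.nullProj H Ω U n) = 0 := by
        rw [sub_smul, sub_eq_zero]
        exact add_left_cancel (ht2.trans ht2'.symm)
      have h2 : S.channel X Ω n * S.nullProj H Ω U n = 0 := by
        refine (smul_eq_zero.1 h1).resolve_left (sub_ne_zero.2 ?_)
        exact_mod_cast hne
      have h3 := congrFun (congrFun h2 ⟨0, S.N_pos n⟩) a
      rw [Matrix.mul_apply] at h3
      simp only [hX, channel_unitState, ite_mul, one_mul, zero_mul, Finset.sum_ite_eq',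
        Finset.mem_univ, if_true] at h3
      exact ht1 h3
  filter_upwards [ae_all_iff.2 key] with H hH hQ h0
  refine hQ (nullProj_eq_zero_of_diag fun a => ?_)
  by_contra ha
  refine hH a ⟨ha, ?_⟩
  rw [nullProj, ← Matrix.mul_assoc]
  have h0' : S.channel H Ω n * S.precoder H Ω U n = 0 := h0
  rw [h0', Matrix.zero_mul]

/-! ### The selection leaves an active user with a nontrivial precoder -/

lemma nullProj_singleton (H : S.State) (Ω : Finset (Fin Kbs)) (n : Fin Kmu) :
    S.nullProj H Ω {n} n = 1 := by
  have h : ∀ v, (S.nullProj H Ω {n} n).mulVec v = v := fun v =>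
    (S.nullProj_mulVec_eq_self_iff H Ω {n} n v).2 (by simp)
  exact Matrix.ext_of_mulVec_single fun i => by rw [h, Matrix.one_mulVec]

lemma nullProj_ne_zero_of_avgGain_pos {H : S.State} {Ω : Finset (Fin Kbs)} {U : Finset (Fin Kmu)}
    {n : Fin Kmu} (h : 0 < S.avgGain H Ω U n) : S.nullProj H Ω U n ≠ 0 := by
  intro h0
  rw [avgGain_eq, h0] at h
  simp at h

lemma avgGain_singleton_pos (H : S.State) {Ω : Finset (Fin Kbs)} (hΩ : Ω.Nonempty) (n : Fin Kmu) :
    0 < S.avgGain H Ω {n} n := by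
  rw [avgGain_eq, nullProj_singleton]
  obtain ⟨m, hm⟩ := hΩ
  have hc : 0 < S.antennaCount Ω :=
    Finset.sum_pos (fun m _ => S.M_pos m) ⟨m, hm⟩
  refine mul_pos (by positivity) ?_
  have : Nonempty (Fin (S.N n)) := ⟨⟨0, S.N_pos n⟩⟩
  have : Nonempty (S.Antenna Ω) := ⟨⟨⟨m, hm⟩, ⟨0, S.M_pos m⟩⟩⟩
  refine Finset.sum_pos (fun i _ => Finset.sum_pos (fun a _ => ?_) Finset.univ_nonempty)
    Finset.univ_nonempty
  have := S.hbar_pos n a.1.1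
  simpa using this

/-- A user is added only if its average gain is positive for the enlarged set of users. -/
lemma exists_avgGain_pos_userStep {π : Equiv.Perm (Fin Kmu)} {H : S.State}
    {Ω : Finset (Fin Kbs)} {V : Finset (Fin Kmu)} (h : ∃ n ∈ V, 0 < S.avgGain H Ω V n) :
    ∃ n ∈ S.userStep π H Ω V, 0 < S.avgGain H Ω (S.userStep π H Ω V) n := by
  unfold userStep
  split
  · exact h
  · rename_i u _
    split_ifs with h1
    · exact ⟨u, Finset.mem_insert_self u V, h1⟩
    · exact h

lemma exists_avgGain_pos_activeUsers [NeZero Kmu] {π : Equiv.Perm (Fin Kmu)} {H : S.State}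
    {Ω : Finset (Fin Kbs)} (hΩ : Ω.Nonempty) (k : ℕ) :
    ∃ n ∈ (S.userStep π H Ω)^[k + 1] ∅, 0 < S.avgGain H Ω ((S.userStep π H Ω)^[k + 1] ∅) n := by
  induction k with
  | zero =>
    simp only [zero_add, Function.iterate_one]
    unfold userStep
    split
    · rename_i h
      rw [List.argmax_eq_none, List.filter_eq_nil_iff] at h
      exact absurd (by simp) (h (π 0) (List.mem_map.2 ⟨0, List.mem_finRange 0, rfl⟩))
    · rename_i u _
      have h1 := avgGain_singleton_pos H hΩ u
      have h2 : insert u (∅ : Finset (Fin Kmu)) = {u} := rfl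
      rw [h2, if_pos h1]
      exact ⟨u, Finset.mem_singleton_self u, h1⟩
  | succ k ih =>
    rw [Function.iterate_succ_apply']
    exact exists_avgGain_pos_userStep ih

lemma greedyBS_succ_nonempty [NeZero Kbs] (sched : ℕ → Fin Kmu) (H : S.State) (L : ℕ) :
    (S.greedyBS sched H (L + 1)).Nonempty := by
  unfold greedyBS
  dsimp only
  split
  · rename_i h
    rw [List.argmax_eq_none, List.filter_eq_nil_iff] at h
    have := h 0 (List.mem_finRange 0)
    simp only [decide_eq_true_eq, not_not] at this
    exact ⟨0, this⟩
  · exact ⟨_, Finset.mem_insert_self _ _⟩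

end DownlinkSystem

/-! ### Optimality of modified water-filling -/

section Optimality
variable {ι : Type*} [Fintype ι]

/-- The weighted sum of the users' exponential costs for the powers `P`. -/
def weightedCost (θ lam : ι → ℝ) (C : ι → ℝ → ℝ) (P : ι → ℝ) : ℝ :=
  ∑ n, lam n * Real.exp (-θ n * C n (P n))

variable {s : ι → Subchannels} {c : ℝ} {θ lam : ι → ℝ} {C : ι → ℝ → ℝ} {ζ : ℝ} {P : ι → ℝ}

/-- The excess of the Lagrangian of user `n` over its minimum. -/
def lagrangianGap (θ lam : ι → ℝ) (C : ι → ℝ → ℝ) (ζ : ℝ) (P P' : ι → ℝ) (n : ι) : ℝ :=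
  (lam n * Real.exp (-θ n * C n (P' n)) + ζ * P' n) -
    (lam n * Real.exp (-θ n * C n (P n)) + ζ * P n)

lemma sum_lagrangianGap (P' : ι → ℝ) :
    ∑ n, lagrangianGap θ lam C ζ P P' n =
      weightedCost θ lam C P' - weightedCost θ lam C P + ζ * (∑ n, P' n - ∑ n, P n) := by
  simp only [lagrangianGap, weightedCost, Finset.sum_sub_distrib, Finset.sum_add_distrib,
    ← Finset.mul_sum]
  ring

section
variable (hc : 0 < c) (hθ : ∀ n, 0 < θ n) (hl : ∀ n, 0 < lam n)
  (hC : ∀ n, (s n).IsCapacity c (C n)) (hP : IsAllocation s (fun n => c * θ n) lam ζ P)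
include hc hθ hl hC hP

omit [Fintype ι] in
lemma IsAllocation.gap (n : ι) : ∃ r β : ℝ, 0 < r ∧ 0 < β ∧ ∀ P' : ι → ℝ, 0 ≤ P' n →
    r * (Real.exp (-(β * (P' n - P n))) - 1 + β * (P' n - P n)) ≤
      lagrangianGap θ lam C ζ P P' n := by
  obtain ⟨μ, h1, h2⟩ := hP.level n
  have hβ := mul_pos hc (hθ n)
  have hμ := h1.pos
  refine ⟨ζ * μ / (c * θ n), c * θ n / μ, div_pos (mul_pos hP.zeta_pos hμ) hβ,
    div_pos hβ hμ, fun P' hP' => ?_⟩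
  have h := h1.gap hc (hθ n) (hl n) (hC n) hP'
  rw [← h2] at h
  have e : c * θ n / μ * (P' n - P n) = c * θ n * ((P' n - P n) / μ) := by ring
  rw [e]
  exact h

omit [Fintype ι] in
lemma IsAllocation.gap_nonneg {P' : ι → ℝ} {n : ι} (h : 0 ≤ P' n) :
    0 ≤ lagrangianGap θ lam C ζ P P' n := by
  obtain ⟨r, β, hr, -, hgap⟩ := hP.gap hc hθ hl hC n
  exact (mul_nonneg hr.le (exp_neg_sub_one_add_nonneg _)).trans (hgap P' h)

omit [Fintype ι] in
lemma IsAllocation.eq_of_gap {P' : ι → ℝ} {n : ι} (h : 0 ≤ P' n)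
    (h0 : lagrangianGap θ lam C ζ P P' n ≤ 0) : P' n = P n := by
  obtain ⟨r, β, hr, hβ, hgap⟩ := hP.gap hc hθ hl hC n
  by_contra hne
  have h1 := mul_pos hr (exp_neg_sub_one_add_pos
    (mul_ne_zero hβ.ne' (sub_ne_zero.2 hne)))
  linarith [hgap P' h]

/-- Modified water-filling minimizes the weighted cost among all allocations of at most the same
total power; the multiplier `ζ` prices the power that is saved. -/
lemma IsAllocation.cost_le {P' : ι → ℝ} (h : ∀ n, 0 ≤ P' n) :
    weightedCost θ lam C P + ζ * (∑ n, P n - ∑ n, P' n) ≤ weightedCost θ lam C P' := by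
  have h1 := Finset.sum_nonneg fun n (_ : n ∈ Finset.univ) => hP.gap_nonneg hc hθ hl hC (h n)
  rw [sum_lagrangianGap] at h1
  linarith

lemma IsAllocation.unique {P' : ι → ℝ} (h : ∀ n, 0 ≤ P' n) (hsum : ∑ n, P' n = ∑ n, P n)
    (hcost : weightedCost θ lam C P' ≤ weightedCost θ lam C P) : P' = P := by
  have h1 := sum_lagrangianGap (θ := θ) (lam := lam) (C := C) (ζ := ζ) (P := P) P'
  rw [hsum, sub_self, mul_zero, add_zero] at h1
  have h2 := fun n => hP.gap_nonneg hc hθ hl hC (h n)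
  ext n
  refine hP.eq_of_gap hc hθ hl hC (h n) ?_
  have h3 := Finset.single_le_sum (f := lagrangianGap θ lam C ζ P P') (fun n _ => h2 n)
    (Finset.mem_univ n)
  linarith

/-- Allocations of the same total power whose costs tend to the minimum tend to the minimizer, and
so do the individual costs. -/
lemma IsAllocation.tendsto {κ : Type*} {l : Filter κ} {P' : κ → ι → ℝ} (h : ∀ k n, 0 ≤ P' k n)
    (hsum : ∀ k, ∑ n, P' k n = ∑ n, P n)
    (hcost : Filter.Tendsto (fun k => weightedCost θ lam C (P' k)) l
      (nhds (weightedCost θ lam C P))) (n : ι) :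
    Filter.Tendsto (fun k => P' k n) l (nhds (P n)) ∧
    Filter.Tendsto (fun k => Real.exp (-θ n * C n (P' k n))) l
      (nhds (Real.exp (-θ n * C n (P n)))) := by
  have hgap : Filter.Tendsto (fun k => lagrangianGap θ lam C ζ P (P' k) n) l (nhds 0) := by
    have h1 : Filter.Tendsto (fun k => weightedCost θ lam C (P' k) - weightedCost θ lam C P) l
        (nhds 0) := by
      simpa using hcost.sub_const (weightedCost θ lam C P)
    refine squeeze_zero (fun k => hP.gap_nonneg hc hθ hl hC (h k n)) (fun k => ?_) h1
    have h2 := sum_lagrangianGap (θ := θ) (lam := lam) (C := C) (ζ := ζ) (P := P) (P' k)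
    rw [hsum, sub_self, mul_zero, add_zero] at h2
    rw [← h2]
    exact Finset.single_le_sum (f := lagrangianGap θ lam C ζ P (P' k))
      (fun n _ => hP.gap_nonneg hc hθ hl hC (h k n)) (Finset.mem_univ n)
  obtain ⟨r, β, hr, hβ, hge⟩ := hP.gap hc hθ hl hC n
  have hPt : Filter.Tendsto (fun k => P' k n) l (nhds (P n)) := by
    rw [Metric.tendsto_nhds]
    intro ε hε
    obtain ⟨η, hη, hη'⟩ := exists_forall_le_exp_neg_sub_one_add (mul_pos hβ hε)
    filter_upwards [hgap.eventually_lt_const (mul_pos hr hη)] with k hk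
    rw [Real.dist_eq]
    by_contra hle
    push Not at hle
    have h1 := hη' (β * (P' k n - P n)) (by
      rw [abs_mul, abs_of_pos hβ]; exact mul_le_mul_of_nonneg_left hle hβ.le)
    have h2 := mul_le_mul_of_nonneg_left h1 hr.le
    linarith [hge (P' k) (h k n)]
  refine ⟨hPt, ?_⟩
  have h1 := (hgap.sub ((hPt.sub_const (P n)).const_mul ζ)).div_const (lam n)
  have h2 := h1.add_const (Real.exp (-θ n * C n (P n)))
  simp only [sub_self, mul_zero, zero_div, zero_add] at h2
  refine h2.congr fun k => ?_
  have := (hl n).ne'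
  simp only [lagrangianGap]
  field_simp
  ring

end

end Optimality

/-- The index of a candidate mode: `inl L` is the multi-user mode with `L` base stations, and
`inr (l, n)` the single-user mode of user `n` with `l + 1` base stations. -/
abbrev Mode (Kbs Kmu : ℕ) : Type := Fin (Kbs + 1) ⊕ Fin Kbs × Fin Kmu

/-- The number of base stations that a mode uses. -/
def Mode.size {Kbs Kmu : ℕ} : Mode Kbs Kmu → ℕ
  | .inl L => L.val
  | .inr x => x.1.val + 1

namespace DownlinkSystem

variable {Kbs Kmu : ℕ} {S : DownlinkSystem Kbs Kmu}

/-! ### Candidate modes -/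

lemma frozenRate_nonneg (H : S.State) (Ω : Finset (Fin Kbs)) (U : Finset (Fin Kmu))
    (n : Fin Kmu) (p : ℝ) : 0 ≤ S.frozenRate H Ω U n p := by
  unfold frozenRate
  split_ifs
  · exact mimoCapacity_nonneg S.BT_pos.le _ _
  · exact le_rfl

lemma frozenRate_zero (H : S.State) (Ω : Finset (Fin Kbs)) (U : Finset (Fin Kmu))
    (n : Fin Kmu) : S.frozenRate H Ω U n 0 = 0 := by
  unfold frozenRate
  split_ifs
  · exact mimoCapacity_zero _ _
  · rfl

variable (S) in
/-- The subchannels of user `n` for a fixed choice of base stations and active users; an inactive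
user has none. -/
def frozenSub (H : S.State) (Ω : Finset (Fin Kbs)) (U : Finset (Fin Kmu)) (n : Fin Kmu) :
    Subchannels :=
  if n ∈ U then Subchannels.ofMatrix (S.effChannel H Ω U n) else Subchannels.empty

lemma isCapacity_frozen (H : S.State) (Ω : Finset (Fin Kbs)) (U : Finset (Fin Kmu))
    (n : Fin Kmu) : (S.frozenSub H Ω U n).IsCapacity S.BT (S.frozenRate H Ω U n) := by
  unfold frozenSub frozenRate
  split_ifs
  · exact Subchannels.isCapacity_ofMatrix S.BT_pos.le _
  · exact Subchannels.isCapacity_empty S.BT_pos.le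

lemma eventually_lt_frozenRate (H : S.State) (Ω : Finset (Fin Kbs)) (U : Finset (Fin Kmu))
    (n : Fin Kmu) {p : ℝ} (hp : 0 ≤ p) {r : ℝ} (hr : r < S.frozenRate H Ω U n p) :
    ∀ᶠ p' in nhdsWithin p (Set.Ici 0), r < S.frozenRate H Ω U n p' := by
  unfold frozenRate at hr ⊢
  split_ifs at hr ⊢ with h
  · exact eventually_lt_mimoCapacity _ S.BT_pos.le (S.precoder_conjTranspose_mul H Ω U n) hp hr
  · exact Filter.Eventually.of_forall fun _ => hr

lemma frozenSub_idx_nonempty {H : S.State} {Ω : Finset (Fin Kbs)} {U : Finset (Fin Kmu)}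
    {n : Fin Kmu} (hn : n ∈ U) (h : S.effChannel H Ω U n ≠ 0) :
    (S.frozenSub H Ω U n).idx.Nonempty := by
  rw [frozenSub, if_pos hn]
  have : (S.effChannel H Ω U n).rank ≠ 0 := by
    intro h0
    rw [Matrix.rank, Submodule.finrank_eq_zero, LinearMap.range_eq_bot] at h0
    refine h (Matrix.ext_of_mulVec_single fun j => ?_)
    rw [← Matrix.mulVecLin_apply, h0, Matrix.zero_mulVec, LinearMap.zero_apply]
  exact ⟨1, Finset.mem_Icc.2 ⟨le_rfl, by omega⟩⟩

variable [NeZero Kmu] (π : Equiv.Perm (Fin Kmu))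

/-- The base stations of a mode. -/
def modeBS (H : S.State) : Mode Kbs Kmu → Finset (Fin Kbs)
  | .inl L => S.multiBS π H L.val
  | .inr x => S.singleBS H (x.1.val + 1) x.2

/-- The users that a mode serves. -/
def modeUsers (H : S.State) : Mode Kbs Kmu → Finset (Fin Kmu)
  | .inl L => S.activeUsers π H L.val
  | .inr x => {x.2}

/-- The rate of user `n` with power `p` in a mode. -/
def modeRate (H : S.State) (a : Mode Kbs Kmu) (n : Fin Kmu) (p : ℝ) : ℝ :=
  S.frozenRate H (modeBS π H a) (modeUsers π H a) n p

/-- The subchannels of user `n` in a mode. -/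
def modeSub (H : S.State) (a : Mode Kbs Kmu) (n : Fin Kmu) : Subchannels :=
  S.frozenSub H (modeBS π H a) (modeUsers π H a) n

/-- The factors `β_n = BT θ_n`. -/
def beta (S : DownlinkSystem Kbs Kmu) (n : Fin Kmu) : ℝ := S.BT * S.θ n

omit [NeZero Kmu] in
lemma beta_pos (n : Fin Kmu) : 0 < S.beta n := mul_pos S.BT_pos (S.θ_pos n)

/-- `P` is the modified water-filling allocation of the total power of mode `a`. -/
def IsModeAlloc (lam : Fin Kmu → ℝ) (H : S.State) (a : Mode Kbs Kmu) (P : Fin Kmu → ℝ) : Prop :=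
  ∃ ζ, IsAllocation (modeSub π H a) S.beta lam ζ P ∧ ∑ n, P n = S.totalPower a.size

variable (S) in
/-- In every mode that uses a base station, some served user has a nonzero equivalent channel. -/
def IsGood (H : S.State) : Prop :=
  ∀ a : Mode Kbs Kmu, a.size ≠ 0 → ∃ n ∈ modeUsers π H a,
    0 < frobSq (S.effChannel H (modeBS π H a) (modeUsers π H a) n)

lemma levelMeasurable_modeBS (a : Mode Kbs Kmu) :
    LevelMeasurable fun H : S.State => modeBS π H a := by
  rcases a with L | x
  · exact S.levelMeasurable_greedyBS _ _
  · exact S.levelMeasurable_greedyBS _ _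

lemma levelMeasurable_modeUsers (a : Mode Kbs Kmu) :
    LevelMeasurable fun H : S.State => modeUsers π H a := by
  rcases a with L | x
  · exact S.levelMeasurable_activeUsers π _
  · exact LevelMeasurable.const _

lemma measurable_modeRate (a : Mode Kbs Kmu) (n : Fin Kmu) {p : S.State → ℝ} (hp : Measurable p)
    (hp0 : ∀ H, 0 ≤ p H) : Measurable fun H => modeRate π H a n (p H) :=
  (levelMeasurable_modeBS π a).measurable (F := fun Ω H =>
    S.frozenRate H Ω (modeUsers π H a) n (p H)) fun Ω =>
    (levelMeasurable_modeUsers π a).measurable (F := fun U H => S.frozenRate H Ω U n (p H))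
      fun U => S.measurable_frozenRate Ω U n hp hp0

lemma measurableSet_isGood : MeasurableSet {H : S.State | S.IsGood π H} := by
  have : {H : S.State | S.IsGood π H} = ⋂ a : Mode Kbs Kmu, ⋂ _ : a.size ≠ 0, ⋃ n,
      {H | n ∈ modeUsers π H a ∧
        0 < frobSq (S.effChannel H (modeBS π H a) (modeUsers π H a) n)} := by
    ext H; simp [IsGood]
  rw [this]
  refine MeasurableSet.iInter fun a => MeasurableSet.iInter fun _ => MeasurableSet.iUnion fun n => ?_
  refine (levelMeasurable_modeBS π a).measurableSet (F := fun Ω H => n ∈ modeUsers π H a ∧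
    0 < frobSq (S.effChannel H Ω (modeUsers π H a) n)) fun Ω => ?_
  refine (levelMeasurable_modeUsers π a).measurableSet (F := fun U H => n ∈ U ∧
    0 < frobSq (S.effChannel H Ω U n)) fun U => ?_
  exact (MeasurableSet.const _).inter
    (measurableSet_lt measurable_const (S.measurable_frobSq_effChannel Ω U n))

/-- The user added last to the active users has a positive average gain, hence a nontrivial precoder,
and almost surely its channel does not annihilate the precoder. -/
lemma ae_isGood [NeZero Kbs] : ∀ᵐ H ∂S.fadingLaw, S.IsGood π H := by
  filter_upwards [ae_effChannel_ne_zero (S := S)] with H hH a ha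
  rcases a with L | x
  · obtain ⟨k, hk⟩ : ∃ k, L.val = k + 1 := Nat.exists_eq_succ_of_ne_zero ha
    obtain ⟨k', hk'⟩ : ∃ k', Kmu = k' + 1 := Nat.exists_eq_succ_of_ne_zero (NeZero.ne Kmu)
    have hΩ : (S.multiBS π H L.val).Nonempty := by
      rw [hk]; exact greedyBS_succ_nonempty _ H k
    obtain ⟨n, hn, hpos⟩ := exists_avgGain_pos_activeUsers (π := π) hΩ k'
    rw [← hk'] at hn hpos
    exact ⟨n, hn, (frobSq_pos_iff _).2 (hH _ _ _ (nullProj_ne_zero_of_avgGain_pos hpos))⟩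
  · refine ⟨x.2, Finset.mem_singleton_self _, (frobSq_pos_iff _).2 (hH _ _ _ ?_)⟩
    simp only [modeUsers]
    rw [nullProj_singleton]
    obtain ⟨m, hm⟩ : (modeBS π H (.inr x)).Nonempty := greedyBS_succ_nonempty _ H x.1.val
    intro h0
    let a : S.Antenna (modeBS π H (.inr x)) := ⟨⟨m, hm⟩, ⟨0, S.M_pos m⟩⟩
    have : (1 : Matrix (S.Antenna (modeBS π H (.inr x))) _ ℂ) a a = 0 := by rw [h0]; rfl
    rw [Matrix.one_apply_eq] at this
    exact one_ne_zero this

omit [NeZero Kmu] in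
lemma totalPower_pos {L : ℕ} (hL : L ≠ 0) : 0 < S.totalPower L := by
  rw [totalPower, if_neg hL]
  have h1 : (1 : ℝ) ≤ L := by exact_mod_cast Nat.one_le_iff_ne_zero.2 hL
  have := mul_nonneg S.kappa_nonneg (sub_nonneg.2 h1)
  linarith [S.Pref_pos]

lemma activeUsers_zero (H : S.State) : S.activeUsers π H 0 = ∅ := by
  unfold activeUsers
  have hΩ : S.multiBS π H 0 = ∅ := rfl
  rw [hΩ]
  have hstep : S.userStep π H ∅ ∅ = ∅ := by
    unfold userStep
    split
    · rfl
    · rw [if_neg]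
      simp [avgGain, antennaCount]
  exact Function.iterate_fixed hstep _

lemma exists_isModeAlloc {lam : Fin Kmu → ℝ} (hl : ∀ n, 0 < lam n) {H : S.State}
    (hH : S.IsGood π H) (a : Mode Kbs Kmu) : ∃ P, IsModeAlloc π lam H a P := by
  by_cases ha : a.size = 0
  · have hU : modeUsers π H a = ∅ := by
      rcases a with L | x
      · have : L.val = 0 := ha
        simp only [modeUsers, this]
        exact activeUsers_zero π H
      · exact absurd ha (Nat.succ_ne_zero _)
    refine ⟨fun _ => 0, 1, ⟨one_pos, fun n => ?_⟩, by simp [ha, totalPower]⟩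
    obtain ⟨μ, hμ, -⟩ := Subchannels.existsUnique_isLevel (modeSub π H a n) (S.beta_pos n) (hl n)
      one_pos
    refine ⟨μ, hμ, ?_⟩
    simp [modeSub, frozenSub, hU, Subchannels.power, Subchannels.empty]
  · obtain ⟨n, hn, hpos⟩ := hH a ha
    obtain ⟨ζ, P, h1, h2⟩ := exists_isAllocation (s := modeSub π H a) S.beta_pos hl
      ⟨n, frozenSub_idx_nonempty hn ((frobSq_pos_iff _).1 hpos)⟩ (totalPower_pos (S := S) ha)
    exact ⟨P, ζ, h1, h2⟩

open Classical in
/-- The optimal power allocation of mode `a` for the multipliers `lam`, set to `0` outside the good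
states, where it need not exist. -/
def modePower (lam : Fin Kmu → ℝ) (H : S.State) (a : Mode Kbs Kmu) : Fin Kmu → ℝ :=
  if h : S.IsGood π H ∧ ∃ P, IsModeAlloc π lam H a P then h.2.choose else 0

variable {π} {lam : Fin Kmu → ℝ}

lemma modePower_spec (hl : ∀ n, 0 < lam n) {H : S.State} (hH : S.IsGood π H)
    (a : Mode Kbs Kmu) : IsModeAlloc π lam H a (modePower π lam H a) := by
  have h : S.IsGood π H ∧ ∃ P, IsModeAlloc π lam H a P := ⟨hH, exists_isModeAlloc π hl hH a⟩
  rw [modePower, dif_pos h]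
  exact h.2.choose_spec

lemma modePower_nonneg (H : S.State) (a : Mode Kbs Kmu) (n : Fin Kmu) :
    0 ≤ modePower π lam H a n := by
  unfold modePower
  split_ifs with h
  · obtain ⟨ζ, h1, -⟩ := h.2.choose_spec
    exact h1.nonneg n
  · exact le_rfl

variable (π) in
/-- The cost of the users in mode `a` with the powers `P`, weighted by the multipliers. -/
def modeCost (lam : Fin Kmu → ℝ) (H : S.State) (a : Mode Kbs Kmu) (P : Fin Kmu → ℝ) : ℝ :=
  weightedCost S.θ lam (modeRate π H a) P

lemma IsModeAlloc.cost_le (hl : ∀ n, 0 < lam n) {H : S.State} {a : Mode Kbs Kmu}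
    {P P' : Fin Kmu → ℝ} (hP : IsModeAlloc π lam H a P) (h : ∀ n, 0 ≤ P' n)
    (hsum : ∑ n, P' n ≤ S.totalPower a.size) : modeCost π lam H a P ≤ modeCost π lam H a P' ∧
      (∑ n, P' n < S.totalPower a.size → modeCost π lam H a P < modeCost π lam H a P') := by
  obtain ⟨ζ, h1, h2⟩ := hP
  rw [← h2] at hsum ⊢
  have h3 := h1.cost_le S.BT_pos S.θ_pos hl (fun n => isCapacity_frozen H _ _ n) h
  have h4 := h1.zeta_pos
  unfold modeCost modeRate
  constructor
  · nlinarith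
  · intro hlt; nlinarith

lemma IsModeAlloc.unique (hl : ∀ n, 0 < lam n) {H : S.State} {a : Mode Kbs Kmu}
    {P P' : Fin Kmu → ℝ} (hP : IsModeAlloc π lam H a P) (h : ∀ n, 0 ≤ P' n)
    (hsum : ∑ n, P' n = S.totalPower a.size)
    (hcost : modeCost π lam H a P' ≤ modeCost π lam H a P) : P' = P := by
  obtain ⟨ζ, h1, h2⟩ := hP
  rw [← h2] at hsum
  exact h1.unique S.BT_pos S.θ_pos hl (fun n => isCapacity_frozen H _ _ n) h hsum hcost

lemma IsModeAlloc.tendsto (hl : ∀ n, 0 < lam n) {H : S.State} {a : Mode Kbs Kmu}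
    {P : Fin Kmu → ℝ} (hP : IsModeAlloc π lam H a P) {κ : Type*} {l : Filter κ}
    {P' : κ → Fin Kmu → ℝ} (h : ∀ k n, 0 ≤ P' k n)
    (hsum : ∀ k, ∑ n, P' k n = S.totalPower a.size)
    (hcost : Filter.Tendsto (fun k => modeCost π lam H a (P' k)) l
      (nhds (modeCost π lam H a P))) (n : Fin Kmu) :
    Filter.Tendsto (fun k => P' k n) l (nhds (P n)) ∧
    Filter.Tendsto (fun k => Real.exp (-S.θ n * modeRate π H a n (P' k n))) l
      (nhds (Real.exp (-S.θ n * modeRate π H a n (P n)))) := by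
  obtain ⟨ζ, h1, h2⟩ := hP
  rw [← h2] at hsum
  exact h1.tendsto S.BT_pos S.θ_pos hl (fun n => isCapacity_frozen H _ _ n) h hsum hcost n

lemma IsModeAlloc.nonneg {H : S.State} {a : Mode Kbs Kmu} {P : Fin Kmu → ℝ}
    (hP : IsModeAlloc π lam H a P) (n : Fin Kmu) : 0 ≤ P n := by
  obtain ⟨ζ, h1, -⟩ := hP; exact h1.nonneg n

lemma IsModeAlloc.sum_eq {H : S.State} {a : Mode Kbs Kmu} {P : Fin Kmu → ℝ}
    (hP : IsModeAlloc π lam H a P) : ∑ n, P n = S.totalPower a.size := by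
  obtain ⟨ζ, -, h1⟩ := hP; exact h1

lemma IsModeAlloc.eq (hl : ∀ n, 0 < lam n) {H : S.State} {a : Mode Kbs Kmu}
    {P P' : Fin Kmu → ℝ} (hP : IsModeAlloc π lam H a P) (hP' : IsModeAlloc π lam H a P') :
    P' = P :=
  hP.unique hl hP'.nonneg hP'.sum_eq (hP'.cost_le hl hP.nonneg hP.sum_eq.le).1

end DownlinkSystem

namespace DownlinkSystem

variable {Kbs Kmu : ℕ} {S : DownlinkSystem Kbs Kmu} [NeZero Kmu] {π : Equiv.Perm (Fin Kmu)}
  {lam : Fin Kmu → ℝ}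

/-! ### Measurability of the optimal powers -/

lemma measurable_modeCost (a : Mode Kbs Kmu) {p : S.State → Fin Kmu → ℝ}
    (hp : ∀ n, Measurable fun H => p H n) (hp0 : ∀ H n, 0 ≤ p H n) :
    Measurable fun H => modeCost π lam H a (p H) := by
  unfold modeCost weightedCost
  exact Finset.measurable_fun_sum _ fun n _ =>
    ((measurable_modeRate π a n (hp n) fun H => hp0 H n).const_mul _).exp.const_mul _

lemma modeCost_nonneg (hl : ∀ n, 0 < lam n) (H : S.State) (a : Mode Kbs Kmu)
    (P : Fin Kmu → ℝ) : 0 ≤ modeCost π lam H a P := by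
  unfold modeCost weightedCost
  exact Finset.sum_nonneg fun n _ => mul_nonneg (hl n).le (Real.exp_nonneg _)

/-- The cost is upper semicontinuous in the powers. -/
lemma eventually_modeCost_lt (hl : ∀ n, 0 < lam n) (H : S.State) (a : Mode Kbs Kmu)
    {P : Fin Kmu → ℝ} (hP : ∀ n, 0 ≤ P n) {ε : ℝ} (hε : 0 < ε) :
    ∀ᶠ p in nhdsWithin P {p | ∀ n, 0 ≤ p n}, modeCost π lam H a p < modeCost π lam H a P + ε := by
  have hK : (0 : ℝ) < Kmu := by exact_mod_cast Nat.pos_of_ne_zero (NeZero.ne Kmu)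
  have hterm : ∀ n, ∀ᶠ p in nhdsWithin P {p | ∀ n, 0 ≤ p n},
      lam n * Real.exp (-S.θ n * modeRate π H a n (p n)) <
        lam n * Real.exp (-S.θ n * modeRate π H a n (P n)) + ε / Kmu := by
    intro n
    set C := modeRate π H a n (P n) with hC
    have hcont : Filter.Tendsto (fun r => lam n * Real.exp (-S.θ n * r)) (nhdsWithin C (Set.Iio C))
        (nhds (lam n * Real.exp (-S.θ n * C))) :=
      (Continuous.tendsto (by fun_prop) C).mono_left nhdsWithin_le_nhds
    obtain ⟨r, hr, hrC⟩ := ((hcont.eventually_lt_const (lt_add_of_pos_right _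
      (div_pos hε hK))).and self_mem_nhdsWithin).exists
    have hev := eventually_lt_frozenRate H (modeBS π H a) (modeUsers π H a) n (hP n)
      (r := r) hrC
    have htend : Filter.Tendsto (fun p : Fin Kmu → ℝ => p n)
        (nhdsWithin P {p | ∀ n, 0 ≤ p n}) (nhdsWithin (P n) (Set.Ici 0)) :=
      tendsto_nhdsWithin_iff.2 ⟨((continuous_apply n).tendsto P).mono_left nhdsWithin_le_nhds,
        Filter.eventually_of_mem self_mem_nhdsWithin fun p hp => hp n⟩
    filter_upwards [htend.eventually hev] with p hp
    refine lt_of_le_of_lt (mul_le_mul_of_nonneg_left (Real.exp_le_exp.2 ?_) (hl n).le) hr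
    have h1 : r ≤ modeRate π H a n (p n) := hp.le
    nlinarith [S.θ_pos n]
  filter_upwards [Filter.eventually_all.2 hterm] with p hp
  have h1 : ∑ n, lam n * Real.exp (-S.θ n * modeRate π H a n (p n)) <
      ∑ n, (lam n * Real.exp (-S.θ n * modeRate π H a n (P n)) + ε / Kmu) :=
    Finset.sum_lt_sum_of_nonempty Finset.univ_nonempty fun n _ => hp n
  rw [Finset.sum_add_distrib, Finset.sum_const, Finset.card_univ, Fintype.card_fin, nsmul_eq_mul,
    mul_div_cancel₀ _ hK.ne'] at h1
  exact h1

omit [NeZero Kmu] in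
lemma totalPower_nonneg (L : ℕ) : 0 ≤ S.totalPower L := by
  by_cases hL : L = 0
  · simp [hL, totalPower]
  · exact (totalPower_pos hL).le

/-- The optimal powers are measurable: they are the limit of approximate minimizers in a countable
dense set of allocations. -/
lemma measurable_modePower (hl : ∀ n, 0 < lam n) (a : Mode Kbs Kmu) (n : Fin Kmu) :
    Measurable fun H : S.State => modePower π lam H a n := by
  let Δ : Set (Fin Kmu → ℝ) := {p | (∀ n, 0 ≤ p n) ∧ ∑ n, p n = S.totalPower a.size}
  have : Nonempty Δ := ⟨⟨Pi.single 0 (S.totalPower a.size), fun n => by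
    rw [Pi.single_apply]; split_ifs
    · exact totalPower_nonneg _
    · exact le_rfl, by simp⟩⟩
  -- the first `1 / (m + 1)`-optimal element of a dense sequence is measurable in `H`, and it
  -- converges to the unique minimizer as `m → ∞`
  let d := TopologicalSpace.denseSeq Δ
  have hcm : ∀ k, Measurable fun H : S.State => modeCost π lam H a (d k).1 := fun k =>
    measurable_modeCost a (fun n => measurable_const) fun H n => (d k).2.1 n
  have hbdd : ∀ H : S.State, BddBelow (Set.range fun k => modeCost π lam H a (d k).1) :=
    fun H => ⟨0, by rintro _ ⟨k, rfl⟩; exact modeCost_nonneg hl H a _⟩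
  let I : S.State → ℝ := fun H => ⨅ k, modeCost π lam H a (d k).1
  have hI : Measurable I := Measurable.iInf hcm
  have hex : ∀ (m : ℕ) (H : S.State), ∃ k, modeCost π lam H a (d k).1 < I H + 1 / (m + 1) :=
    fun m H => exists_lt_of_ciInf_lt (lt_add_of_pos_right _ (by positivity))
  classical
  let X : ℕ → S.State → ℕ := fun m H => Nat.find (hex m H)
  have hX : ∀ m, Measurable (X m) := fun m =>
    measurable_find (hex m) fun k => measurableSet_lt (hcm k) (hI.add_const _)
  have hXm : ∀ m, Measurable fun H => (d (X m H)).1 n := fun m =>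
    (measurable_from_nat (f := fun k => (d k).1 n)).comp (hX m)
  have hgood := S.measurableSet_isGood π
  refine measurable_of_tendsto_metrizable (f := fun m =>
    {H : S.State | S.IsGood π H}.indicator fun H => (d (X m H)).1 n)
    (fun m => (hXm m).indicator hgood) (tendsto_pi_nhds.2 fun H => ?_)
  by_cases hH : S.IsGood π H
  · have hP := modePower_spec (π := π) hl hH a
    set P := modePower π lam H a
    have hIP : I H = modeCost π lam H a P := by
      refine le_antisymm (le_of_forall_pos_lt_add fun ε hε => ?_)
        (le_ciInf fun k => (hP.cost_le hl (d k).2.1 (d k).2.2.le).1)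
      have hev := eventually_modeCost_lt (π := π) hl H a hP.nonneg hε
      have hev2 : ∀ᶠ p : Δ in nhds ⟨P, hP.nonneg, hP.sum_eq⟩,
          modeCost π lam H a p.1 < modeCost π lam H a P + ε := by
        have h1 : Filter.Tendsto (fun p : Δ => p.1) (nhds ⟨P, hP.nonneg, hP.sum_eq⟩)
            (nhdsWithin P {p | ∀ n, 0 ≤ p n}) :=
          tendsto_nhdsWithin_iff.2 ⟨continuous_subtype_val.tendsto _,
            Filter.Eventually.of_forall fun p => p.2.1⟩
        exact h1.eventually hev
      obtain ⟨k, hk⟩ := (TopologicalSpace.denseRange_denseSeq Δ).exists_mem_open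
        isOpen_interior ⟨_, mem_interior_iff_mem_nhds.2 hev2⟩
      have hk' := interior_subset hk
      exact (ciInf_le (hbdd H) k).trans_lt hk'
    have hcost : Filter.Tendsto (fun m => modeCost π lam H a (d (X m H)).1) Filter.atTop
        (nhds (modeCost π lam H a P)) := by
      have h1 : Filter.Tendsto (fun m : ℕ => I H + 1 / ((m : ℝ) + 1)) Filter.atTop
          (nhds (I H)) := by
        simpa using tendsto_one_div_add_atTop_nhds_zero_nat.const_add (I H)
      rw [← hIP]
      exact tendsto_of_tendsto_of_tendsto_of_le_of_le tendsto_const_nhds h1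
        (fun m => ciInf_le (hbdd H) _) fun m => (Nat.find_spec (hex m H)).le
    have := (hP.tendsto hl (P' := fun m => (d (X m H)).1) (fun m => (d (X m H)).2.1)
      (fun m => (d (X m H)).2.2) hcost n).1
    simpa [Set.indicator, hH] using this
  · have h0 : modePower π lam H a = 0 := by
      rw [modePower, dif_neg fun h => hH h.1]
    simp [Set.indicator, hH, h0]

end DownlinkSystem

/-! ### Water-filling with a fixed set of active subchannels -/

namespace Subchannels

/-- The subchannels that receive power at the water level `μ`. -/
def active (s : Subchannels) (μ : ℝ) : Finset ℕ := s.idx.filter fun j => 1 < μ * s.snr j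

/-- With the active subchannels `J` and the multiplier `ζ`, the water level is this factor times
`ζ ^ (-1 / (1 + |J| β))`. -/
def levelFactor (s : Subchannels) (β lam : ℝ) (J : Finset ℕ) : ℝ :=
  Real.exp ((Real.log (lam * β) - β * ∑ j ∈ J, Real.log (s.snr j)) / (1 + J.card * β))

variable {s : Subchannels} {β lam ζ μ : ℝ}

lemma power_active (s : Subchannels) (μ : ℝ) :
    s.power μ = (s.active μ).card * μ - ∑ j ∈ s.active μ, 1 / s.snr j := by
  rw [power, active, ← nsmul_eq_mul, ← Finset.sum_const, ← Finset.sum_sub_distrib,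
    Finset.sum_filter]
  refine Finset.sum_congr rfl fun j hj => ?_
  have hs := s.snr_pos j hj
  split_ifs with h
  · rw [max_eq_left]
    rw [sub_nonneg, div_le_iff₀ hs]; exact h.le
  · rw [max_eq_right]
    rw [sub_nonpos, le_div_iff₀ hs]; exact not_lt.1 h

lemma logGain_active (s : Subchannels) (hμ : 0 < μ) :
    s.logGain μ = (s.active μ).card * Real.log μ + ∑ j ∈ s.active μ, Real.log (s.snr j) := by
  rw [logGain, active, ← nsmul_eq_mul, ← Finset.sum_const, ← Finset.sum_add_distrib,
    Finset.sum_filter]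
  refine Finset.sum_congr rfl fun j hj => ?_
  have hs := s.snr_pos j hj
  split_ifs with h
  · rw [max_eq_left (Real.log_nonneg h.le), Real.log_mul hμ.ne' hs.ne']
  · exact max_eq_right (Real.log_nonpos (mul_pos hμ hs).le (not_lt.1 h))

lemma power_pos_iff (s : Subchannels) (μ : ℝ) : 0 < s.power μ ↔ (s.active μ).Nonempty := by
  constructor
  · intro h
    obtain ⟨j, hj, hpos⟩ := Finset.exists_lt_of_sum_lt (s := s.idx) (f := fun _ => (0 : ℝ))
      (g := fun j => max (μ - 1 / s.snr j) 0) (by simpa [power] using h)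
    rcases lt_max_iff.1 hpos with h | h
    · refine ⟨j, Finset.mem_filter.2 ⟨hj, ?_⟩⟩
      rwa [sub_pos, div_lt_iff₀ (s.snr_pos j hj)] at h
    · exact absurd h (lt_irrefl _)
  · rintro ⟨j, hj⟩
    obtain ⟨hj, h⟩ := Finset.mem_filter.1 hj
    refine Finset.sum_pos' (fun _ _ => le_max_right _ _) ⟨j, hj, lt_max_of_lt_left ?_⟩
    rwa [sub_pos, div_lt_iff₀ (s.snr_pos j hj)]

lemma IsLevel.eq_levelFactor (hβ : 0 < β) (hl : 0 < lam) (hζ : 0 < ζ)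
    (h : s.IsLevel β lam ζ μ) :
    μ = s.levelFactor β lam (s.active μ) *
      Real.exp (1 / (1 + (s.active μ).card * β) * -Real.log ζ) := by
  have h1 := (isLevel_iff_log hβ hl hζ h.pos).1 h
  rw [logGain_active s h.pos] at h1
  have hd : (0 : ℝ) < 1 + (s.active μ).card * β := by positivity
  rw [levelFactor, ← Real.exp_add]
  rw [← Real.exp_log h.pos]
  congr 1
  rw [Real.exp_log h.pos]
  field_simp
  linarith

lemma IsLevel.power_add_eq (hβ : 0 < β) (hl : 0 < lam) (hζ : 0 < ζ)
    (h : s.IsLevel β lam ζ μ) :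
    s.power μ + ∑ j ∈ s.active μ, 1 / s.snr j =
      (s.active μ).card * s.levelFactor β lam (s.active μ) *
        Real.exp (1 / (1 + (s.active μ).card * β) * -Real.log ζ) := by
  rw [mul_assoc, ← h.eq_levelFactor hβ hl hζ, power_active s]
  ring

lemma IsLevel.cost_eq (hβ : 0 < β) (hl : 0 < lam) (hζ : 0 < ζ)
    (h : s.IsLevel β lam ζ μ) :
    lam * Real.exp (-(β * s.logGain μ)) =
      s.levelFactor β lam (s.active μ) / β *
        Real.exp (-((s.active μ).card * β / (1 + (s.active μ).card * β)) * -Real.log ζ) := by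
  have hd : (0 : ℝ) < 1 + (s.active μ).card * β := by positivity
  have h2 : Real.exp (-((s.active μ).card * β / (1 + (s.active μ).card * β)) * -Real.log ζ) =
      ζ * Real.exp (1 / (1 + (s.active μ).card * β) * -Real.log ζ) := by
    have e : -((s.active μ).card * β / (1 + (s.active μ).card * β)) * -Real.log ζ =
        Real.log ζ + 1 / (1 + (s.active μ).card * β) * -Real.log ζ := by
      field_simp
      ring
    rw [e, Real.exp_add, Real.exp_log hζ]
  have h3 : lam * Real.exp (-(β * s.logGain μ)) = ζ * μ / β := by
    rw [eq_div_iff hβ.ne', ← h.eq]; ring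
  rw [h2, h3]
  nth_rw 1 [h.eq_levelFactor hβ hl hζ]
  ring

end Subchannels

namespace DownlinkSystem

variable {Kbs Kmu : ℕ} {S : DownlinkSystem Kbs Kmu} [NeZero Kmu] {π : Equiv.Perm (Fin Kmu)}
  {lam : Fin Kmu → ℝ}

/-! ### Ties between modes -/

variable (π) in
/-- The factor `exp (-θ R)` of user `n` in a mode with optimal powers. -/
def modeFactor (lam : Fin Kmu → ℝ) (H : S.State) (a : Mode Kbs Kmu) (n : Fin Kmu) : ℝ :=
  Real.exp (-S.θ n * modeRate π H a n (modePower π lam H a n))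

variable (π) in
/-- The value `ψ` of a mode with optimal powers. -/
def modeValue (lam : Fin Kmu → ℝ) (H : S.State) (a : Mode Kbs Kmu) : ℝ :=
  a.size + modeCost π lam H a (modePower π lam H a)

lemma modeCost_eq (H : S.State) (a : Mode Kbs Kmu) :
    modeCost π lam H a (modePower π lam H a) = ∑ n, lam n * modeFactor π lam H a n := rfl

lemma measurable_modeFactor (hl : ∀ n, 0 < lam n) (a : Mode Kbs Kmu) (n : Fin Kmu) :
    Measurable fun H : S.State => modeFactor π lam H a n :=
  ((measurable_modeRate π a n (measurable_modePower hl a n)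
    fun H => modePower_nonneg H a n).const_mul _).exp

lemma measurable_modeValue (hl : ∀ n, 0 < lam n) (a : Mode Kbs Kmu) :
    Measurable fun H : S.State => modeValue π lam H a :=
  (measurable_modeCost a (fun n => measurable_modePower hl a n)
    fun H n => modePower_nonneg H a n).const_add _

lemma modeFactor_eq_one {H : S.State} {a : Mode Kbs Kmu} {n : Fin Kmu}
    (h : modePower π lam H a n = 0) : modeFactor π lam H a n = 1 := by
  rw [modeFactor, h, modeRate, frozenRate_zero, mul_zero, Real.exp_zero]

variable {c : Fin Kmu → ℝ}

omit [NeZero Kmu] in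
lemma scale_scale (c c' : Fin Kmu → ℝ) (H : S.State) :
    S.scale c' (S.scale c H) = S.scale (fun n => c' n * c n) H := by
  funext n; exact smul_smul _ _ _

lemma modeBS_scale (hc : ∀ n, 0 < c n) (H : S.State) (a : Mode Kbs Kmu) :
    modeBS π (S.scale c H) a = modeBS π H a := by
  rcases a with L | x
  · exact greedyBS_scale hc _ H _
  · exact greedyBS_scale hc _ H _

lemma modeRate_scale (hc : ∀ n, 0 < c n) {H : S.State} {a : Mode Kbs Kmu} (n : Fin Kmu) (p : ℝ) :
    modeRate π (S.scale c H) a n p =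
      S.frozenRate H (modeBS π H a) (modeUsers π (S.scale c H) a) n (c n ^ 2 * p) := by
  rw [modeRate, modeBS_scale hc, frozenRate_scale hc]

lemma modeCost_scale (hc : ∀ n, 0 < c n) {H : S.State} {a : Mode Kbs Kmu}
    (hU : modeUsers π (S.scale c H) a = modeUsers π H a) (P : Fin Kmu → ℝ) :
    modeCost π lam (S.scale c H) a P = modeCost π lam H a fun n => c n ^ 2 * P n := by
  unfold modeCost weightedCost
  simp only [modeRate_scale hc, hU]
  rfl

/-- Improving the channel of a user that gets no power before and after does not change the cost. -/
lemma modeCost_scale_eq (hl : ∀ n, 0 < lam n) {H : S.State} {a : Mode Kbs Kmu}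
    (hc : ∀ n, 0 < c n) (hU : modeUsers π (S.scale c H) a = modeUsers π H a)
    (hH : S.IsGood π H) (hH' : S.IsGood π (S.scale c H))
    (h : ∀ n, c n ≠ 1 → modePower π lam H a n = 0 ∧ modePower π lam (S.scale c H) a n = 0) :
    modeCost π lam (S.scale c H) a (modePower π lam (S.scale c H) a) =
      modeCost π lam H a (modePower π lam H a) := by
  have h1 := modePower_spec (π := π) hl hH a
  have h2 := modePower_spec (π := π) hl hH' a
  have e1 : (fun n => c n ^ 2 * modePower π lam H a n) = modePower π lam H a := by
    funext n
    by_cases hn : c n = 1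
    · rw [hn]; ring
    · rw [(h n hn).1, mul_zero]
  have e2 : (fun n => c n ^ 2 * modePower π lam (S.scale c H) a n) =
      modePower π lam (S.scale c H) a := by
    funext n
    by_cases hn : c n = 1
    · rw [hn]; ring
    · rw [(h n hn).2, mul_zero]
  refine le_antisymm ?_ ?_
  · have := (h2.cost_le hl h1.nonneg h1.sum_eq.le).1
    rwa [modeCost_scale hc hU (modePower π lam H a), e1] at this
  · have := (h1.cost_le hl h2.nonneg h2.sum_eq.le).1
    rwa [modeCost_scale hc hU, e2]

/-- Improving the channel of a user that gets power strictly lowers the cost. -/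
lemma modeCost_scale_lt (hl : ∀ n, 0 < lam n) {H : S.State} {a : Mode Kbs Kmu}
    (hc : ∀ n, 1 ≤ c n) (hU : modeUsers π (S.scale c H) a = modeUsers π H a)
    (hH : S.IsGood π H) (hH' : S.IsGood π (S.scale c H))
    (h : ∃ n, 1 < c n ∧ 0 < modePower π lam H a n) :
    modeCost π lam (S.scale c H) a (modePower π lam (S.scale c H) a) <
      modeCost π lam H a (modePower π lam H a) := by
  have hc0 : ∀ n, 0 < c n := fun n => one_pos.trans_le (hc n)
  have h1 := modePower_spec (π := π) hl hH a
  have h2 := modePower_spec (π := π) hl hH' a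
  set P := modePower π lam H a
  have hle : ∀ n, P n / c n ^ 2 ≤ P n := fun n =>
    div_le_self (h1.nonneg n) (one_le_pow₀ (hc n))
  have hlt : ∑ n, P n / c n ^ 2 < S.totalPower a.size := by
    rw [← h1.sum_eq]
    obtain ⟨n, hn, hpos⟩ := h
    exact Finset.sum_lt_sum (fun n _ => hle n)
      ⟨n, Finset.mem_univ n, div_lt_self hpos (one_lt_pow₀ hn two_ne_zero)⟩
  have := (h2.cost_le hl (P' := fun n => P n / c n ^ 2)
    (fun n => div_nonneg (h1.nonneg n) (sq_nonneg _)) hlt.le).2 hlt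
  rw [modeCost_scale hc0 hU fun n => P n / c n ^ 2] at this
  have e : (fun n => c n ^ 2 * (P n / c n ^ 2)) = P := by
    funext n; exact mul_div_cancel₀ _ (pow_pos (hc0 n) 2).ne'
  rwa [e] at this

/-- Almost surely, if two modes have equal values, a user with power in one of them has power in the
other: improving only the channel of a user with power in mode `a` but not in mode `b` lowers the
value of `a` and keeps that of `b`. -/
lemma ae_power_pos_of_tie [NeZero Kbs] (hl : ∀ n, 0 < lam n) (a b : Mode Kbs Kmu) (n : Fin Kmu) :
    ∀ᵐ H ∂S.fadingLaw, modeValue π lam H a = modeValue π lam H b →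
      0 < modePower π lam H a n → 0 < modePower π lam H b n := by
  let E : Set S.State := {H | S.IsGood π H ∧ modeValue π lam H a = modeValue π lam H b ∧
    0 < modePower π lam H a n ∧ modePower π lam H b n = 0}
  have hE : MeasurableSet E := by
    refine (S.measurableSet_isGood π).inter ((measurableSet_eq_fun (measurable_modeValue hl a)
      (measurable_modeValue hl b)).inter ((measurableSet_lt measurable_const
      (measurable_modePower hl a n)).inter (measurableSet_eq_fun (measurable_modePower hl b n)
      measurable_const)))
  have hnull : S.fadingLaw E = 0 := by
    refine S.fadingLaw_null_of_scale hE (fun t n' => if n' = n then t else 1) (fun n' => ?_)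
      (fun t ht n' => ?_) fun H => ?_
    · split_ifs <;> fun_prop
    · split_ifs
      · exact ht
      · exact one_pos
    · refine Set.Finite.measure_zero (Set.Finite.of_injOn (t := Set.univ) (f := fun t =>
        (modeUsers π (S.scale (fun n' => if n' = n then t else 1) H) a,
          modeUsers π (S.scale (fun n' => if n' = n then t else 1) H) b)) (by simp [Set.MapsTo]) ?_
          Set.finite_univ) _
      -- a tie occurs for at most one `t` for each pair of sets of active users
      have key : ∀ t t' : ℝ, 0 < t → t < t' →
          S.scale (fun n' => if n' = n then t else 1) H ∈ E →
          S.scale (fun n' => if n' = n then t' else 1) H ∈ E →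
          modeUsers π (S.scale (fun n' => if n' = n then t else 1) H) a =
            modeUsers π (S.scale (fun n' => if n' = n then t' else 1) H) a →
          modeUsers π (S.scale (fun n' => if n' = n then t else 1) H) b =
            modeUsers π (S.scale (fun n' => if n' = n then t' else 1) H) b → False := by
        intro t t' ht htt h h' hUa hUb
        set H1 := S.scale (fun n' => if n' = n then t else 1) H
        let c : Fin Kmu → ℝ := fun n' => if n' = n then t' / t else 1
        have hH2 : S.scale (fun n' => if n' = n then t' else 1) H = S.scale c H1 := by
          rw [scale_scale]
          congr 1
          funext n'
          simp only [c]
          split_ifs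
          · field_simp
          · simp
        rw [hH2] at h' hUa hUb
        have hc : ∀ n', 1 ≤ c n' := fun n' => by
          simp only [c]; split_ifs
          · rw [one_le_div ht]; exact htt.le
          · exact le_rfl
        have hlt := modeCost_scale_lt (π := π) (a := a) hl hc hUa.symm h.1 h'.1
          ⟨n, by simp only [c, if_true]; rwa [one_lt_div ht], h.2.2.1⟩
        have heq := modeCost_scale_eq (π := π) (a := b) hl
          (fun n' => one_pos.trans_le (hc n')) hUb.symm h.1 h'.1 fun n' hn' => by
            have : n' = n := by
              by_contra hne
              exact hn' (by simp only [c, if_neg hne])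
            rw [this]
            exact ⟨h.2.2.2, h'.2.2.2⟩
        have e1 := h.2.1
        have e2 := h'.2.1
        unfold modeValue at e1 e2
        linarith
      rintro t ⟨ht, h⟩ t' ⟨ht', h'⟩ hU
      obtain ⟨hUa, hUb⟩ := Prod.mk.inj hU
      by_contra hne
      rcases lt_or_gt_of_ne hne with hlt | hlt
      · exact key t t' ht hlt h h' hUa hUb
      · exact key t' t ht' hlt h' h hUa.symm hUb.symm
  filter_upwards [ae_isGood (S := S) π, measure_eq_zero_iff_ae_notMem.1 hnull] with H hH hnot htie hpos
  by_contra hle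
  exact hnot ⟨hH, htie, hpos, le_antisymm (not_lt.1 hle) (modePower_nonneg H b n)⟩

/-- Under a common scaling of all channels by `t`, as long as the active users do not change, the
optimal powers multiplied by `t ^ 2` are a modified water-filling for the unscaled channels. -/
lemma exists_level_scale (hl : ∀ n, 0 < lam n) {H : S.State} {a : Mode Kbs Kmu} (ha : a.size ≠ 0)
    {t : ℝ} (ht : 0 < t) {U : Finset (Fin Kmu)}
    (hU : modeUsers π (S.scale (fun _ => t) H) a = U)
    (hH : S.IsGood π (S.scale (fun _ => t) H)) :
    ∃ ζ, 0 < ζ ∧ ∃ μ : Fin Kmu → ℝ, ∀ n,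
      (S.frozenSub H (modeBS π H a) U n).IsLevel (S.beta n) (lam n) ζ (μ n) ∧
      t ^ 2 * modePower π lam (S.scale (fun _ => t) H) a n =
        (S.frozenSub H (modeBS π H a) U n).power (μ n) ∧
      modeFactor π lam (S.scale (fun _ => t) H) a n =
        Real.exp (-(S.beta n * (S.frozenSub H (modeBS π H a) U n).logGain (μ n))) := by
  have hc : ∀ n : Fin Kmu, 0 < (fun _ : Fin Kmu => t) n := fun _ => ht
  have ht2 : 0 < t ^ 2 := pow_pos ht 2
  obtain ⟨n, hn, hne⟩ := hH a ha
  rw [modeBS_scale hc, hU] at hne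
  rw [hU] at hn
  have hne' : S.effChannel H (modeBS π H a) U n ≠ 0 := by
    have h1 := (frobSq_pos_iff _).1 hne
    rw [effChannel_eq, nullSpace_scale hc, channel_scale, Matrix.smul_mul] at h1
    exact (smul_ne_zero_iff.1 h1).2
  obtain ⟨ζ, P', hP', hsum⟩ := exists_isAllocation (s := S.frozenSub H (modeBS π H a) U)
    (β := S.beta) (lam := lam) S.beta_pos hl ⟨n, frozenSub_idx_nonempty hn hne'⟩
    (mul_pos ht2 (totalPower_pos (S := S) ha))
  have hP := modePower_spec (π := π) hl hH a
  set H' := S.scale (fun _ => t) H with hH'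
  have hrate : ∀ n p, modeRate π H' a n p =
      S.frozenRate H (modeBS π H a) U n (t ^ 2 * p) := fun n p => by
    rw [hH', modeRate_scale hc, ← hH', hU]
  have hPeq : (fun n => P' n / t ^ 2) = modePower π lam H' a := by
    refine hP.unique hl (fun n => div_nonneg (hP'.nonneg n) ht2.le) ?_ ?_
    · rw [← Finset.sum_div, hsum, mul_div_cancel_left₀ _ ht2.ne']
    · have h1 := hP'.cost_le S.BT_pos S.θ_pos hl (fun n => isCapacity_frozen H _ _ n)
        (P' := fun n => t ^ 2 * modePower π lam H' a n)
        (fun n => mul_nonneg ht2.le (hP.nonneg n))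
      rw [← Finset.mul_sum, hP.sum_eq, hsum, sub_self, mul_zero, add_zero] at h1
      unfold modeCost weightedCost at *
      simp only [hrate]
      refine le_trans (le_of_eq ?_) h1
      exact Finset.sum_congr rfl fun n _ => by rw [mul_div_cancel₀ _ ht2.ne']
  choose μ hμ1 hμ2 using hP'.level
  refine ⟨ζ, hP'.zeta_pos, μ, fun n => ?_⟩
  have hPn : t ^ 2 * modePower π lam H' a n =
      (S.frozenSub H (modeBS π H a) U n).power (μ n) := by
    rw [← hPeq, ← hμ2 n]; exact mul_div_cancel₀ _ ht2.ne'
  refine ⟨hμ1 n, hPn, ?_⟩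
  rw [modeFactor, hrate, hPn, (isCapacity_frozen H _ _ n).eq _ (hμ1 n).pos, beta]
  congr 1
  ring

end DownlinkSystem

namespace DownlinkSystem

variable {Kbs Kmu : ℕ} {S : DownlinkSystem Kbs Kmu} [NeZero Kmu] {π : Equiv.Perm (Fin Kmu)}
  {lam : Fin Kmu → ℝ}

/-- The value of a mode along a common scaling of all channels: as long as the active users and
the active subchannels `J` do not change, it is an exponential sum in the variable
`v = -log ζ`, which is itself determined by an exponential sum. -/
lemma exists_expSum_scale (hl : ∀ n, 0 < lam n) {H : S.State} {a : Mode Kbs Kmu} (ha : a.size ≠ 0)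
    {t : ℝ} (ht : 0 < t) {U : Finset (Fin Kmu)}
    (hU : modeUsers π (S.scale (fun _ => t) H) a = U)
    (hH : S.IsGood π (S.scale (fun _ => t) H)) :
    ∃ J : Fin Kmu → Finset ℕ, ∃ v : ℝ,
      (∀ n, J n ⊆ (S.frozenSub H (modeBS π H a) U n).idx) ∧
      (∀ n, 0 < modePower π lam (S.scale (fun _ => t) H) a n ↔ (J n).Nonempty) ∧
      expSum (fun n => ((J n).card : ℝ) *
          (S.frozenSub H (modeBS π H a) U n).levelFactor (S.beta n) (lam n) (J n))
        (fun n => 1 / (1 + (J n).card * S.beta n)) v =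
        t ^ 2 * S.totalPower a.size +
          ∑ n, ∑ j ∈ J n, 1 / (S.frozenSub H (modeBS π H a) U n).snr j ∧
      modeValue π lam (S.scale (fun _ => t) H) a = a.size + expSum
        (fun n => (S.frozenSub H (modeBS π H a) U n).levelFactor (S.beta n) (lam n) (J n) /
          S.beta n)
        (fun n => -((J n).card * S.beta n / (1 + (J n).card * S.beta n))) v := by
  obtain ⟨ζ, hζ, μ, hμ⟩ := exists_level_scale hl ha ht hU hH
  have ht2 : 0 < t ^ 2 := pow_pos ht 2
  refine ⟨fun n => (S.frozenSub H (modeBS π H a) U n).active (μ n), -Real.log ζ,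
    fun n => Finset.filter_subset _ _, fun n => ?_, ?_, ?_⟩
  · rw [← Subchannels.power_pos_iff, ← (hμ n).2.1, mul_pos_iff_of_pos_left ht2]
  · rw [← (modePower_spec (π := π) hl hH a).sum_eq, Finset.mul_sum, ← Finset.sum_add_distrib]
    refine Finset.sum_congr rfl fun n _ => ?_
    rw [(hμ n).2.1, (hμ n).1.power_add_eq (S.beta_pos n) (hl n) hζ]
  · rw [modeValue, modeCost_eq]
    congr 1
    refine Finset.sum_congr rfl fun n _ => ?_
    rw [(hμ n).2.2, (hμ n).1.cost_eq (S.beta_pos n) (hl n) hζ]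

/-- Almost surely, modes with different numbers of base stations have different values. A tie requires
that the same users get power. Along a common scaling of the channels to infinity, the factors of
these users tend to zero and those of the others stay one, so that the difference of the values
tends to the difference of the numbers of base stations. -/
lemma ae_ne_of_size_ne [NeZero Kbs] (hl : ∀ n, 0 < lam n) {a b : Mode Kbs Kmu}
    (hab : a.size ≠ b.size) :
    ∀ᵐ H ∂S.fadingLaw, modeValue π lam H a ≠ modeValue π lam H b := by
  let E : Set S.State := {H | S.IsGood π H ∧ modeValue π lam H a = modeValue π lam H b ∧
    ∀ n, (0 < modePower π lam H a n ↔ 0 < modePower π lam H b n)}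
  have hE : MeasurableSet E := by
    refine (S.measurableSet_isGood π).inter ((measurableSet_eq_fun (measurable_modeValue hl a)
      (measurable_modeValue hl b)).inter ?_)
    have : {H : S.State | ∀ n, (0 < modePower π lam H a n ↔ 0 < modePower π lam H b n)} =
        ⋂ n, {H | 0 < modePower π lam H a n ↔ 0 < modePower π lam H b n} := by
      ext H; simp
    change MeasurableSet
      {H : S.State | ∀ n, (0 < modePower π lam H a n ↔ 0 < modePower π lam H b n)}
    rw [this]
    exact MeasurableSet.iInter fun n =>
      (measurableSet_lt measurable_const (measurable_modePower hl a n)).iff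
        (measurableSet_lt measurable_const (measurable_modePower hl b n))
  have hnull : S.fadingLaw E = 0 := by
    have hzero : ∀ a b : Mode Kbs Kmu, a.size = 0 → b.size ≠ 0 → ∀ H, S.IsGood π H →
        (∀ n, (0 < modePower π lam H a n ↔ 0 < modePower π lam H b n)) → False := by
      intro a b ha hb H hH hiff
      have h1 := (modePower_spec (π := π) hl hH a).sum_eq
      have h2 := (modePower_spec (π := π) hl hH b).sum_eq
      rw [ha, totalPower, if_pos rfl,
        Finset.sum_eq_zero_iff_of_nonneg fun n _ => modePower_nonneg H a n] at h1
      have h3 : ∑ n, modePower π lam H b n ≤ 0 := Finset.sum_nonpos fun n _ => by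
        have := (hiff n).not.1 (by rw [h1 n (Finset.mem_univ n)]; exact lt_irrefl _)
        exact not_lt.1 this
      linarith [totalPower_pos (S := S) hb]
    by_cases ha : a.size = 0
    · refine measure_mono_null (t := ∅) (fun H h => ?_) measure_empty
      exact hzero a b ha (fun h0 => hab (ha.trans h0.symm)) H h.1 h.2.2
    by_cases hb : b.size = 0
    · refine measure_mono_null (t := ∅) (fun H h => ?_) measure_empty
      exact hzero b a hb ha H h.1 fun n => (h.2.2 n).symm
    refine S.fadingLaw_null_of_scale hE (fun t _ => t) (fun _ => measurable_id)
      (fun t ht _ => ht) fun H => ?_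
    -- the curve is split into countably many pieces with constant active users and subchannels
    let sa : Finset (Fin Kmu) → Fin Kmu → Subchannels := S.frozenSub H (modeBS π H a)
    let sb : Finset (Fin Kmu) → Fin Kmu → Subchannels := S.frozenSub H (modeBS π H b)
    let F : Finset (Fin Kmu) × Finset (Fin Kmu) × (Fin Kmu → Finset ℕ) × (Fin Kmu → Finset ℕ) →
        Set ℝ := fun ⟨U, U', J, J'⟩ =>
      {t | ((∀ n, J n ⊆ (sa U n).idx) ∧ (∀ n, J' n ⊆ (sb U' n).idx) ∧
          (∀ n, (J n).Nonempty ↔ (J' n).Nonempty) ∧ ∃ n, (J n).Nonempty) ∧ 0 < t ∧ ∃ v v',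
        expSum (fun n => ((J n).card : ℝ) * (sa U n).levelFactor (S.beta n) (lam n) (J n))
          (fun n => 1 / (1 + (J n).card * S.beta n)) v =
          t ^ 2 * S.totalPower a.size + ∑ n, ∑ j ∈ J n, 1 / (sa U n).snr j ∧
        expSum (fun n => ((J' n).card : ℝ) * (sb U' n).levelFactor (S.beta n) (lam n) (J' n))
          (fun n => 1 / (1 + (J' n).card * S.beta n)) v' =
          t ^ 2 * S.totalPower b.size + ∑ n, ∑ j ∈ J' n, 1 / (sb U' n).snr j ∧
        a.size + expSum (fun n => (sa U n).levelFactor (S.beta n) (lam n) (J n) / S.beta n)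
          (fun n => -((J n).card * S.beta n / (1 + (J n).card * S.beta n))) v =
        b.size + expSum (fun n => (sb U' n).levelFactor (S.beta n) (lam n) (J' n) / S.beta n)
          (fun n => -((J' n).card * S.beta n / (1 + (J' n).card * S.beta n))) v'}
    refine measure_mono_null (t := ⋃ x, F x) ?_ (measure_iUnion_null ?_)
    · rintro t ⟨ht, hgood, htie, hiff⟩
      obtain ⟨J, v, h1, h2, h3, h4⟩ := exists_expSum_scale (π := π) hl ha ht rfl hgood
      obtain ⟨J', v', h1', h2', h3', h4'⟩ := exists_expSum_scale (π := π) hl hb ht rfl hgood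
      refine Set.mem_iUnion.2 ⟨(_, _, J, J'), ⟨h1, h1', fun n => ?_, ?_⟩, ht, v, v', h3, h3', ?_⟩
      · rw [← h2, ← h2', hiff]
      · by_contra hno
        push Not at hno
        have hs := (modePower_spec (π := π) hl hgood a).sum_eq
        have h5 : ∑ n, modePower π lam (S.scale (fun _ => t) H) a n ≤ 0 :=
          Finset.sum_nonpos fun n _ => by
            refine not_lt.1 fun hlt => ?_
            have := (h2 n).1 hlt
            rw [hno n] at this
            exact Finset.not_nonempty_empty this
        linarith [totalPower_pos (S := S) ha]
      · rw [← h4, ← h4', htie]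
    · rintro ⟨U, U', J, J'⟩
      by_cases hc : (∀ n, J n ⊆ (sa U n).idx) ∧ (∀ n, J' n ⊆ (sb U' n).idx) ∧
          (∀ n, (J n).Nonempty ↔ (J' n).Nonempty) ∧ ∃ n, (J n).Nonempty
      swap
      · exact measure_mono_null (t := ∅) (fun t h => hc h.1) measure_empty
      refine measure_mono_null (fun t h => h.2) (volume_expSum_tie ?_ ?_ ?_ ?_ ?_ ?_ ?_ ?_
        (totalPower_pos (S := S) ha) (totalPower_pos (S := S) hb) ?_ ?_ ?_)
      · exact fun n => mul_nonneg (Nat.cast_nonneg _) (Real.exp_pos _).le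
      · intro n; have := S.beta_pos n; positivity
      · obtain ⟨n, hn⟩ := hc.2.2.2
        exact ⟨n, mul_pos (Nat.cast_pos.2 hn.card_pos) (Real.exp_pos _)⟩
      · intro n; have := S.beta_pos n; positivity
      · exact fun n => mul_nonneg (Nat.cast_nonneg _) (Real.exp_pos _).le
      · intro n; have := S.beta_pos n; positivity
      · obtain ⟨n, hn⟩ := hc.2.2.2
        exact ⟨n, mul_pos (Nat.cast_pos.2 ((hc.2.2.1 n).1 hn).card_pos) (Real.exp_pos _)⟩
      · intro n; have := S.beta_pos n; positivity
      · exact Finset.sum_nonneg fun n _ => Finset.sum_nonneg fun j hj =>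
          (one_div_pos.2 ((sa U n).snr_pos j (hc.1 n hj))).le
      · exact Finset.sum_nonneg fun n _ => Finset.sum_nonneg fun j hj =>
          (one_div_pos.2 ((sb U' n).snr_pos j (hc.2.1 n hj))).le
      · -- the limits for `t → ∞` differ because the sets of users with power coincide
        have hlim : ∀ (s : Fin Kmu → Subchannels) (J : Fin Kmu → Finset ℕ),
            ∑ n, (if ((J n).card : ℝ) * S.beta n / (1 + (J n).card * S.beta n) = 0
              then (s n).levelFactor (S.beta n) (lam n) (J n) / S.beta n else 0) =
            ∑ n, (if (J n).Nonempty then 0 else lam n) := by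
          intro s J
          refine Finset.sum_congr rfl fun n _ => ?_
          have hβ := S.beta_pos n
          by_cases hJ : (J n).Nonempty
          · have : (0 : ℝ) < (J n).card := Nat.cast_pos.2 hJ.card_pos
            rw [if_neg (by positivity), if_pos hJ]
          · rw [if_neg hJ]
            rw [Finset.not_nonempty_iff_eq_empty] at hJ
            rw [hJ, if_pos (by simp), Subchannels.levelFactor]
            simp only [Finset.sum_empty, mul_zero, sub_zero, Finset.card_empty, Nat.cast_zero,
              zero_mul, add_zero, div_one]
            rw [Real.exp_log (mul_pos (hl n) hβ), mul_div_cancel_right₀ _ hβ.ne']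
        rw [hlim, hlim]
        simp only [hc.2.2.1]
        intro h
        exact hab (by exact_mod_cast add_right_cancel h)
  filter_upwards [ae_isGood (S := S) π, measure_eq_zero_iff_ae_notMem.1 hnull,
    ae_all_iff.2 fun n => ae_power_pos_of_tie (π := π) hl a b n,
    ae_all_iff.2 fun n => ae_power_pos_of_tie (π := π) hl b a n] with H hH hnot h1 h2 htie
  exact hnot ⟨hH, htie, fun n => ⟨h1 n htie, h2 n htie.symm⟩⟩

/-- A user that is not served in a mode gets no power: its family of subchannels is empty. -/
lemma IsModeAlloc.eq_zero_of_notMem {H : S.State} {a : Mode Kbs Kmu} {P : Fin Kmu → ℝ}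
    (hP : IsModeAlloc π lam H a P) {n : Fin Kmu} (hn : n ∉ modeUsers π H a) : P n = 0 := by
  obtain ⟨ζ, h, -⟩ := hP
  obtain ⟨μ, -, hμ⟩ := h.level n
  rw [hμ, modeSub, frozenSub, if_neg hn]
  simp [Subchannels.power, Subchannels.empty]

/-- Almost surely, ties between modes are harmless: two modes with equal values give each user the
same exponential factor. -/
theorem ae_factor_eq_of_tie [NeZero Kbs] (hl : ∀ n, 0 < lam n) :
    ∀ᵐ H ∂S.fadingLaw, ∀ a b : Mode Kbs Kmu, modeValue π lam H a = modeValue π lam H b →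
      modeFactor π lam H a = modeFactor π lam H b := by
  have hsize : ∀ᵐ H ∂S.fadingLaw, ∀ a b : Mode Kbs Kmu,
      modeValue π lam H a = modeValue π lam H b → a.size = b.size := by
    refine ae_all_iff.2 fun a => ae_all_iff.2 fun b => ?_
    by_cases hab : a.size = b.size
    · exact Filter.Eventually.of_forall fun _ _ => hab
    · filter_upwards [ae_ne_of_size_ne (π := π) hl hab] with H hH h
      exact absurd h hH
  filter_upwards [ae_isGood (S := S) π, hsize, ae_all_iff.2 fun a => ae_all_iff.2 fun b =>
    ae_all_iff.2 fun n => ae_power_pos_of_tie (π := π) hl a b n] with H hH hs hpos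
  -- a tie with a single-user mode leaves only one user with power, whose factor is then determined
  -- by the value
  have key : ∀ (x : Fin Kbs × Fin Kmu) (b : Mode Kbs Kmu),
      modeValue π lam H (.inr x) = modeValue π lam H b →
      modeFactor π lam H (.inr x) = modeFactor π lam H b := by
    intro x b htie
    have hone : ∀ j, j ≠ x.2 → modeFactor π lam H (.inr x) j = 1 ∧ modeFactor π lam H b j = 1 := by
      intro j hj
      have h0 := (modePower_spec (π := π) hl hH (.inr x)).eq_zero_of_notMem (n := j)
        (by simpa [modeUsers] using hj)
      refine ⟨modeFactor_eq_one h0, modeFactor_eq_one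
        (le_antisymm (not_lt.1 fun h => ?_) (modePower_nonneg H b j))⟩
      exact absurd (hpos b (.inr x) j htie.symm h) (by rw [h0]; exact lt_irrefl _)
    have hcost := htie
    rw [modeValue, modeValue, hs _ _ htie, modeCost_eq, modeCost_eq, add_right_inj,
      ← Finset.add_sum_erase _ _ (Finset.mem_univ x.2),
      ← Finset.add_sum_erase _ (fun n => lam n * modeFactor π lam H b n) (Finset.mem_univ x.2),
      Finset.sum_congr rfl fun j hj => by
        rw [(hone j (Finset.ne_of_mem_erase hj)).1, ← (hone j (Finset.ne_of_mem_erase hj)).2],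
      add_left_inj] at hcost
    funext j
    by_cases hj : j = x.2
    · rw [hj]; exact mul_left_cancel₀ (hl x.2).ne' hcost
    · rw [(hone j hj).1, (hone j hj).2]
  rintro (L | x) b htie
  · rcases b with L' | x
    · have : L = L' := Fin.ext (hs _ _ htie)
      rw [this]
    · exact (key x _ htie.symm).symm
  · exact key x b htie

end DownlinkSystem

namespace DownlinkSystem

variable {Kbs Kmu : ℕ} {S : DownlinkSystem Kbs Kmu} [NeZero Kmu] {π : Equiv.Perm (Fin Kmu)}
  {lam : Fin Kmu → ℝ}

/-! ### The explicit form of modified water-filling -/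

lemma modeSub_inl_of_mem {H : S.State} {L : Fin (Kbs + 1)} {n : Fin Kmu}
    (hn : n ∈ S.activeUsers π H L) :
    modeSub π H (.inl L) n = Subchannels.ofMatrix (S.multiChannel π H L n) :=
  if_pos hn

lemma modeSub_inl_of_notMem {H : S.State} {L : Fin (Kbs + 1)} {n : Fin Kmu}
    (hn : n ∉ S.activeUsers π H L) : modeSub π H (.inl L) n = Subchannels.empty :=
  if_neg hn

lemma isWaterLevel_iff {H : S.State} {L : ℕ} {z : ℝ} (hz : 0 < z) {n : Fin Kmu}
    (hl : 0 < lam n) {w : ℝ × ℕ} :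
    S.IsWaterLevel π lam H L z n w ↔
      (Subchannels.ofMatrix (S.multiChannel π H L n)).IsLevel (S.beta n) (lam n) z w.1 ∧
      breakpoint (S.multiChannel π H L n) w.2 ≤ (w.1 : EReal) ∧
      (w.1 : EReal) < breakpoint (S.multiChannel π H L n) (w.2 + 1) :=
  and_congr_left fun h => level_formula_iff (S.beta_pos n) hl hz h.1 h.2

lemma existsUnique_isWaterLevel (H : S.State) (L : ℕ) {z : ℝ} (hz : 0 < z) {n : Fin Kmu}
    (hl : 0 < lam n) : ∃! w : ℝ × ℕ, S.IsWaterLevel π lam H L z n w := by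
  obtain ⟨μ, hμ, hu⟩ := Subchannels.existsUnique_isLevel
    (Subchannels.ofMatrix (S.multiChannel π H L n)) (S.beta_pos n) hl hz
  obtain ⟨i, hi, hi'⟩ := exists_breakpoint_interval (G := S.multiChannel π H L n) hμ.pos
  refine ⟨(μ, i), (isWaterLevel_iff hz hl).2 ⟨hμ, hi, hi'⟩, fun w hw => ?_⟩
  obtain ⟨h1, h2, h3⟩ := (isWaterLevel_iff hz hl).1 hw
  have e1 : w.1 = μ := hu _ h1
  rw [e1] at h2 h3
  exact Prod.ext e1 (breakpoint_interval_unique h2 h3 hi hi')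

lemma isModifiedWaterFilling_iff (hl : ∀ n, 0 < lam n) {H : S.State} {L : Fin (Kbs + 1)} {z : ℝ}
    (hz : 0 < z) {P : Fin Kmu → ℝ} :
    S.IsModifiedWaterFilling π lam H L z P ↔
      IsAllocation (modeSub π H (.inl L)) S.beta lam z P := by
  have hpow : ∀ {n : Fin Kmu} {w : ℝ × ℕ}, S.IsWaterLevel π lam H L z n w →
      max ((w.2 : ℝ) * w.1 -
        ∑ j ∈ Finset.Icc 1 w.2, 1 / subchannelSNR (S.multiChannel π H L n) j) 0 =
      (Subchannels.ofMatrix (S.multiChannel π H L n)).power w.1 := fun {n w} hw => by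
    rw [← power_of_breakpoint hw.2.1 hw.2.2, max_eq_left (Subchannels.power_nonneg _ _)]
  constructor
  · rintro ⟨h1, h2⟩
    refine ⟨hz, fun n => ?_⟩
    by_cases hn : n ∈ S.activeUsers π H L
    · obtain ⟨w, ⟨hw, -⟩, hP⟩ := h1 n hn
      rw [modeSub_inl_of_mem hn]
      exact ⟨w.1, ((isWaterLevel_iff hz (hl n)).1 hw).1, hP.trans (hpow hw)⟩
    · rw [modeSub_inl_of_notMem hn]
      obtain ⟨μ, hμ, -⟩ := Subchannels.existsUnique_isLevel Subchannels.empty (S.beta_pos n) (hl n)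
        hz
      refine ⟨μ, hμ, ?_⟩
      rw [h2 n hn]
      simp [Subchannels.power, Subchannels.empty]
  · rintro ⟨-, h⟩
    refine ⟨fun n hn => ?_, fun n hn => ?_⟩
    · obtain ⟨w, hw, hu⟩ := existsUnique_isWaterLevel (S := S) (π := π) H L hz (hl n)
      refine ⟨w, ⟨hw, hu⟩, ?_⟩
      obtain ⟨μ, hμ, hP⟩ := h n
      rw [modeSub_inl_of_mem hn] at hμ hP
      rw [hP, hpow hw, (Subchannels.existsUnique_isLevel _ (S.beta_pos n) (hl n) hz).unique hμ
        ((isWaterLevel_iff hz (hl n)).1 hw).1]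
    · obtain ⟨μ, -, hP⟩ := h n
      rw [hP, modeSub_inl_of_notMem hn]
      simp [Subchannels.power, Subchannels.empty]

lemma existsUnique_zeta (hl : ∀ n, 0 < lam n) {H : S.State} (hH : S.IsGood π H)
    {L : Fin (Kbs + 1)} (hL : L ≠ 0) :
    ∃! z : ℝ, 0 < z ∧ ∃ P : Fin Kmu → ℝ, S.IsModifiedWaterFilling π lam H L z P ∧
      ∑ n, P n = S.totalPower L := by
  have hsize : Mode.size (.inl L : Mode Kbs Kmu) ≠ 0 := fun h => hL (Fin.ext h)
  obtain ⟨ζ, h1, h2⟩ := modePower_spec (π := π) hl hH (.inl L)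
  refine ⟨ζ, ⟨h1.zeta_pos, _, (isModifiedWaterFilling_iff hl h1.zeta_pos).2 h1, h2⟩, ?_⟩
  rintro z ⟨hz, P, hP, hsum⟩
  have h3 := (isModifiedWaterFilling_iff hl hz).1 hP
  exact h3.zeta_unique S.beta_pos hl h1 (hsum.trans h2.symm)
    (by rw [hsum]; exact totalPower_pos (S := S) hsize)

/-- Modified water-filling that meets the power constraint is the optimal allocation. -/
lemma eq_modePower_of_isModifiedWaterFilling (hl : ∀ n, 0 < lam n) {H : S.State}
    (hH : S.IsGood π H) {L : Fin (Kbs + 1)} {z : ℝ} (hz : L ≠ 0 → 0 < z) {P : Fin Kmu → ℝ}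
    (hP : S.IsModifiedWaterFilling π lam H L z P) (hsum : ∑ n, P n = S.totalPower L) :
    P = modePower π lam H (.inl L) := by
  have hspec := modePower_spec (π := π) hl hH (.inl L)
  by_cases hL : L = 0
  · -- without base stations there is no active user, so the level conditions are void
    have hU : S.activeUsers π H L = ∅ := by rw [hL]; exact activeUsers_zero π H
    funext n
    rw [hP.2 n (by simp [hU])]
    exact (hspec.eq_zero_of_notMem (n := n) (by simp [modeUsers, hU])).symm
  · exact hspec.eq hl ⟨z, (isModifiedWaterFilling_iff hl (hz hL)).1 hP, hsum⟩

/-! ### Single-user modes -/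

lemma modePower_inr (hl : ∀ n, 0 < lam n) {H : S.State} (hH : S.IsGood π H)
    (x : Fin Kbs × Fin Kmu) (n : Fin Kmu) :
    modePower π lam H (.inr x) n = if n = x.2 then S.totalPower (x.1.val + 1) else 0 := by
  have hspec := modePower_spec (π := π) hl hH (.inr x)
  have h0 : ∀ n, n ≠ x.2 → modePower π lam H (.inr x) n = 0 := fun n hn =>
    hspec.eq_zero_of_notMem (by simpa [modeUsers] using hn)
  split_ifs with hn
  · have h1 := hspec.sum_eq
    rw [Finset.sum_eq_single x.2 (fun n _ hn => h0 n hn) (by simp)] at h1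
    rw [hn]; exact h1
  · exact h0 n hn

lemma modeRate_inr_self (H : S.State) (x : Fin Kbs × Fin Kmu) (p : ℝ) :
    modeRate π H (.inr x) x.2 p =
      mimoCapacity S.BT (S.channel H (S.singleBS H (x.1.val + 1) x.2) x.2) p := by
  have h1 : modeRate π H (.inr x) x.2 p = mimoCapacity S.BT
      (S.effChannel H (S.singleBS H (x.1.val + 1) x.2) {x.2} x.2) p :=
    if_pos (Finset.mem_singleton_self _)
  rw [h1]
  exact mimoCapacity_mul_unitary _ _ (S.precoder_conjTranspose_mul H _ _ _)
    (nullProj_singleton H _ _) p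

lemma modeRate_inr_of_ne (H : S.State) (x : Fin Kbs × Fin Kmu) {n : Fin Kmu} (hn : n ≠ x.2)
    (p : ℝ) : modeRate π H (.inr x) n p = 0 :=
  if_neg (by simpa [modeUsers] using hn)

end DownlinkSystem

namespace DownlinkSystem

variable {Kbs Kmu : ℕ} {S : DownlinkSystem Kbs Kmu}

/-! ### Policies as mixtures of modes -/

/-- The probability of each mode under a policy. -/
def Policy.weight (p : S.Policy) (H : S.State) : Mode Kbs Kmu → ℝ
  | .inl L => p.φ H L
  | .inr x => p.q H x.1 x.2

variable (S) in
/-- The powers in all modes, given those in the multi-user modes: a single-user mode spends all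
its power on its user. -/
def modeAlloc (P : Fin (Kbs + 1) → Fin Kmu → ℝ) : Mode Kbs Kmu → Fin Kmu → ℝ
  | .inl L => P L
  | .inr x => Pi.single x.2 (S.totalPower (x.1.val + 1))

variable [NeZero Kmu] {π : Equiv.Perm (Fin Kmu)} {lam : Fin Kmu → ℝ}

variable (π) in
/-- The factor `exp (-θ R)` of user `n` in a mode with the powers of a policy. -/
def Policy.factor (p : S.Policy) (H : S.State) (a : Mode Kbs Kmu) (n : Fin Kmu) : ℝ :=
  Real.exp (-S.θ n * modeRate π H a n (S.modeAlloc (p.pow H) a n))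

variable (π) in
/-- The value of a mode for given powers in the multi-user modes. -/
def modePsi (lam : Fin Kmu → ℝ) (H : S.State) (P : Fin (Kbs + 1) → Fin Kmu → ℝ)
    (a : Mode Kbs Kmu) : ℝ :=
  a.size + modeCost π lam H a (S.modeAlloc P a)

omit [NeZero Kmu] in
lemma Policy.usage_eq (p : S.Policy) :
    p.usage = ∫ H, ∑ a, p.weight H a * (a.size : ℝ) ∂S.fadingLaw := by
  unfold Policy.usage
  refine integral_congr_ae (Filter.Eventually.of_forall fun H => ?_)
  simp only [Fintype.sum_sum_type, Fintype.sum_prod_type, Policy.weight, Mode.size, Nat.cast_add,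
    Nat.cast_one, mul_comm]

lemma modeRate_modeAlloc_inr (H : S.State) (P : Fin (Kbs + 1) → Fin Kmu → ℝ) (l : Fin Kbs)
    (n : Fin Kmu) : modeRate π H (.inr (l, n)) n (S.modeAlloc P (.inr (l, n)) n) =
      S.singleRate H (l.val + 1) n := by
  have h := modeRate_inr_self (π := π) H (l, n) (S.modeAlloc P (.inr (l, n)) n)
  rw [h]
  simp [modeAlloc, singleRate]

lemma Policy.qos_eq (p : S.Policy) (n : Fin Kmu) :
    p.qos π n = (∫ H, ∑ a, p.weight H a * p.factor π H a n ∂S.fadingLaw) -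
      Real.exp (-S.θ n * S.Cbar n) := by
  unfold Policy.qos
  congr 1
  refine integral_congr_ae (Filter.Eventually.of_forall fun H => ?_)
  simp only [Fintype.sum_sum_type, Fintype.sum_prod_type, add_assoc]
  congr 1
  rw [← Finset.sum_add_distrib]
  refine Finset.sum_congr rfl fun l _ => ?_
  rw [← Finset.add_sum_erase _ (fun j => p.weight H (.inr (l, j)) *
    p.factor π H (.inr (l, j)) n) (Finset.mem_univ n)]
  congr 1
  · rw [Policy.factor, modeRate_modeAlloc_inr]; rfl
  · refine Finset.sum_congr rfl fun j hj => ?_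
    rw [Policy.factor, modeRate_inr_of_ne H (l, j) (Finset.ne_of_mem_erase hj).symm, mul_zero,
      Real.exp_zero, mul_one]
    rfl

lemma psiMulti_eq (H : S.State) (P : Fin (Kbs + 1) → Fin Kmu → ℝ) (L : Fin (Kbs + 1)) :
    S.psiMulti π lam H P L = modePsi π lam H P (.inl L) := rfl

lemma psiSingle_eq (H : S.State) (P : Fin (Kbs + 1) → Fin Kmu → ℝ) (l : Fin Kbs) (n : Fin Kmu) :
    S.psiSingle lam H l n = modePsi π lam H P (.inr (l, n)) := by
  unfold psiSingle modePsi modeCost weightedCost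
  rw [← Finset.add_sum_erase _ _ (Finset.mem_univ n), modeRate_modeAlloc_inr, add_assoc]
  congr 1
  · simp [Mode.size]
  · congr 1
    refine Finset.sum_congr rfl fun j hj => ?_
    rw [modeRate_inr_of_ne H (l, n) (Finset.ne_of_mem_erase hj), mul_zero, Real.exp_zero, mul_one]

variable [NeZero Kbs]

lemma psiStar_le (H : S.State) (P : Fin (Kbs + 1) → Fin Kmu → ℝ) (a : Mode Kbs Kmu) :
    S.psiStar π lam H P ≤ modePsi π lam H P a := by
  rcases a with L | ⟨l, n⟩
  · exact (min_le_left _ _).trans (Finset.inf'_le _ (Finset.mem_univ L))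
  · rw [← psiSingle_eq]
    exact (min_le_right _ _).trans (Finset.inf'_le (fun x : Fin Kbs × Fin Kmu =>
      S.psiSingle lam H x.1 x.2) (Finset.mem_univ (l, n)))

lemma exists_psiStar_eq (H : S.State) (P : Fin (Kbs + 1) → Fin Kmu → ℝ) :
    ∃ a, S.psiStar π lam H P = modePsi π lam H P a := by
  rcases min_choice (Finset.univ.inf' Finset.univ_nonempty fun L : Fin (Kbs + 1) =>
      S.psiMulti π lam H P L) (Finset.univ.inf' Finset.univ_nonempty
      fun x : Fin Kbs × Fin Kmu => S.psiSingle lam H x.1 x.2) with h | h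
  · obtain ⟨L, -, hL⟩ := Finset.exists_mem_eq_inf' Finset.univ_nonempty fun L : Fin (Kbs + 1) =>
      S.psiMulti π lam H P L
    exact ⟨.inl L, h.trans hL⟩
  · obtain ⟨x, -, hx⟩ := Finset.exists_mem_eq_inf' Finset.univ_nonempty
      fun x : Fin Kbs × Fin Kmu => S.psiSingle lam H x.1 x.2
    exact ⟨.inr x, h.trans (hx.trans (psiSingle_eq H P x.1 x.2))⟩

open Classical in
lemma minimizerCount_eq (H : S.State) (P : Fin (Kbs + 1) → Fin Kmu → ℝ) :
    S.minimizerCount π lam H P = (Finset.univ.filter fun a : Mode Kbs Kmu =>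
      modePsi π lam H P a = S.psiStar π lam H P).card := by
  unfold minimizerCount
  rw [Finset.card_filter, Finset.card_filter, Finset.card_filter, Fintype.sum_sum_type]
  refine congrArg₂ _ rfl (Finset.sum_congr rfl fun x _ => ?_)
  simp only [psiSingle_eq (π := π) H P]

/-! ### The best modes -/

variable (π) in
/-- The least value of a mode with optimal powers. -/
def minValue (lam : Fin Kmu → ℝ) (H : S.State) : ℝ :=
  Finset.univ.inf' Finset.univ_nonempty (modeValue π lam H)

lemma minValue_le (H : S.State) (a : Mode Kbs Kmu) : minValue π lam H ≤ modeValue π lam H a :=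
  Finset.inf'_le _ (Finset.mem_univ a)

lemma exists_minValue_eq (H : S.State) : ∃ a, modeValue π lam H a = minValue π lam H := by
  obtain ⟨a, -, ha⟩ := Finset.exists_mem_eq_inf' Finset.univ_nonempty (modeValue π lam H)
  exact ⟨a, ha.symm⟩

lemma measurable_minValue (hl : ∀ n, 0 < lam n) :
    Measurable fun H : S.State => minValue π lam H := by
  have h := Finset.inf'_induction (s := (Finset.univ : Finset (Mode Kbs Kmu)))
    Finset.univ_nonempty (fun a (H : S.State) => modeValue π lam H a) (p := Measurable)
    (fun f hf g hg => hf.inf hg) fun a _ => measurable_modeValue hl a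
  refine (congrArg Measurable (funext fun H => ?_)).mp h
  simp [minValue, Finset.inf'_apply]

open Classical in
variable (π) in
/-- The modes that attain the least value. -/
def bestModes (lam : Fin Kmu → ℝ) (H : S.State) : Finset (Mode Kbs Kmu) :=
  Finset.univ.filter fun a => modeValue π lam H a = minValue π lam H

lemma mem_bestModes {H : S.State} {a : Mode Kbs Kmu} :
    a ∈ bestModes π lam H ↔ modeValue π lam H a = minValue π lam H := by
  simp [bestModes]

lemma bestModes_card_pos (H : S.State) : 0 < (bestModes π lam H).card := by
  obtain ⟨a, ha⟩ := exists_minValue_eq (π := π) (lam := lam) H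
  exact Finset.card_pos.2 ⟨a, mem_bestModes.2 ha⟩

open Classical in
variable (π) in
/-- Equal probabilities for the best modes. -/
def equalShare (lam : Fin Kmu → ℝ) (H : S.State) (a : Mode Kbs Kmu) : ℝ :=
  if modeValue π lam H a = minValue π lam H then 1 / ((bestModes π lam H).card : ℝ) else 0

lemma equalShare_nonneg (H : S.State) (a : Mode Kbs Kmu) : 0 ≤ equalShare π lam H a := by
  unfold equalShare
  split_ifs <;> positivity

lemma sum_equalShare (H : S.State) : ∑ a, equalShare π lam H a = 1 := by
  classical
  unfold equalShare
  rw [← Finset.sum_filter]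
  have : (Finset.univ.filter fun a => modeValue π lam H a = minValue π lam H) =
      bestModes π lam H := by
    ext a; simp [bestModes]
  rw [this, Finset.sum_const, nsmul_eq_mul]
  have := bestModes_card_pos (π := π) (lam := lam) H
  field_simp

lemma measurable_equalShare (hl : ∀ n, 0 < lam n) (a : Mode Kbs Kmu) :
    Measurable fun H : S.State => equalShare π lam H a := by
  classical
  have hset : ∀ a : Mode Kbs Kmu,
      MeasurableSet {H : S.State | modeValue π lam H a = minValue π lam H} := fun a =>
    measurableSet_eq_fun (measurable_modeValue hl a) (measurable_minValue hl)
  have hcard : Measurable fun H : S.State => ((bestModes π lam H).card : ℝ) := by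
    have : (fun H : S.State => ((bestModes π lam H).card : ℝ)) =
        fun H => ∑ a, if modeValue π lam H a = minValue π lam H then (1 : ℝ) else 0 := by
      funext H
      simp only [bestModes, Finset.card_filter, Nat.cast_sum, Nat.cast_ite, Nat.cast_one,
        Nat.cast_zero]
    rw [this]
    exact Finset.measurable_fun_sum _ fun a _ =>
      Measurable.ite (hset a) measurable_const measurable_const
  unfold equalShare
  exact Measurable.ite (hset a) (measurable_const.div hcard) measurable_const

lemma sum_equalShare_mul (H : S.State) (f : Mode Kbs Kmu → ℝ) {x : ℝ}
    (h : ∀ a ∈ bestModes π lam H, f a = x) : ∑ a, equalShare π lam H a * f a = x := by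
  have : ∀ a, equalShare π lam H a * f a = equalShare π lam H a * x := fun a => by
    unfold equalShare
    split_ifs with ha
    · rw [h a (mem_bestModes.2 ha)]
    · simp
  simp only [this]
  rw [← Finset.sum_mul, sum_equalShare, one_mul]

end DownlinkSystem

namespace DownlinkSystem

variable {Kbs Kmu : ℕ} {S : DownlinkSystem Kbs Kmu} [NeZero Kmu] {π : Equiv.Perm (Fin Kmu)}
  {lam : Fin Kmu → ℝ}

/-! ### Lagrangian duality -/

section Admissible
variable {p : S.Policy} (hp : p.Admissible)
include hp

omit [NeZero Kmu] in
lemma Policy.Admissible.aemeasurable_weight (a : Mode Kbs Kmu) :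
    AEMeasurable (fun H => p.weight H a) S.fadingLaw := by
  rcases a with L | x
  · exact hp.meas_φ L
  · exact hp.meas_q x.1 x.2

omit [NeZero Kmu] in
lemma Policy.Admissible.sum_weight : ∀ᵐ H ∂S.fadingLaw, ∑ a, p.weight H a = 1 := by
  filter_upwards [hp.prob] with H hH
  simpa only [Fintype.sum_sum_type, Fintype.sum_prod_type, Policy.weight] using hH

omit [NeZero Kmu] in
lemma Policy.Admissible.weight_nonneg : ∀ᵐ H ∂S.fadingLaw, ∀ a, 0 ≤ p.weight H a := by
  filter_upwards [hp.nonneg] with H hH a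
  rcases a with L | x
  · exact hH.1 L
  · exact hH.2.1 x.1 x.2

omit [NeZero Kmu] in
lemma Policy.Admissible.alloc_nonneg :
    ∀ᵐ H ∂S.fadingLaw, ∀ a n, 0 ≤ S.modeAlloc (p.pow H) a n := by
  filter_upwards [hp.nonneg] with H hH a n
  rcases a with L | x
  · exact hH.2.2 L n
  · simp only [modeAlloc, Pi.single_apply]
    split_ifs
    · exact totalPower_nonneg _
    · exact le_rfl

omit [NeZero Kmu] in
lemma Policy.Admissible.sum_alloc :
    ∀ᵐ H ∂S.fadingLaw, ∀ a, ∑ n, S.modeAlloc (p.pow H) a n = S.totalPower a.size := by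
  filter_upwards [hp.power] with H hH a
  rcases a with L | x
  · exact hH L
  · simp [modeAlloc, Mode.size]

lemma Policy.Admissible.aemeasurable_factor (a : Mode Kbs Kmu) (n : Fin Kmu) :
    AEMeasurable (fun H => p.factor π H a n) S.fadingLaw := by
  have hrate : AEMeasurable (fun H => modeRate π H a n (S.modeAlloc (p.pow H) a n))
      S.fadingLaw := by
    have halloc : AEMeasurable (fun H => S.modeAlloc (p.pow H) a n) S.fadingLaw := by
      rcases a with L | x
      · exact hp.meas_pow L n
      · exact aemeasurable_const
    refine ⟨fun H => modeRate π H a n (max (halloc.mk _ H) 0),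
      measurable_modeRate π a n (halloc.measurable_mk.max measurable_const)
        fun _ => le_max_right _ _, ?_⟩
    filter_upwards [halloc.ae_eq_mk, hp.alloc_nonneg] with H h1 h2
    rw [← h1, max_eq_left (h2 a n)]
  exact Real.measurable_exp.comp_aemeasurable (hrate.const_mul _)

omit hp in
lemma Policy.factor_mem (H : S.State) (a : Mode Kbs Kmu) (n : Fin Kmu) :
    0 < p.factor π H a n ∧ p.factor π H a n ≤ 1 := by
  refine ⟨Real.exp_pos _, Real.exp_le_one_iff.2 ?_⟩
  have h1 : 0 ≤ modeRate π H a n (S.modeAlloc (p.pow H) a n) := frozenRate_nonneg H _ _ n _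
  nlinarith [S.θ_pos n]

omit [NeZero Kmu] in
lemma Policy.Admissible.integrable_weight_mul {a : Mode Kbs Kmu} {f : S.State → ℝ}
    (hf : AEMeasurable f S.fadingLaw) {C : ℝ} (hC : ∀ H, |f H| ≤ C) :
    Integrable (fun H => p.weight H a * f H) S.fadingLaw := by
  refine Integrable.of_bound ((hp.aemeasurable_weight a).mul hf).aestronglyMeasurable C ?_
  filter_upwards [hp.sum_weight, hp.weight_nonneg] with H h1 h2
  have h3 : p.weight H a ≤ 1 := h1 ▸ Finset.single_le_sum (fun a _ => h2 a) (Finset.mem_univ a)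
  rw [Real.norm_eq_abs, abs_mul, abs_of_nonneg (h2 a)]
  calc p.weight H a * |f H| ≤ 1 * |f H| := by gcongr
    _ ≤ C := by rw [one_mul]; exact hC H

lemma Policy.Admissible.integrable_weight_mul_factor (a : Mode Kbs Kmu) (n : Fin Kmu) :
    Integrable (fun H => p.weight H a * p.factor π H a n) S.fadingLaw :=
  hp.integrable_weight_mul (hp.aemeasurable_factor a n) (C := 1) fun H => by
    rw [abs_of_pos (p.factor_mem H a n).1]; exact (p.factor_mem H a n).2

lemma Policy.Admissible.integrable_lagrangian :
    Integrable (fun H => ∑ a, p.weight H a * modePsi π lam H (p.pow H) a) S.fadingLaw := by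
  refine integrable_finsetSum _ fun a _ => ?_
  have : (fun H => p.weight H a * modePsi π lam H (p.pow H) a) = fun H =>
      p.weight H a * (a.size : ℝ) + ∑ n, lam n * (p.weight H a * p.factor π H a n) := by
    funext H
    rw [modePsi, mul_add, modeCost, weightedCost, Finset.mul_sum]
    congr 1
    exact Finset.sum_congr rfl fun n _ => mul_left_comm _ _ _
  rw [this]
  exact (hp.integrable_weight_mul aemeasurable_const fun _ => le_rfl).add
    (integrable_finsetSum _ fun n _ => (hp.integrable_weight_mul_factor a n).const_mul _)

/-- The Lagrangian of the problem is the expected value of the modes that are used. -/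
lemma Policy.Admissible.lagrangian_eq :
    p.usage + ∑ n, lam n * (p.qos π n + Real.exp (-S.θ n * S.Cbar n)) =
      ∫ H, ∑ a, p.weight H a * modePsi π lam H (p.pow H) a ∂S.fadingLaw := by
  simp only [Policy.usage_eq, Policy.qos_eq, sub_add_cancel]
  simp only [← integral_const_mul]
  have hi : ∀ a, Integrable (fun H => p.weight H a * (a.size : ℝ)) S.fadingLaw := fun a =>
    hp.integrable_weight_mul aemeasurable_const fun _ => le_rfl
  have hf : ∀ n, Integrable (fun H => lam n * ∑ a, p.weight H a * p.factor π H a n)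
      S.fadingLaw := fun n =>
    (integrable_finsetSum _ fun a _ => hp.integrable_weight_mul_factor a n).const_mul _
  rw [← integral_finsetSum _ fun n _ => hf n,
    ← integral_add (integrable_finsetSum _ fun a _ => hi a) (integrable_finsetSum _ fun n _ => hf n)]
  refine integral_congr_ae (Filter.Eventually.of_forall fun H => ?_)
  simp only [Finset.mul_sum]
  rw [Finset.sum_comm, ← Finset.sum_add_distrib]
  refine Finset.sum_congr rfl fun a _ => ?_
  rw [modePsi, mul_add, modeCost, weightedCost, Finset.mul_sum]
  congr 1
  exact Finset.sum_congr rfl fun n _ => mul_left_comm _ _ _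

end Admissible

lemma modeValue_le_modePsi (hl : ∀ n, 0 < lam n) {H : S.State} (hH : S.IsGood π H)
    {P : Fin (Kbs + 1) → Fin Kmu → ℝ} {a : Mode Kbs Kmu} (h : ∀ n, 0 ≤ S.modeAlloc P a n)
    (hsum : ∑ n, S.modeAlloc P a n = S.totalPower a.size) :
    modeValue π lam H a ≤ modePsi π lam H P a :=
  add_le_add_right ((modePower_spec (π := π) hl hH a).cost_le hl h hsum.le).1 _

/-- With optimal powers in the multi-user modes, the powers in all modes are optimal. -/
lemma modeAlloc_modePower (hl : ∀ n, 0 < lam n) {H : S.State} (hH : S.IsGood π H)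
    {P : Fin (Kbs + 1) → Fin Kmu → ℝ} (hP : ∀ L, P L = modePower π lam H (.inl L)) :
    S.modeAlloc P = modePower π lam H := by
  funext a
  rcases a with L | x
  · exact hP L
  · funext n
    rw [modePower_inr hl hH]
    simp [modeAlloc, Pi.single_apply]

lemma modePsi_modePower (hl : ∀ n, 0 < lam n) {H : S.State} (hH : S.IsGood π H)
    {P : Fin (Kbs + 1) → Fin Kmu → ℝ} (hP : ∀ L, P L = modePower π lam H (.inl L)) :
    modePsi π lam H P = modeValue π lam H := by
  funext a
  rw [modePsi, modeAlloc_modePower hl hH hP]; rfl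

variable [NeZero Kbs]

/-- The pointwise Lagrangian is at least the value of the best modes. -/
lemma Policy.Admissible.minValue_le_lagrangian (hl : ∀ n, 0 < lam n) {p : S.Policy}
    (hp : p.Admissible) :
    ∀ᵐ H ∂S.fadingLaw, (∀ a, 0 ≤ p.weight H a * (modePsi π lam H (p.pow H) a - minValue π lam H)) ∧
      ∑ a, p.weight H a * modePsi π lam H (p.pow H) a - minValue π lam H =
        ∑ a, p.weight H a * (modePsi π lam H (p.pow H) a - minValue π lam H) := by
  filter_upwards [hp.sum_weight, hp.weight_nonneg, hp.alloc_nonneg, hp.sum_alloc,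
    ae_isGood (S := S) π] with H h1 h2 h3 h4 hH
  refine ⟨fun a => mul_nonneg (h2 a) (sub_nonneg.2 ((minValue_le H a).trans
    (modeValue_le_modePsi hl hH (h3 a) (h4 a)))), ?_⟩
  simp only [mul_sub, Finset.sum_sub_distrib]
  rw [← Finset.sum_mul, h1, one_mul]

lemma psiStar_eq_minValue (hl : ∀ n, 0 < lam n) {H : S.State} (hH : S.IsGood π H)
    {P : Fin (Kbs + 1) → Fin Kmu → ℝ} (hP : ∀ L, P L = modePower π lam H (.inl L)) :
    S.psiStar π lam H P = minValue π lam H := by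
  have h := modePsi_modePower hl hH hP
  refine le_antisymm ?_ ?_
  · obtain ⟨a, ha⟩ := exists_minValue_eq (π := π) (lam := lam) H
    rw [← ha, ← h]; exact psiStar_le H P a
  · obtain ⟨a, ha⟩ := exists_psiStar_eq (π := π) (lam := lam) H P
    rw [ha, h]; exact minValue_le H a

lemma share_eq_equalShare (hl : ∀ n, 0 < lam n) {H : S.State} (hH : S.IsGood π H)
    {P : Fin (Kbs + 1) → Fin Kmu → ℝ} (hP : ∀ L, P L = modePower π lam H (.inl L))
    (a : Mode Kbs Kmu) [Decidable (modePsi π lam H P a = S.psiStar π lam H P)] :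
    (if modePsi π lam H P a = S.psiStar π lam H P
      then 1 / (S.minimizerCount π lam H P : ℝ) else 0) = equalShare π lam H a := by
  classical
  rw [minimizerCount_eq]
  simp only [psiStar_eq_minValue hl hH hP, modePsi_modePower hl hH hP, equalShare, bestModes]

section HasOptimalForm
variable {ζ : S.State → Fin (Kbs + 1) → ℝ} {p : S.Policy} (hp : p.HasOptimalForm π lam ζ)
include hp

lemma Policy.HasOptimalForm.pow_eq :
    ∀ᵐ H ∂S.fadingLaw, ∀ L, p.pow H L = modePower π lam H (.inl L) := by
  filter_upwards [hp.power, hp.zeta_pos, ae_isGood (S := S) π] with H h1 h2 hH L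
  exact eq_modePower_of_isModifiedWaterFilling hp.lam_pos hH (h2 L) (h1 L).1 (h1 L).2

lemma Policy.HasOptimalForm.weight_eq :
    ∀ᵐ H ∂S.fadingLaw, ∀ a, p.weight H a = equalShare π lam H a := by
  filter_upwards [hp.multi, hp.single, hp.pow_eq, ae_isGood (S := S) π] with H h1 h2 h3 hH a
  rcases a with L | ⟨l, n⟩
  · rw [← share_eq_equalShare hp.lam_pos hH h3]
    exact h1 L
  · rw [← share_eq_equalShare hp.lam_pos hH h3]
    simp only [← psiSingle_eq]
    exact h2 l n

lemma Policy.HasOptimalForm.admissible : p.Admissible where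
  meas_φ L := ⟨_, measurable_equalShare hp.lam_pos (.inl L), by
    filter_upwards [hp.weight_eq] with H hH using hH (.inl L)⟩
  meas_q l n := ⟨_, measurable_equalShare hp.lam_pos (.inr (l, n)), by
    filter_upwards [hp.weight_eq] with H hH using hH (.inr (l, n))⟩
  meas_pow L n := ⟨_, measurable_modePower hp.lam_pos (.inl L) n, by
    filter_upwards [hp.pow_eq] with H hH using congrFun (hH L) n⟩
  nonneg := by
    filter_upwards [hp.weight_eq, hp.pow_eq] with H h1 h2
    refine ⟨fun L => ?_, fun l n => ?_, fun L n => ?_⟩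
    · exact (equalShare_nonneg (π := π) H (.inl L)).trans_eq (h1 (.inl L)).symm
    · exact (equalShare_nonneg (π := π) H (.inr (l, n))).trans_eq (h1 (.inr (l, n))).symm
    · rw [h2]; exact modePower_nonneg H _ n
  prob := by
    filter_upwards [hp.weight_eq] with H h1
    have h2 := sum_equalShare (π := π) (lam := lam) H
    simp only [← h1, Fintype.sum_sum_type, Fintype.sum_prod_type] at h2
    exact h2
  power := by
    filter_upwards [hp.power] with H h1 L using (h1 L).2

lemma Policy.HasOptimalForm.lagrangian_eq :
    ∀ᵐ H ∂S.fadingLaw,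
      ∑ a, p.weight H a * modePsi π lam H (p.pow H) a = minValue π lam H := by
  filter_upwards [hp.weight_eq, hp.pow_eq, ae_isGood (S := S) π] with H h1 h2 hH
  simp only [h1, modePsi_modePower hp.lam_pos hH h2]
  exact sum_equalShare_mul H _ fun a ha => mem_bestModes.1 ha

lemma Policy.HasOptimalForm.integrable_minValue :
    Integrable (fun H => minValue π lam H) S.fadingLaw :=
  hp.admissible.integrable_lagrangian.congr hp.lagrangian_eq

lemma Policy.HasOptimalForm.usage_eq_dual :
    p.usage + ∑ n, lam n * Real.exp (-S.θ n * S.Cbar n) = ∫ H, minValue π lam H ∂S.fadingLaw := by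
  have h := hp.admissible.lagrangian_eq (π := π) (lam := lam)
  simp only [hp.qos_eq, zero_add] at h
  rw [h]
  exact integral_congr_ae hp.lagrangian_eq

/-- Weak duality, with the duality gap of an admissible policy as an integral. -/
lemma Policy.HasOptimalForm.duality {p' : S.Policy} (hp' : p'.Admissible) :
    p'.usage - p.usage + ∑ n, lam n * p'.qos π n =
      ∫ H, (∑ a, p'.weight H a * modePsi π lam H (p'.pow H) a - minValue π lam H)
        ∂S.fadingLaw := by
  rw [integral_sub hp'.integrable_lagrangian hp.integrable_minValue, ← hp'.lagrangian_eq,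
    ← hp.usage_eq_dual]
  simp only [mul_add, Finset.sum_add_distrib]
  ring

lemma Policy.HasOptimalForm.gap_nonneg {p' : S.Policy} (hp' : p'.Admissible) :
    0 ≤ᵐ[S.fadingLaw] fun H =>
      ∑ a, p'.weight H a * modePsi π lam H (p'.pow H) a - minValue π lam H := by
  filter_upwards [hp'.minValue_le_lagrangian (π := π) hp.lam_pos] with H h
  rw [Pi.zero_apply, h.2]
  exact Finset.sum_nonneg fun a _ => h.1 a

theorem Policy.HasOptimalForm.isOptimal : p.IsOptimal π := by
  refine ⟨⟨hp.admissible, fun n => (hp.qos_eq n).le⟩, fun p' hp' => ?_⟩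
  have h1 := hp.duality hp'.1
  have h2 := integral_nonneg_of_ae (hp.gap_nonneg hp'.1)
  have h3 : ∑ n, lam n * p'.qos π n ≤ 0 := Finset.sum_nonpos fun n _ =>
    mul_nonpos_of_nonneg_of_nonpos (hp.lam_pos n).le (hp'.2 n)
  linarith

/-- Every optimal policy closes the duality gap: its constraints are tight, it uses only best
modes, and its powers in the multi-user modes that it uses are optimal. -/
theorem Policy.HasOptimalForm.of_isOptimal {p' : S.Policy} (hp' : p'.IsOptimal π) :
    (∀ n, p'.qos π n = 0) ∧
    ∀ᵐ H ∂S.fadingLaw,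
      (∀ L, 0 < p'.φ H L →
        S.psiMulti π lam H (p.pow H) L = S.psiStar π lam H (p.pow H) ∧
        p'.pow H L = p.pow H L) ∧
      (∀ l n, 0 < p'.q H l n →
        S.psiSingle lam H l n = S.psiStar π lam H (p.pow H)) := by
  have h1 := hp.duality hp'.1.1
  have hgap := hp.gap_nonneg hp'.1.1
  have h2 := integral_nonneg_of_ae hgap
  have h3 := hp'.2 p hp.isOptimal.1
  have hterm : ∀ n, lam n * p'.qos π n ≤ 0 := fun n =>
    mul_nonpos_of_nonneg_of_nonpos (hp.lam_pos n).le (hp'.1.2 n)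
  have h4 : ∑ n, lam n * p'.qos π n ≤ 0 := Finset.sum_nonpos fun n _ => hterm n
  have h5 : ∑ n, lam n * p'.qos π n = 0 := by linarith
  refine ⟨fun n => ?_, ?_⟩
  · have := (Finset.sum_eq_zero_iff_of_nonpos fun n _ => hterm n).1 h5 n (Finset.mem_univ n)
    exact (mul_eq_zero.1 this).resolve_left (hp.lam_pos n).ne'
  have h6 : ∫ H, (∑ a, p'.weight H a * modePsi π lam H (p'.pow H) a - minValue π lam H)
      ∂S.fadingLaw = 0 := by linarith
  rw [integral_eq_zero_iff_of_nonneg_ae hgap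
    (hp'.1.1.integrable_lagrangian.sub hp.integrable_minValue)] at h6
  filter_upwards [h6, hp'.1.1.minValue_le_lagrangian (π := π) hp.lam_pos, hp.pow_eq,
    ae_isGood (S := S) π, hp'.1.1.alloc_nonneg, hp'.1.1.sum_alloc] with H h7 h8 hpow hH h9 h10
  rw [Pi.zero_apply, h8.2, Finset.sum_eq_zero_iff_of_nonneg fun a _ => h8.1 a] at h7
  have key : ∀ a, 0 < p'.weight H a → modeValue π lam H a = minValue π lam H ∧
      S.modeAlloc (p'.pow H) a = modePower π lam H a := by
    intro a ha
    have h11 : modePsi π lam H (p'.pow H) a = minValue π lam H :=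
      sub_eq_zero.1 ((mul_eq_zero.1 (h7 a (Finset.mem_univ a))).resolve_left ha.ne')
    have h12 := modeValue_le_modePsi (π := π) hp.lam_pos hH (h9 a) (h10 a)
    have h13 := minValue_le (π := π) (lam := lam) H a
    refine ⟨by linarith, (modePower_spec (π := π) hp.lam_pos hH a).unique hp.lam_pos (h9 a)
      (h10 a) ?_⟩
    have h14 : modePsi π lam H (p'.pow H) a ≤ modeValue π lam H a := by linarith
    exact (add_le_add_iff_left _).1 h14
  refine ⟨fun L hL => ?_, fun l n hq => ?_⟩
  · obtain ⟨e1, e2⟩ := key (.inl L) hL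
    rw [psiStar_eq_minValue hp.lam_pos hH hpow, psiMulti_eq,
      modePsi_modePower hp.lam_pos hH hpow, hpow L]
    exact ⟨e1, e2⟩
  · rw [psiStar_eq_minValue hp.lam_pos hH hpow, psiSingle_eq H (p.pow H) l n,
      modePsi_modePower hp.lam_pos hH hpow]
    exact (key (.inr (l, n)) hq).1

end HasOptimalForm

end DownlinkSystem

/-! ### Small multipliers -/

namespace Subchannels

/-- The multiplier `ζ` is bounded below when a user with a multiplier of at least `κ` gets power. -/
lemma exists_pos_le_zeta (s : Subchannels) {β : ℝ} (hβ : 0 < β) (x : ℝ) {κ : ℝ} (hκ : 0 < κ) :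
    ∃ z, 0 < z ∧ ∀ lam ζ μ, κ ≤ lam → s.IsLevel β lam ζ μ → 0 < s.power μ → s.power μ ≤ x →
      z ≤ ζ := by
  by_cases hs : s.idx.Nonempty
  · obtain ⟨M, hM, hxM⟩ := s.exists_lt_power hs x
    refine ⟨κ * β * Real.exp (-(β * s.logGain M)) / M, by positivity,
      fun lam ζ μ hl h _ hle => ?_⟩
    have hμM : μ ≤ M := by
      by_contra hlt
      exact absurd (s.power_mono (not_le.1 hlt).le) (not_le.2 (hle.trans_lt hxM))
    have h1 := s.logGain_mono h.pos hμM
    have h2 : Real.exp (-(β * s.logGain M)) ≤ Real.exp (-(β * s.logGain μ)) :=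
      Real.exp_le_exp.2 (neg_le_neg (mul_le_mul_of_nonneg_left h1 hβ.le))
    have h3 : κ * β * Real.exp (-(β * s.logGain M)) ≤ lam * β * Real.exp (-(β * s.logGain μ)) := by
      gcongr
      exact mul_nonneg (hκ.trans_le hl).le hβ.le
    rw [h.eq] at h3
    have hζ : 0 < ζ := pos_of_mul_pos_left
      ((by positivity : (0 : ℝ) < κ * β * Real.exp (-(β * s.logGain M))).trans_le h3) h.pos.le
    rw [div_le_iff₀ hM]
    exact h3.trans (mul_le_mul_of_nonneg_left hμM hζ.le)
  · exact ⟨1, one_pos, fun lam ζ μ _ _ h _ => absurd (s.idx_nonempty_of_power_pos h) hs⟩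

/-- A user whose multiplier is small compared with `ζ` gets no power. -/
lemma eventually_power_eq_zero (s : Subchannels) {β : ℝ} (hβ : 0 < β) {z : ℝ} (hz : 0 < z) :
    ∀ᶠ l in nhdsWithin (0 : ℝ) (Set.Ioi 0), ∀ ζ μ, z ≤ ζ → s.IsLevel β l ζ μ →
      s.power μ = 0 := by
  obtain ⟨m, hm, hm'⟩ := s.exists_logGain_eq_zero
  have hlt : ∀ᶠ l in nhdsWithin (0 : ℝ) (Set.Ioi 0), l < z * m / β :=
    (Filter.eventually_of_mem (Iio_mem_nhds (by positivity)) fun _ h => h).filter_mono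
      nhdsWithin_le_nhds
  filter_upwards [hlt, self_mem_nhdsWithin] with l hl hl0 ζ μ hζ h
  have hl0 : 0 < l := hl0
  refine (hm' μ h.pos ?_).2
  rw [lt_div_iff₀ hβ] at hl
  have h1 : l * β * Real.exp (-(β * s.logGain μ)) ≤ l * β * 1 := by
    gcongr
    exact Real.exp_le_one_iff.2 (neg_nonpos.2 (mul_nonneg hβ.le (s.logGain_nonneg μ)))
  rw [h.eq] at h1
  have h2 : z * μ ≤ ζ * μ := mul_le_mul_of_nonneg_right hζ h.pos.le
  exact le_of_mul_le_mul_left (by linarith) hz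

end Subchannels

namespace DownlinkSystem

variable {Kbs Kmu : ℕ} {S : DownlinkSystem Kbs Kmu} [NeZero Kmu] {π : Equiv.Perm (Fin Kmu)}
  {lam lam' : Fin Kmu → ℝ}

lemma modeFactor_pos (H : S.State) (a : Mode Kbs Kmu) (n : Fin Kmu) :
    0 < modeFactor π lam H a n := Real.exp_pos _

lemma modeFactor_le_one (H : S.State) (a : Mode Kbs Kmu) (n : Fin Kmu) :
    modeFactor π lam H a n ≤ 1 := by
  refine Real.exp_le_one_iff.2 ?_
  have h1 : 0 ≤ modeRate π H a n (modePower π lam H a n) := frozenRate_nonneg H _ _ n _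
  nlinarith [S.θ_pos n]

variable (Kbs Kmu) in
/-- The mode without transmission. -/
def idleMode : Mode Kbs Kmu := .inl 0

lemma modePower_eq_zero_of_size (hl : ∀ n, 0 < lam n) {H : S.State} (hH : S.IsGood π H)
    {a : Mode Kbs Kmu} (ha : a.size = 0) (n : Fin Kmu) : modePower π lam H a n = 0 := by
  have h := (modePower_spec (π := π) hl hH a).sum_eq
  rw [ha, totalPower, if_pos rfl,
    Finset.sum_eq_zero_iff_of_nonneg fun n _ => modePower_nonneg H a n] at h
  exact h n (Finset.mem_univ n)

lemma modeValue_idleMode_le (hl : ∀ n, 0 < lam n) (H : S.State) :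
    modeValue π lam H (idleMode Kbs Kmu) ≤ ∑ n, lam n := by
  rw [modeValue, modeCost_eq]
  have : ((Mode.size (idleMode Kbs Kmu) : ℕ) : ℝ) = 0 := by simp [idleMode, Mode.size]
  rw [this, zero_add]
  exact Finset.sum_le_sum fun n _ => mul_le_of_le_one_right (hl n).le (modeFactor_le_one H _ n)

lemma modeValue_nonneg (hl : ∀ n, 0 < lam n) (H : S.State) (a : Mode Kbs Kmu) :
    0 ≤ modeValue π lam H a := add_nonneg (Nat.cast_nonneg _) (modeCost_nonneg hl H a _)

variable [NeZero Kbs]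

/-- A user with a small multiplier is not served in a best mode: the best mode costs at most as
much as silence, so another user with a substantial multiplier is served, and this bounds the
price `ζ` of the power from below. -/
lemma eventually_modeFactor_eq_one {H : S.State} (hH : S.IsGood π H) (n : Fin Kmu) :
    ∀ᶠ x in nhdsWithin (0 : ℝ) (Set.Ioi 0), ∀ lam : Fin Kmu → ℝ, (∀ j, 0 < lam j) → lam n = x →
      ∀ a ∈ bestModes π lam H, modeFactor π lam H a n = 1 := by
  have hK : (0 : ℝ) < Kmu := by exact_mod_cast Nat.pos_of_ne_zero (NeZero.ne Kmu)
  have hκ : (0 : ℝ) < 1 / (2 * Kmu) := by positivity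
  choose z hz hz' using fun (a : Mode Kbs Kmu) (j : Fin Kmu) =>
    (modeSub π H a j).exists_pos_le_zeta (S.beta_pos j) (S.totalPower a.size) hκ
  have hev : ∀ᶠ x in nhdsWithin (0 : ℝ) (Set.Ioi 0), ∀ (a : Mode Kbs Kmu) (j : Fin Kmu),
      ∀ ζ μ, z a j ≤ ζ → (modeSub π H a n).IsLevel (S.beta n) x ζ μ →
        (modeSub π H a n).power μ = 0 :=
    Filter.eventually_all.2 fun a => Filter.eventually_all.2 fun j =>
      (modeSub π H a n).eventually_power_eq_zero (S.beta_pos n) (hz a j)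
  have hhalf : ∀ᶠ x in nhdsWithin (0 : ℝ) (Set.Ioi 0), x < 1 / 2 :=
    (Filter.eventually_of_mem (Iio_mem_nhds (by norm_num)) fun _ h => h).filter_mono
      nhdsWithin_le_nhds
  filter_upwards [hev, hhalf] with x hx hx2 lam hl hn a ha
  by_cases ha0 : a.size = 0
  · exact modeFactor_eq_one (modePower_eq_zero_of_size hl hH ha0 n)
  obtain ⟨ζ, hP, hsum⟩ := modePower_spec (π := π) hl hH a
  have hone : (1 : ℝ) ≤ a.size := by exact_mod_cast Nat.one_le_iff_ne_zero.2 ha0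
  have hval : (a.size : ℝ) + ∑ j, lam j * modeFactor π lam H a j ≤ ∑ j, lam j := by
    have h1 := mem_bestModes.1 ha
    have h2 := minValue_le (π := π) (lam := lam) H (idleMode Kbs Kmu)
    have h3 := modeValue_idleMode_le (π := π) hl H
    rw [modeValue, modeCost_eq] at h1
    linarith
  -- the mode saves at least `1` over silence, less than half of which is due to user `n`
  obtain ⟨j, hj, hjκ⟩ : ∃ j, j ≠ n ∧ 1 / (2 * Kmu) ≤ lam j * (1 - modeFactor π lam H a j) := by
    by_contra hno
    push Not at hno
    have h1 : ∑ j, lam j * (1 - modeFactor π lam H a j) <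
        ∑ j, ((if j = n then 1 / 2 else 0) + 1 / (2 * (Kmu : ℝ))) := by
      refine Finset.sum_lt_sum_of_nonempty Finset.univ_nonempty fun j _ => ?_
      by_cases hj : j = n
      · rw [if_pos hj, hj, hn]
        have h2 := modeFactor_pos (π := π) (lam := lam) H a n
        have h3 := hl n
        rw [hn] at h3
        nlinarith
      · rw [if_neg hj, zero_add]
        exact hno j hj
    rw [Finset.sum_add_distrib, Finset.sum_ite_eq' Finset.univ n, if_pos (Finset.mem_univ n),
      Finset.sum_const, Finset.card_univ, Fintype.card_fin, nsmul_eq_mul] at h1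
    simp only [mul_sub, mul_one, Finset.sum_sub_distrib] at h1
    have h4 : (Kmu : ℝ) * (1 / (2 * Kmu)) = 1 / 2 := by field_simp
    linarith
  have hfj := modeFactor_pos (π := π) (lam := lam) H a j
  have hlj : 1 / (2 * (Kmu : ℝ)) ≤ lam j := hjκ.trans (by nlinarith [hl j])
  have hPj : 0 < modePower π lam H a j := by
    refine lt_of_le_of_ne (modePower_nonneg H a j) fun h0 => ?_
    rw [modeFactor_eq_one h0.symm] at hjκ
    linarith
  obtain ⟨μ, hμ, hμP⟩ := hP.level j
  obtain ⟨μn, hμn, hμnP⟩ := hP.level n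
  have hζ := hz' a j (lam j) ζ μ hlj hμ (hμP ▸ hPj) (by
    rw [← hμP, ← hsum]
    exact Finset.single_le_sum (fun n _ => modePower_nonneg H a n) (Finset.mem_univ j))
  rw [hn] at hμn
  exact modeFactor_eq_one (hμnP.trans (hx a j ζ μn hζ hμn))

/-! ### The dual function -/

variable (π) in
/-- The factor of user `n` averaged uniformly over the best modes. -/
def avgFactor (lam : Fin Kmu → ℝ) (H : S.State) (n : Fin Kmu) : ℝ :=
  ∑ a, equalShare π lam H a * modeFactor π lam H a n

lemma avgFactor_mem (H : S.State) (n : Fin Kmu) :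
    0 ≤ avgFactor π lam H n ∧ avgFactor π lam H n ≤ 1 := by
  refine ⟨Finset.sum_nonneg fun a _ => mul_nonneg (equalShare_nonneg H a) (modeFactor_pos H a n).le,
    ?_⟩
  rw [← sum_equalShare (π := π) (lam := lam) H]
  exact Finset.sum_le_sum fun a _ => mul_le_of_le_one_right (equalShare_nonneg H a)
    (modeFactor_le_one H a n)

lemma measurable_avgFactor (hl : ∀ n, 0 < lam n) (n : Fin Kmu) :
    Measurable fun H : S.State => avgFactor π lam H n :=
  Finset.measurable_fun_sum _ fun a _ =>
    (measurable_equalShare hl a).mul (measurable_modeFactor hl a n)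

lemma integrable_avgFactor (hl : ∀ n, 0 < lam n) (n : Fin Kmu) :
    Integrable (fun H : S.State => avgFactor π lam H n) S.fadingLaw :=
  Integrable.of_bound (measurable_avgFactor hl n).aestronglyMeasurable 1
    (Filter.Eventually.of_forall fun H => by
      rw [Real.norm_eq_abs, abs_of_nonneg (avgFactor_mem H n).1]; exact (avgFactor_mem H n).2)

lemma integrable_minValue (hl : ∀ n, 0 < lam n) :
    Integrable (fun H : S.State => minValue π lam H) S.fadingLaw :=
  Integrable.of_bound (measurable_minValue hl).aestronglyMeasurable (∑ n, lam n)
    (Filter.Eventually.of_forall fun H => by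
      have h0 : 0 ≤ minValue π lam H := by
        obtain ⟨a, ha⟩ := exists_minValue_eq (π := π) (lam := lam) H
        rw [← ha]; exact modeValue_nonneg hl H a
      rw [Real.norm_eq_abs, abs_of_nonneg h0]
      exact (minValue_le H _).trans (modeValue_idleMode_le hl H))

omit [NeZero Kbs] in
lemma modeValue_le_add (hl : ∀ n, 0 < lam n) (hl' : ∀ n, 0 < lam' n) {H : S.State}
    (hH : S.IsGood π H) (a : Mode Kbs Kmu) :
    modeValue π lam' H a ≤
      modeValue π lam H a + ∑ n, (lam' n - lam n) * modeFactor π lam H a n := by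
  have hP := modePower_spec (π := π) hl hH a
  have h := ((modePower_spec (π := π) hl' hH a).cost_le hl' hP.nonneg hP.sum_eq.le).1
  have h2 : modeCost π lam' H a (modePower π lam H a) = modeCost π lam H a (modePower π lam H a) +
      ∑ n, (lam' n - lam n) * modeFactor π lam H a n := by
    rw [modeCost_eq, ← Finset.sum_add_distrib, modeCost, weightedCost]
    refine Finset.sum_congr rfl fun n _ => ?_
    rw [modeFactor]
    ring
  rw [h2] at h
  unfold modeValue
  linarith

/-- The mean factors are a supergradient of the least value as a function of the multipliers. -/
lemma minValue_le_add (hl : ∀ n, 0 < lam n) (hl' : ∀ n, 0 < lam' n) {H : S.State}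
    (hH : S.IsGood π H) :
    minValue π lam' H ≤ minValue π lam H + ∑ n, (lam' n - lam n) * avgFactor π lam H n := by
  have h1 : ∑ a, equalShare π lam H a * (modeValue π lam H a +
      ∑ n, (lam' n - lam n) * modeFactor π lam H a n) =
      minValue π lam H + ∑ n, (lam' n - lam n) * avgFactor π lam H n := by
    simp only [mul_add, Finset.sum_add_distrib]
    congr 1
    · exact sum_equalShare_mul H _ fun a ha => mem_bestModes.1 ha
    · simp only [avgFactor, Finset.mul_sum]
      rw [Finset.sum_comm]
      exact Finset.sum_congr rfl fun n _ => Finset.sum_congr rfl fun a _ => mul_left_comm _ _ _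
  rw [← h1, ← one_mul (minValue π lam' H), ← sum_equalShare (π := π) (lam := lam) H,
    Finset.sum_mul]
  exact Finset.sum_le_sum fun a _ => mul_le_mul_of_nonneg_left
    ((minValue_le H a).trans (modeValue_le_add hl hl' hH a)) (equalShare_nonneg H a)

variable (S) in
/-- The factor that the effective-capacity constraint of user `n` requires. -/
def target (n : Fin Kmu) : ℝ := Real.exp (-S.θ n * S.Cbar n)

omit [NeZero Kbs] [NeZero Kmu] in
lemma target_lt_one (n : Fin Kmu) : S.target n < 1 :=
  Real.exp_lt_one_iff.2 (by nlinarith [mul_pos (S.θ_pos n) (S.Cbar_pos n)])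

variable (S π) in
/-- The dual function: the infimum of the Lagrangian over the admissible policies. Only positive
multipliers matter. -/
def dual (lam : Fin Kmu → ℝ) : ℝ :=
  ∫ H, minValue π lam H ∂S.fadingLaw - ∑ n, lam n * S.target n

variable (S π) in
/-- The expectation of the factor of user `n` under an equal share of the best modes. -/
def meanFactor (lam : Fin Kmu → ℝ) (n : Fin Kmu) : ℝ := ∫ H, avgFactor π lam H n ∂S.fadingLaw

lemma dual_le_add (hl : ∀ n, 0 < lam n) (hl' : ∀ n, 0 < lam' n) :
    S.dual π lam' ≤ S.dual π lam +
      ∑ n, (lam' n - lam n) * (S.meanFactor π lam n - S.target n) := by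
  have h1 : ∫ H, minValue π lam' H ∂S.fadingLaw ≤
      ∫ H, (minValue π lam H + ∑ n, (lam' n - lam n) * avgFactor π lam H n) ∂S.fadingLaw := by
    refine integral_mono_ae (integrable_minValue hl') ((integrable_minValue hl).add
      (integrable_finsetSum _ fun n _ => (integrable_avgFactor hl n).const_mul _)) ?_
    filter_upwards [ae_isGood (S := S) π] with H hH using minValue_le_add hl hl' hH
  rw [integral_add (integrable_minValue hl)
    (integrable_finsetSum _ fun n _ => (integrable_avgFactor hl n).const_mul _),
    integral_finsetSum _ fun n _ => (integrable_avgFactor hl n).const_mul _] at h1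
  simp only [integral_const_mul] at h1
  unfold dual meanFactor
  have h2 : ∑ n, (lam' n - lam n) * (∫ H, avgFactor π lam H n ∂S.fadingLaw - S.target n) =
      ∑ n, (lam' n - lam n) * ∫ H, avgFactor π lam H n ∂S.fadingLaw -
      (∑ n, lam' n * S.target n - ∑ n, lam n * S.target n) := by
    rw [← Finset.sum_sub_distrib, ← Finset.sum_sub_distrib]
    exact Finset.sum_congr rfl fun n _ => by ring
  rw [h2]
  linarith

lemma meanFactor_mem (hl : ∀ n, 0 < lam n) (n : Fin Kmu) :
    0 ≤ S.meanFactor π lam n ∧ S.meanFactor π lam n ≤ 1 := by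
  refine ⟨integral_nonneg fun H => (avgFactor_mem H n).1, ?_⟩
  have := integral_mono (integrable_avgFactor (π := π) hl n) (integrable_const (μ := S.fadingLaw) 1)
    fun H => (avgFactor_mem H n).2
  simpa [meanFactor] using this

lemma abs_dual_sub_le (hl : ∀ n, 0 < lam n) (hl' : ∀ n, 0 < lam' n) :
    |S.dual π lam' - S.dual π lam| ≤ ∑ n, |lam' n - lam n| := by
  have key : ∀ {lam lam' : Fin Kmu → ℝ}, (∀ n, 0 < lam n) → (∀ n, 0 < lam' n) →
      S.dual π lam' - S.dual π lam ≤ ∑ n, |lam' n - lam n| := by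
    intro lam lam' hl hl'
    have h1 := dual_le_add (S := S) (π := π) hl hl'
    have h2 : ∑ n, (lam' n - lam n) * (S.meanFactor π lam n - S.target n) ≤
        ∑ n, |lam' n - lam n| := by
      refine Finset.sum_le_sum fun n _ => (le_abs_self _).trans ?_
      rw [abs_mul]
      refine mul_le_of_le_one_right (abs_nonneg _) (abs_le.2 ?_)
      have h3 := meanFactor_mem (S := S) (π := π) hl n
      have h4 := S.target_lt_one n
      have h5 : 0 < S.target n := Real.exp_pos _
      constructor <;> linarith
    linarith
  refine abs_sub_le_iff.2 ⟨key hl hl', ?_⟩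
  simpa only [abs_sub_comm] using key hl' hl

end DownlinkSystem

namespace DownlinkSystem

variable {Kbs Kmu : ℕ} {S : DownlinkSystem Kbs Kmu} [NeZero Kmu] {π : Equiv.Perm (Fin Kmu)}
  {lam : Fin Kmu → ℝ}

/-! ### Continuity in the multipliers -/

section Limit
variable {κ : Type*} {l : Filter κ} {lams : κ → Fin Kmu → ℝ} (hl : ∀ n, 0 < lam n)
  (hls : ∀ k n, 0 < lams k n) (hlim : ∀ n, Filter.Tendsto (fun k => lams k n) l (nhds (lam n)))
include hl hls hlim

omit [NeZero Kmu] hl hls in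
lemma tendsto_sum_abs_sub (f : κ → Fin Kmu → ℝ) (hf : ∀ k n, |f k n| ≤ 1) :
    Filter.Tendsto (fun k => ∑ n, (lams k n - lam n) * f k n) l (nhds 0) := by
  have h0 : (0 : ℝ) = ∑ _n : Fin Kmu, 0 := by simp
  rw [h0]
  refine tendsto_finsetSum _ fun n _ => ?_
  have h1 : Filter.Tendsto (fun k => |lams k n - lam n|) l (nhds 0) := by
    simpa using ((hlim n).sub_const (lam n)).abs
  refine squeeze_zero_norm (fun k => ?_) h1
  rw [Real.norm_eq_abs, abs_mul]
  exact mul_le_of_le_one_right (abs_nonneg _) (hf k n)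

lemma tendsto_modeValue {H : S.State} (hH : S.IsGood π H) (a : Mode Kbs Kmu) :
    Filter.Tendsto (fun k => modeValue π (lams k) H a) l (nhds (modeValue π lam H a)) := by
  have hf : ∀ (lam : Fin Kmu → ℝ) n, |modeFactor π lam H a n| ≤ 1 := fun lam n => by
    rw [abs_of_pos (modeFactor_pos H a n)]; exact modeFactor_le_one H a n
  have h1 := tendsto_sum_abs_sub hlim (fun k => modeFactor π (lams k) H a) fun k n => hf _ n
  have h2 := tendsto_sum_abs_sub hlim (fun k => modeFactor π lam H a) fun k n => hf _ n
  refine tendsto_of_tendsto_of_tendsto_of_le_of_le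
    (by simpa using h1.const_add (modeValue π lam H a))
    (by simpa using h2.const_add (modeValue π lam H a)) (fun k => ?_) fun k => ?_
  · have h3 := modeValue_le_add (hls k) hl hH a
    have h4 : ∑ n, (lam n - lams k n) * modeFactor π (lams k) H a n =
        -∑ n, (lams k n - lam n) * modeFactor π (lams k) H a n := by
      rw [← Finset.sum_neg_distrib]
      exact Finset.sum_congr rfl fun n _ => by ring
    rw [h4] at h3
    dsimp only
    linarith
  · exact modeValue_le_add hl (hls k) hH a

lemma tendsto_modeFactor {H : S.State} (hH : S.IsGood π H) (a : Mode Kbs Kmu) (n : Fin Kmu) :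
    Filter.Tendsto (fun k => modeFactor π (lams k) H a n) l (nhds (modeFactor π lam H a n)) := by
  have hP := fun k => modePower_spec (π := π) (hls k) hH a
  refine ((modePower_spec (π := π) hl hH a).tendsto hl (fun k => (hP k).nonneg)
    (fun k => (hP k).sum_eq) ?_ n).2
  have h1 := tendsto_sum_abs_sub hlim (fun k => modeFactor π (lams k) H a) fun k n => by
    rw [abs_of_pos (modeFactor_pos H a n)]; exact modeFactor_le_one H a n
  have h2 := ((tendsto_modeValue hl hls hlim hH a).sub_const (a.size : ℝ)).sub h1
  have h3 : modeValue π lam H a - a.size - 0 = modeCost π lam H a (modePower π lam H a) := by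
    rw [modeValue]; ring
  rw [h3] at h2
  refine h2.congr fun k => ?_
  rw [modeValue, modeCost_eq, modeCost, weightedCost, add_sub_cancel_left,
    ← Finset.sum_sub_distrib]
  refine Finset.sum_congr rfl fun n _ => ?_
  rw [modeFactor]
  ring

variable [NeZero Kbs]

/-- When ties are harmless, the mean factors depend continuously on the multipliers. -/
lemma tendsto_avgFactor {H : S.State} (hH : S.IsGood π H)
    (htie : ∀ a b : Mode Kbs Kmu, modeValue π lam H a = modeValue π lam H b →
      modeFactor π lam H a = modeFactor π lam H b) (n : Fin Kmu) :
    Filter.Tendsto (fun k => avgFactor π (lams k) H n) l (nhds (avgFactor π lam H n)) := by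
  obtain ⟨b, hb⟩ := exists_minValue_eq (π := π) (lam := lam) H
  have havg : avgFactor π lam H n = modeFactor π lam H b n :=
    sum_equalShare_mul H _ fun a ha => by rw [htie a b ((mem_bestModes.1 ha).trans hb.symm)]
  rw [havg, ← sub_zero (modeFactor π lam H b n)]
  have hterm : ∀ a, Filter.Tendsto (fun k => equalShare π (lams k) H a *
      (modeFactor π (lams k) H a n - modeFactor π lam H b n)) l (nhds 0) := by
    intro a
    by_cases ha : modeValue π lam H a = minValue π lam H
    · have h1 := ((tendsto_modeFactor hl hls hlim hH a n).sub_const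
        (modeFactor π lam H b n)).abs
      rw [htie a b (ha.trans hb.symm), sub_self, abs_zero] at h1
      refine squeeze_zero_norm (fun k => ?_) h1
      rw [Real.norm_eq_abs, abs_mul, abs_of_nonneg (equalShare_nonneg H a)]
      refine mul_le_of_le_one_left (abs_nonneg _) ?_
      rw [← sum_equalShare (π := π) (lam := lams k) H]
      exact Finset.single_le_sum (fun a _ => equalShare_nonneg H a) (Finset.mem_univ a)
    · have hlt : modeValue π lam H b < modeValue π lam H a :=
        hb ▸ lt_of_le_of_ne (minValue_le H a) (Ne.symm ha)
      refine tendsto_const_nhds.congr' ?_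
      filter_upwards [(tendsto_modeValue hl hls hlim hH b).eventually_lt
        (tendsto_modeValue hl hls hlim hH a) hlt] with k hk
      have : equalShare π (lams k) H a = 0 :=
        if_neg fun h => absurd (h ▸ minValue_le H b) (not_le.2 hk)
      rw [this, zero_mul]
  have hsum := (tendsto_finsetSum (Finset.univ : Finset (Mode Kbs Kmu)) fun a _ => hterm a).const_add
    (modeFactor π lam H b n)
  simp only [Finset.sum_const_zero, add_zero] at hsum
  rw [sub_zero]
  refine hsum.congr fun k => ?_
  simp only [mul_sub, Finset.sum_sub_distrib]
  rw [← Finset.sum_mul, sum_equalShare, avgFactor]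
  ring

lemma tendsto_meanFactor [l.IsCountablyGenerated] (n : Fin Kmu) :
    Filter.Tendsto (fun k => S.meanFactor π (lams k) n) l (nhds (S.meanFactor π lam n)) := by
  refine tendsto_integral_filter_of_dominated_convergence (fun _ => 1)
    (Filter.Eventually.of_forall fun k =>
      (measurable_avgFactor (hls k) n).aestronglyMeasurable)
    (Filter.Eventually.of_forall fun k => Filter.Eventually.of_forall fun H => ?_)
    (integrable_const _) ?_
  · rw [Real.norm_eq_abs, abs_of_nonneg (avgFactor_mem H n).1]
    exact (avgFactor_mem H n).2
  · filter_upwards [ae_isGood (S := S) π, ae_factor_eq_of_tie (π := π) hl] with H hH htie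
    exact tendsto_avgFactor hl hls hlim hH htie n

end Limit

variable [NeZero Kbs]

/-- When the multiplier of a user tends to zero, that user is eventually not served. -/
lemma tendsto_meanFactor_of_tendsto_zero {lams : ℕ → Fin Kmu → ℝ} (hls : ∀ k n, 0 < lams k n)
    {n : Fin Kmu} (h0 : Filter.Tendsto (fun k => lams k n) Filter.atTop (nhds 0)) :
    Filter.Tendsto (fun k => S.meanFactor π (lams k) n) Filter.atTop (nhds 1) := by
  have h1 : (1 : ℝ) = ∫ _H : S.State, 1 ∂S.fadingLaw := by simp
  rw [h1]
  refine tendsto_integral_filter_of_dominated_convergence (fun _ => 1)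
    (Filter.Eventually.of_forall fun k =>
      (measurable_avgFactor (hls k) n).aestronglyMeasurable)
    (Filter.Eventually.of_forall fun k => Filter.Eventually.of_forall fun H => ?_)
    (integrable_const _) ?_
  · rw [Real.norm_eq_abs, abs_of_nonneg (avgFactor_mem H n).1]
    exact (avgFactor_mem H n).2
  · filter_upwards [ae_isGood (S := S) π] with H hH
    have h2 : Filter.Tendsto (fun k => lams k n) Filter.atTop (nhdsWithin 0 (Set.Ioi 0)) :=
      tendsto_nhdsWithin_iff.2 ⟨h0, Filter.Eventually.of_forall fun k => hls k n⟩
    refine tendsto_const_nhds.congr' ?_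
    filter_upwards [h2.eventually (eventually_modeFactor_eq_one hH n)] with k hk
    exact (sum_equalShare_mul H _ (hk (lams k) (hls k) rfl)).symm

/-! ### Maximizers of the dual function -/

/-- Where the dual function does not increase with `lam n`, the constraint of user `n` holds. -/
lemma meanFactor_le_target (hl : ∀ n, 0 < lam n) {n : Fin Kmu} {c : ℝ} (hc : 0 < c)
    (hmax : ∀ y, lam n < y → y ≤ lam n + c → S.dual π (Function.update lam n y) ≤ S.dual π lam) :
    S.meanFactor π lam n ≤ S.target n := by
  -- the supergradient inequality at slightly larger multipliers, followed by continuity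
  let lams : ℕ → Fin Kmu → ℝ := fun k => Function.update lam n (lam n + c / ((k : ℝ) + 1))
  have hpos : ∀ k : ℕ, 0 < c / ((k : ℝ) + 1) := fun k => by positivity
  have hls : ∀ k j, 0 < lams k j := fun k j => by
    by_cases hj : j = n
    · subst hj
      simp only [lams, Function.update_self]
      linarith [hl j, hpos k]
    · simp only [lams, Function.update_of_ne hj]; exact hl j
  have hlim : ∀ j, Filter.Tendsto (fun k => lams k j) Filter.atTop (nhds (lam j)) := fun j => by
    by_cases hj : j = n
    · subst hj
      simp only [lams, Function.update_self]
      have := (tendsto_one_div_add_atTop_nhds_zero_nat (𝕜 := ℝ)).const_mul c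
      simp only [mul_one_div, mul_zero] at this
      simpa using this.const_add (lam j)
    · simp only [lams, Function.update_of_ne hj]; exact tendsto_const_nhds
  refine le_of_tendsto (tendsto_meanFactor hl hls hlim n) (Filter.Eventually.of_forall fun k => ?_)
  have h1 := dual_le_add (S := S) (π := π) (hls k) hl
  have h2 := hmax (lam n + c / ((k : ℝ) + 1)) (by linarith [hpos k])
    (add_le_add_right (div_le_self hc.le (by linarith [Nat.cast_nonneg (α := ℝ) k])) _)
  have h3 : ∑ j, (lam j - lams k j) * (S.meanFactor π (lams k) j - S.target j) =
      -(c / ((k : ℝ) + 1)) * (S.meanFactor π (lams k) n - S.target n) := by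
    rw [Finset.sum_eq_single n (fun j _ hj => by simp [lams, Function.update_of_ne hj]) (by simp)]
    simp [lams]
  rw [h3] at h1
  have h4 : c / ((k : ℝ) + 1) * (S.meanFactor π (lams k) n - S.target n) ≤ 0 := by
    linarith
  exact sub_nonpos.1 (nonpos_of_mul_nonpos_right h4 (hpos k))

/-- Where the dual function does not increase when `lam n` decreases, the constraint of user `n`
is not slack. -/
lemma target_le_meanFactor (hl : ∀ n, 0 < lam n) {n : Fin Kmu} {c : ℝ} (hc : 0 < c)
    (hcl : c < lam n)
    (hmax : ∀ y, y < lam n → lam n - c ≤ y → S.dual π (Function.update lam n y) ≤ S.dual π lam) :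
    S.target n ≤ S.meanFactor π lam n := by
  let lams : ℕ → Fin Kmu → ℝ := fun k => Function.update lam n (lam n - c / ((k : ℝ) + 1))
  have hpos : ∀ k : ℕ, 0 < c / ((k : ℝ) + 1) := fun k => by positivity
  have hle : ∀ k : ℕ, c / ((k : ℝ) + 1) ≤ c := fun k =>
    div_le_self hc.le (by linarith [Nat.cast_nonneg (α := ℝ) k])
  have hls : ∀ k j, 0 < lams k j := fun k j => by
    by_cases hj : j = n
    · subst hj
      simp only [lams, Function.update_self]
      linarith [hle k]
    · simp only [lams, Function.update_of_ne hj]; exact hl j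
  have hlim : ∀ j, Filter.Tendsto (fun k => lams k j) Filter.atTop (nhds (lam j)) := fun j => by
    by_cases hj : j = n
    · subst hj
      simp only [lams, Function.update_self]
      have := (tendsto_one_div_add_atTop_nhds_zero_nat (𝕜 := ℝ)).const_mul c
      simp only [mul_one_div, mul_zero] at this
      simpa using this.const_sub (lam j)
    · simp only [lams, Function.update_of_ne hj]; exact tendsto_const_nhds
  refine ge_of_tendsto (tendsto_meanFactor hl hls hlim n) (Filter.Eventually.of_forall fun k => ?_)
  have h1 := dual_le_add (S := S) (π := π) (hls k) hl
  have h2 := hmax (lam n - c / ((k : ℝ) + 1)) (by linarith [hpos k]) (by linarith [hle k])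
  have h3 : ∑ j, (lam j - lams k j) * (S.meanFactor π (lams k) j - S.target j) =
      c / ((k : ℝ) + 1) * (S.meanFactor π (lams k) n - S.target n) := by
    rw [Finset.sum_eq_single n (fun j _ hj => by simp [lams, Function.update_of_ne hj]) (by simp)]
    simp [lams]
  rw [h3] at h1
  have h4 : 0 ≤ c / ((k : ℝ) + 1) * (S.meanFactor π (lams k) n - S.target n) := by
    linarith
  exact sub_nonneg.1 (nonneg_of_mul_nonneg_right h4 (hpos k))

/-- The dual function is at most the Lagrangian of any admissible policy. -/
lemma dual_le_of_admissible (hl : ∀ n, 0 < lam n) {p : S.Policy} (hp : p.Admissible) :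
    S.dual π lam ≤ p.usage + ∑ n, lam n * p.qos π n := by
  have h1 : ∫ H, minValue π lam H ∂S.fadingLaw ≤
      ∫ H, ∑ a, p.weight H a * modePsi π lam H (p.pow H) a ∂S.fadingLaw := by
    refine integral_mono_ae (integrable_minValue hl) hp.integrable_lagrangian ?_
    filter_upwards [hp.minValue_le_lagrangian (π := π) hl] with H h
    have := Finset.sum_nonneg fun a (_ : a ∈ Finset.univ) => h.1 a
    rw [← h.2] at this
    exact sub_nonneg.1 this
  rw [← hp.lagrangian_eq] at h1
  simp only [mul_add, Finset.sum_add_distrib] at h1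
  unfold dual target
  linarith

/-- Multipliers at which the mean factors meet the constraints with equality. They maximize the dual
function over a large box. -/
theorem exists_meanFactor_eq {p : S.Policy} (hp : p.StrictlyFeasible π) :
    ∃ lam : Fin Kmu → ℝ, (∀ n, 0 < lam n) ∧ ∀ n, S.meanFactor π lam n = S.target n := by
  -- with `Λ` as upper bound, the maximizer over a box does not touch the upper faces
  obtain ⟨n0, -, hn0⟩ := Finset.exists_max_image Finset.univ (fun n => p.qos π n)
    (Finset.univ_nonempty (α := Fin Kmu))
  set δ := -p.qos π n0 with hδdef
  have hδ : 0 < δ := neg_pos.2 (hp.2 n0)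
  set Λ : ℝ := (|p.usage| + Kmu) / δ + 1 with hΛ
  have hΛ1 : 1 ≤ Λ := by
    have : 0 ≤ (|p.usage| + Kmu) / δ := by positivity
    linarith
  let box : ℝ → Set (Fin Kmu → ℝ) := fun η => Set.pi Set.univ fun _ => Set.Icc η Λ
  have hbox : ∀ {η : ℝ} {lam : Fin Kmu → ℝ}, lam ∈ box η ↔ ∀ n, η ≤ lam n ∧ lam n ≤ Λ := by
    intro η lam; simp only [box, Set.mem_pi, Set.mem_univ, forall_const, Set.mem_Icc]
  have hone : -(Kmu : ℝ) ≤ S.dual π fun _ => 1 := by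
    have h1 : 0 ≤ ∫ H, minValue π (fun _ : Fin Kmu => (1 : ℝ)) H ∂S.fadingLaw :=
      integral_nonneg fun H => by
        obtain ⟨a, ha⟩ := exists_minValue_eq (π := π) (lam := fun _ => 1) H
        rw [← ha]; exact modeValue_nonneg (fun _ => one_pos) H a
    have h2 : ∑ n : Fin Kmu, 1 * S.target n ≤ Kmu := by
      calc ∑ n : Fin Kmu, 1 * S.target n ≤ ∑ n : Fin Kmu, (1 : ℝ) :=
            Finset.sum_le_sum fun n _ => by rw [one_mul]; exact (S.target_lt_one n).le
        _ = Kmu := by simp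
    unfold dual
    linarith
  have hex : ∀ k : ℕ, ∃ lam : Fin Kmu → ℝ, (∀ n, 1 / ((k : ℝ) + 1) ≤ lam n) ∧
      (∀ n, S.meanFactor π lam n ≤ S.target n) ∧
      ∀ n, 1 / ((k : ℝ) + 1) < lam n → S.target n ≤ S.meanFactor π lam n := by
    intro k
    set η : ℝ := 1 / ((k : ℝ) + 1) with hη
    have hη0 : 0 < η := by positivity
    have hη1 : η ≤ 1 := by
      rw [hη, div_le_one (by positivity)]; linarith [Nat.cast_nonneg (α := ℝ) k]
    have hcont : ContinuousOn (S.dual π) (box η) := by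
      intro lam hlam
      have hl : ∀ n, 0 < lam n := fun n => hη0.trans_le (hbox.1 hlam n).1
      have h1 : Filter.Tendsto (fun lam' : Fin Kmu → ℝ => ∑ n, |lam' n - lam n|)
          (nhdsWithin lam (box η)) (nhds 0) := by
        have : Continuous fun lam' : Fin Kmu → ℝ => ∑ n, |lam' n - lam n| := by fun_prop
        have h2 := (this.tendsto lam).mono_left (nhdsWithin_le_nhds (s := box η))
        simpa using h2
      refine tendsto_iff_dist_tendsto_zero.2 (squeeze_zero' ?_ ?_ h1)
      · exact Filter.Eventually.of_forall fun _ => dist_nonneg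
      · filter_upwards [self_mem_nhdsWithin] with lam' hlam'
        exact abs_dual_sub_le hl fun n => hη0.trans_le (hbox.1 hlam' n).1
    have hcomp : IsCompact (box η) := isCompact_univ_pi fun _ => isCompact_Icc
    have h1mem : (fun _ => 1 : Fin Kmu → ℝ) ∈ box η := hbox.2 fun _ => ⟨hη1, hΛ1⟩
    obtain ⟨lam, hlam, hmax⟩ := hcomp.exists_isMaxOn ⟨_, h1mem⟩ hcont
    have hl : ∀ n, 0 < lam n := fun n => hη0.trans_le (hbox.1 hlam n).1
    have hupd : ∀ n y, η ≤ y → y ≤ Λ → S.dual π (Function.update lam n y) ≤ S.dual π lam := by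
      intro n y hy1 hy2
      refine hmax (hbox.2 fun j => ?_)
      by_cases hj : j = n
      · subst hj; simp only [Function.update_self]; exact ⟨hy1, hy2⟩
      · simp only [Function.update_of_ne hj]; exact hbox.1 hlam j
    have hlt : ∀ n, lam n < Λ := by
      intro n
      have h2 := dual_le_of_admissible (π := π) hl hp.1
      have h3 : ∑ n, lam n * p.qos π n ≤ -(δ * lam n) := by
        calc ∑ n, lam n * p.qos π n ≤ ∑ n, lam n * -δ :=
              Finset.sum_le_sum fun n _ => mul_le_mul_of_nonneg_left
                (by rw [hδdef, neg_neg]; exact hn0 n (Finset.mem_univ n)) (hl n).le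
          _ = -(δ * ∑ n, lam n) := by rw [← Finset.sum_mul]; ring
          _ ≤ _ := neg_le_neg (mul_le_mul_of_nonneg_left
                (Finset.single_le_sum (fun n _ => (hl n).le) (Finset.mem_univ n)) hδ.le)
      have h4 : S.dual π (fun _ => 1) ≤ S.dual π lam := hmax h1mem
      have h5 : lam n ≤ (|p.usage| + Kmu) / δ := by
        rw [le_div_iff₀ hδ]
        linarith [le_abs_self p.usage]
      linarith
    refine ⟨lam, fun n => (hbox.1 hlam n).1, fun n => ?_, fun n hn => ?_⟩
    · refine meanFactor_le_target hl (sub_pos.2 (hlt n)) fun y hy1 hy2 => ?_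
      exact hupd n y ((hbox.1 hlam n).1.trans hy1.le) (by linarith)
    · refine target_le_meanFactor hl (sub_pos.2 hn) (by linarith) fun y hy1 hy2 => ?_
      exact hupd n y (by linarith) (hy1.le.trans (hbox.1 hlam n).2)
  choose lams h1 h2 h3 using hex
  have hls : ∀ k n, 0 < lams k n := fun k n =>
    (by positivity : (0 : ℝ) < 1 / ((k : ℝ) + 1)).trans_le (h1 k n)
  by_contra hno
  push Not at hno
  -- otherwise each box has a maximizer on a lower face; along a subsequence it is the face of one
  -- user `n`, whose mean factor then tends to `1`
  have h4 : ∀ k, ∃ n, lams k n = 1 / ((k : ℝ) + 1) := by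
    intro k
    obtain ⟨n, hn⟩ := hno (lams k) (hls k)
    refine ⟨n, le_antisymm (not_lt.1 fun hlt => hn ?_) (h1 k n)⟩
    exact le_antisymm (h2 k n) (h3 k n hlt)
  choose N hN using h4
  obtain ⟨n, hn⟩ := Finite.exists_infinite_fiber N
  have hinf : (N ⁻¹' {n}).Infinite := Set.infinite_coe_iff.1 hn
  let f : ℕ → ℕ := Nat.nth fun k => N k = n
  have hf : StrictMono f := Nat.nth_strictMono hinf
  have hfN : ∀ k, N (f k) = n := fun k => Nat.nth_mem_of_infinite hinf k
  have h5 : Filter.Tendsto (fun k => lams (f k) n) Filter.atTop (nhds 0) := by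
    refine ((tendsto_one_div_add_atTop_nhds_zero_nat (𝕜 := ℝ)).comp hf.tendsto_atTop).congr
      fun k => ?_
    rw [Function.comp_apply, ← hN (f k), hfN]
  have h6 := tendsto_meanFactor_of_tendsto_zero (S := S) (π := π) (fun k => hls (f k)) h5
  have h7 := le_of_tendsto h6 (Filter.Eventually.of_forall fun k => h2 (f k) n)
  exact absurd h7 (not_le.2 (S.target_lt_one n))

/-- The policy that shares the probability equally among the best modes and uses the optimal
powers. -/
def dualPolicy (π : Equiv.Perm (Fin Kmu)) (lam : Fin Kmu → ℝ) : S.Policy where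
  φ H L := equalShare π lam H (.inl L)
  q H l n := equalShare π lam H (.inr (l, n))
  pow H L := modePower π lam H (.inl L)

theorem exists_hasOptimalForm {p : S.Policy} (hp : p.StrictlyFeasible π) :
    ∃ (lam : Fin Kmu → ℝ) (ζ : S.State → Fin (Kbs + 1) → ℝ) (p : S.Policy),
      p.HasOptimalForm π lam ζ := by
  classical
  obtain ⟨lam, hl, hmean⟩ := exists_meanFactor_eq hp
  let p : S.Policy := dualPolicy π lam
  let ζ : S.State → Fin (Kbs + 1) → ℝ := fun H L =>
    if hH : S.IsGood π H then (modePower_spec (π := π) hl hH (.inl L)).choose else 1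
  have hζ : ∀ H, S.IsGood π H → ∀ L,
      IsAllocation (modeSub π H (.inl L)) S.beta lam (ζ H L) (modePower π lam H (.inl L)) := by
    intro H hH L
    simp only [ζ, dif_pos hH]
    exact (modePower_spec (π := π) hl hH (.inl L)).choose_spec.1
  have hgood := ae_isGood (S := S) π
  refine ⟨lam, ζ, p, hl, ?_, ?_, ?_, ?_, fun n => ?_⟩
  · filter_upwards [hgood] with H hH L _ using (hζ H hH L).zeta_pos
  · filter_upwards [hgood] with H hH L
    exact ⟨(isModifiedWaterFilling_iff hl (hζ H hH L).zeta_pos).2 (hζ H hH L),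
      (modePower_spec (π := π) hl hH (.inl L)).sum_eq⟩
  · filter_upwards [hgood] with H hH L
    exact (share_eq_equalShare hl hH (P := p.pow H) (fun _ => rfl) (.inl L)).symm
  · filter_upwards [hgood] with H hH l n
    have := share_eq_equalShare hl hH (P := p.pow H) (fun _ => rfl) (.inr (l, n))
    simp only [← psiSingle_eq] at this
    exact this.symm
  · rw [Policy.qos_eq, sub_eq_zero]
    refine Eq.trans (integral_congr_ae ?_) (hmean n)
    filter_upwards [hgood] with H hH
    refine Finset.sum_congr rfl fun a _ => ?_
    have h1 : p.weight H a = equalShare π lam H a := by rcases a with L | x <;> rfl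
    rw [h1, Policy.factor, modeAlloc_modePower hl hH (P := p.pow H) fun _ => rfl]
    rfl

end DownlinkSystem

end

theorem theorem1 {Kbs Kmu : ℕ} [NeZero Kbs] [NeZero Kmu] (S : DownlinkSystem Kbs Kmu)
    (π : Equiv.Perm (Fin Kmu)) (hπ : S.IsPriorityOrder π) :
    -- for given multipliers, the water level and the breakpoint index are well defined, and the
    -- power constraint determines `ζ`
    (∀ lam : Fin Kmu → ℝ, (∀ n, 0 < lam n) →
      (∀ (H : S.State) (L : Fin (Kbs + 1)) (z : ℝ), 0 < z → ∀ n ∈ S.activeUsers π H L,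
        ∃! w : ℝ × ℕ, S.IsWaterLevel π lam H L z n w) ∧
      (∀ᵐ H ∂S.fadingLaw, ∀ L : Fin (Kbs + 1), L ≠ 0 → ∃! z : ℝ, 0 < z ∧
        ∃ P : Fin Kmu → ℝ, S.IsModifiedWaterFilling π lam H L z P ∧
          ∑ n, P n = S.totalPower L)) ∧
    -- a policy of the asserted form is optimal, and every optimal policy agrees with it
    (∀ (lam : Fin Kmu → ℝ) (ζ : S.State → Fin (Kbs + 1) → ℝ) (p : S.Policy),
      p.HasOptimalForm π lam ζ →
      p.IsOptimal π ∧
      ∀ p' : S.Policy, p'.IsOptimal π →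
        (∀ n, p'.qos π n = 0) ∧
        ∀ᵐ H ∂S.fadingLaw,
          (∀ L, 0 < p'.φ H L →
            S.psiMulti π lam H (p.pow H) L = S.psiStar π lam H (p.pow H) ∧
            p'.pow H L = p.pow H L) ∧
          (∀ l n, 0 < p'.q H l n →
            S.psiSingle lam H l n = S.psiStar π lam H (p.pow H))) ∧
    -- such a policy exists
    ((∃ p : S.Policy, p.StrictlyFeasible π) →
      ∃ (lam : Fin Kmu → ℝ) (ζ : S.State → Fin (Kbs + 1) → ℝ) (p : S.Policy),
        p.HasOptimalForm π lam ζ) := by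
  refine ⟨fun lam hl => ⟨fun H L z hz n _ => S.existsUnique_isWaterLevel H L hz (hl n), ?_⟩,
    fun lam ζ p hp => ⟨hp.isOptimal, fun p' hp' => hp.of_isOptimal hp'⟩,
    fun ⟨p, hp⟩ => DownlinkSystem.exists_hasOptimalForm hp⟩
  filter_upwards [DownlinkSystem.ae_isGood (S := S) π] with H hH L hL
  exact DownlinkSystem.existsUnique_zeta hl hH hL
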